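/- **Definitions.** An *abstract network* is a finite list $\mathcal N=[\mathcal I_1,\dots,\mathcal I_m]$ of finite sets of indices in which every index that occurs at all occurs at exactly two positions of the list; $|\mathcal N|=m$. Its graph $G(\mathcal N)$ is the loopless multigraph with vertices $1,\dots,m$ and, for all $j\ne j'$ and each $i\in\mathcal I_j\cap\mathcal I_{j'}$, one edge between $j$ and $j'$ labelled $i$; $\mathcal N$ is connected if $G(\mathcal N)$ is. Let $\Pi(d)=\{|b_1\rangle\langle b_2| : 0\le b_1,b_2<d\}$. A $d$-state tensor with index set $\mathcal I$ is a map $g:\Pi(d)^{\mathcal I}\to\mathbb C$, with norm $\|g\|=\max_\sigma|g(\sigma)|$. The contraction of tensors $g,g'$ with index sets $\mathcal I,\mathcal I'$ is the tensor with index set $\mathcal I\oplus\mathcal I'$ (symmetric difference) obtained from $g\cdot g'$ by summing over all values of the indices in $\mathcal I\cap\mathcal I'$. If $\mathcal N$ is connected and $\lambda$ assigns to each position $j$ a tensor $\lambda_j$ with index set $\mathcal I_j$, then $m-1$ successive contractions of pairs of tensors with a common index leave a single number, whose absolute value $\mathrm{val}(\mathcal N,\lambda)$ does not depend on the order of the contractions.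 A *feasibility tensor network* $(\mathcal N,\Lambda)$ consists of an abstract network and, for each $j$, a finite set $\Lambda_j$ of $d$-state tensors with index set $\mathcal I_j$. An *initialization* is a choice $\lambda$ of $\lambda_j\in\Lambda_j$ for all $j$, and $\mathrm{VAL}(\mathcal N,\Lambda)=\max_\lambda \mathrm{val}(\mathcal N,\lambda)$ over all initializations $\lambda$. Call $(\mathcal N,\Lambda)$ *normalized* if, for each initialization $\lambda$, the tensors $\lambda_j$ and all tensors that arise from them by successive contractions of pairs with a common index (each $\lambda_j$ being used at most once) have norm at most $1$. **Theorem.** There are a deterministic algorithm $A$ and a constant $C\in\mathbb N$ such that the following holds. Let $d\ge 2$, and let $(\mathcal N,\Lambda)$ be a normalized feasibility tensor network of $d$-state tensors, with $\mathcal N$ connected and all sets $\Lambda_j$ nonempty, such that $G(\mathcal N)$ has treewidth $t$ and maximum degree $\Delta$. Let $\delta$ be a rational number with $0<\delta<1$. Let the input of $A$ consist of $d$, $\delta$, $\mathcal N$ and, for each $j$, a list of the elements of $\Lambda_j$, where each tensor is given by a table of Gaussian rationals (written in binary) that approximate its entries with error at most $\bigl(\delta/(2|\mathcal N|)\bigr)^{\exp(C\,\Delta\,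 t\,\log d)}$ (in particular, the table may be exact if the entries are Gaussian rationals). Let $L$ be the size of this input. Then $A$ outputs, after at most $$\Bigl(\frac{|\mathcal N|}{\delta}\Bigr)^{\exp(C\,\Delta\, t\,\log d)}+L^{C}$$ steps, (the list of the positions of the chosen tensors of) an initialization $\lambda$ of $(\mathcal N,\Lambda)$ such that $$|\mathrm{val}(\mathcal N,\lambda)-\mathrm{VAL}(\mathcal N,\Lambda)|\le\delta .$$ Steps are counted for programs on binary trees, whose unit-cost operations are to build a leaf or a pair of two trees, to take a component of a pair, and to test whether a tree is a leaf, under composition, branching and while loops; this model is polynomially equivalent to Turing machines. -/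

import Mathlib

/-! ### Multigraphs: degree, connectedness, treewidth -/

/-- The number of edges incident with `v` (used for loopless multigraphs, so that every incident
edge counts once; parallel edges count separately). -/
noncomputable def Graph.edgeDegree {V E : Type*} (G : Graph V E) (v : V) : ℕ :=
  {e : E | G.Inc e v}.ncard

noncomputable def Graph.maximumDegree {V E : Type*} [Fintype V] (G : Graph V E) : ℕ :=
  Finset.univ.sup G.edgeDegree

/-- The simple graph on the vertex set of `G` that forgets edge labels and multiplicities. -/
def Graph.underlying {V E : Type*} (G : Graph V E) : SimpleGraph G.vertexSet where
  Adj v w := v ≠ w ∧ ∃ e, G.IsLink e v w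
  symm := ⟨fun _ _ h => ⟨h.1.symm, h.2.imp fun _ he => he.symm⟩⟩
  loopless := ⟨fun _ h => h.1 rfl⟩

/-- `G` has a tree decomposition of width at most `w`: a finite tree `T` and a bag `β u` of
vertices at each node `u`, such that the bags cover the vertices and the edges, the nodes whose
bags hold a given vertex induce a connected subtree, and each bag has at most `w + 1` elements. -/
def Graph.HasTreeDecomposition {V E : Type*} (G : Graph V E) (w : ℕ) : Prop :=
  ∃ (n : ℕ) (T : SimpleGraph (Fin n)) (β : Fin n → Finset V),
    T.IsTree ∧
    (⋃ u, (β u : Set V)) = G.vertexSet ∧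
    (∀ e v v', G.IsLink e v v' → ∃ u, v ∈ β u ∧ v' ∈ β u) ∧
    (∀ v ∈ G.vertexSet, (T.induce {u | v ∈ β u}).Connected) ∧
    ∀ u, (β u).card ≤ w + 1

/-- The minimum width of a tree decomposition. -/
noncomputable def Graph.treeWidth {V E : Type*} (G : Graph V E) : ℕ :=
  sInf {w | G.HasTreeDecomposition w}

/-! ### Abstract networks and contraction trees -/

/-- A list `I 0, …, I (size - 1)` of finite index sets such that each index that occurs at all
occurs at exactly two positions of the list. -/
structure AbstractNetwork where
  size : ℕ
  I : Fin size → Finset ℕ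
  two : ∀ j, ∀ i ∈ I j, (Finset.univ.filter fun k => i ∈ I k).card = 2

namespace AbstractNetwork

/-- An index that occurs at two distinct positions occurs nowhere else. -/
theorem eq_or_eq (N : AbstractNetwork) {i : ℕ} {a b c : Fin N.size} (hab : a ≠ b)
    (ha : i ∈ N.I a) (hb : i ∈ N.I b) (hc : i ∈ N.I c) : c = a ∨ c = b := by
  classical
  by_contra h
  push Not at h
  have h3 : ({a, b, c} : Finset (Fin N.size)) ⊆ Finset.univ.filter fun k => i ∈ N.I k := by
    intro x hx
    simp only [Finset.mem_insert, Finset.mem_singleton] at hx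
    rcases hx with rfl | rfl | rfl <;> simpa
  have h4 := Finset.card_le_card h3
  rw [N.two a i ha, Finset.card_eq_three.2 ⟨a, b, c, hab, h.1.symm, h.2.symm, rfl⟩] at h4
  omega

/-- The multigraph of a network: a vertex for each position of the list, and for each pair of
distinct positions and each index common to both an edge that is labelled with this index. -/
def graph (N : AbstractNetwork) : Graph (Fin N.size) ℕ where
  vertexSet := Set.univ
  IsLink i a b := a ≠ b ∧ i ∈ N.I a ∧ i ∈ N.I b
  isLink_symm := fun _ _ => ⟨fun _ _ h => ⟨h.1.symm, h.2.2, h.2.1⟩⟩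
  eq_or_eq_of_isLink_of_isLink := fun _ _ _ _ _ h h' =>
    N.eq_or_eq h'.1 h'.2.1 h'.2.2 h.2.1
  left_mem_of_isLink := fun _ _ _ _ => Set.mem_univ _

def IsConnected (N : AbstractNetwork) : Prop := N.graph.underlying.Connected

end AbstractNetwork

/-- Binary trees with leaves labelled by positions of a list of length `m`. -/
inductive ContractionTree (m : ℕ) : Type
  | leaf (j : Fin m) : ContractionTree m
  | node (l r : ContractionTree m) : ContractionTree m

namespace ContractionTree

def leaves {m : ℕ} : ContractionTree m → List (Fin m)
  | leaf j => [j]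
  | node l r => l.leaves ++ r.leaves

/-- The index set at the root: that of the network at a leaf, and the symmetric difference of the
index sets of the two children at an internal node. -/
def index (N : AbstractNetwork) : ContractionTree N.size → Finset ℕ
  | leaf j => N.I j
  | node l r => symmDiff (l.index N) (r.index N)

/-- At each internal node the index sets of the two children have a common index. -/
def Contractible (N : AbstractNetwork) : ContractionTree N.size → Prop
  | leaf _ => True
  | node l r => l.Contractible N ∧ r.Contractible N ∧ (l.index N ∩ r.index N).Nonempty

/-- `T` describes a way of contracting some (not necessarily all) of the index sets of `N` into a
single one. -/
def IsPartial {N : AbstractNetwork} (T : ContractionTree N.size) : Prop :=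
  T.leaves.Nodup ∧ T.Contractible N

/-- `T` is a contraction tree for the whole network `N`: its leaves are in bijection with the
positions of the list. -/
def IsFull {N : AbstractNetwork} (T : ContractionTree N.size) : Prop :=
  T.IsPartial ∧ ∀ j, j ∈ T.leaves

end ContractionTree

/-! ### Tensors, tensor networks and their values -/

/-- A `d`-state tensor with index set `I`: an array of complex numbers, each index of `I` ranging
over `Π(d) = {|b₁⟩⟨b₂| : b₁, b₂ < d}`. The norm of Mathlib on this function space is the maximum
of the absolute values of the entries. -/
abbrev Tensor (d : ℕ) (I : Finset ℕ) : Type := (I → Fin d × Fin d) → ℂ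

/-- The contraction of two tensors: the sum over all values of the common indices. -/
noncomputable def Tensor.contr {d : ℕ} {I J : Finset ℕ} (g : Tensor d I) (h : Tensor d J) :
    Tensor d (symmDiff I J) := fun τ =>
  ∑ ρ : (I ∩ J : Finset ℕ) → Fin d × Fin d,
    g (fun i => if hi : (i : ℕ) ∈ J then ρ ⟨i, Finset.mem_inter.2 ⟨i.2, hi⟩⟩
      else τ ⟨i, Finset.mem_symmDiff.2 (Or.inl ⟨i.2, hi⟩)⟩) *
    h (fun j => if hj : (j : ℕ) ∈ I then ρ ⟨j, Finset.mem_inter.2 ⟨hj, j.2⟩⟩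
      else τ ⟨j, Finset.mem_symmDiff.2 (Or.inr ⟨j.2, hj⟩)⟩)

/-- A choice of a tensor for each index set of the network; `(N, lam)` is a tensor network. -/
abbrev AbstractNetwork.Labelling (N : AbstractNetwork) (d : ℕ) : Type :=
  ∀ j : Fin N.size, Tensor d (N.I j)

/-- The tensor that results at the root when the tensors of `(N, lam)` are contracted along `T`. -/
noncomputable def ContractionTree.simulate {N : AbstractNetwork} {d : ℕ} (lam : N.Labelling d) :
    (T : ContractionTree N.size) → Tensor d (T.index N)
  | leaf j => lam j
  | node l r => (l.simulate lam).contr (r.simulate lam)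

open Classical in
/-- The value of a tensor network: the absolute value of the rank-zero tensor (its norm, since it
has a single entry) that results from contracting the whole network. It does not depend on the
chosen contraction, see `AbstractNetwork.val_eq` below. -/
noncomputable def AbstractNetwork.val (N : AbstractNetwork) {d : ℕ} (lam : N.Labelling d) : ℝ :=
  if h : ∃ T : ContractionTree N.size, T.IsFull then ‖h.choose.simulate lam‖ else 0

/-! ### The value does not depend on the contraction -/

namespace ContractionTree

variable {N : AbstractNetwork} {d : ℕ}

/-- The number of leaves of `T` whose index set contains `i`. -/
def occ (T : ContractionTree N.size) (i : ℕ) : ℕ :=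
  (T.leaves.filter fun j => i ∈ N.I j).length

theorem occ_node (l r : ContractionTree N.size) (i : ℕ) :
    (node l r).occ i = l.occ i + r.occ i := by
  simp [occ, leaves]

theorem occ_eq_card {T : ContractionTree N.size} (hT : T.leaves.Nodup) (i : ℕ) :
    T.occ i = (Finset.univ.filter fun j => j ∈ T.leaves ∧ i ∈ N.I j).card := by
  rw [occ, ← List.toFinset_card_of_nodup (hT.filter _)]
  congr 1
  ext j
  simp

theorem occ_le_two {T : ContractionTree N.size} (hT : T.leaves.Nodup) (i : ℕ) : T.occ i ≤ 2 := by
  rw [occ_eq_card hT]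
  by_cases h : ∃ j, i ∈ N.I j
  · obtain ⟨j, hj⟩ := h
    rw [← N.two j i hj]
    apply Finset.card_le_card
    intro k
    simp +contextual
  · push Not at h
    simp [h]

theorem mem_index {T : ContractionTree N.size} (hT : T.leaves.Nodup) (i : ℕ) :
    i ∈ T.index N ↔ T.occ i = 1 := by
  induction T with
  | leaf j => by_cases h : i ∈ N.I j <;> simp [index, occ, leaves, h]
  | node l r ihl ihr =>
    have h2 := occ_le_two hT i
    have hT' := hT
    rw [leaves, List.nodup_append] at hT'
    rw [index, Finset.mem_symmDiff, ihl hT'.1, ihr hT'.2.1, occ_node]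
    rw [occ_node] at h2
    omega

/-- The indices that are summed over in the course of the contraction. -/
def inner (T : ContractionTree N.size) : Finset ℕ :=
  (Finset.univ.biUnion N.I).filter fun i => T.occ i = 2

theorem mem_inner {T : ContractionTree N.size} {i : ℕ} : i ∈ T.inner ↔ T.occ i = 2 := by
  simp only [inner, Finset.mem_filter, Finset.mem_biUnion, Finset.mem_univ, true_and,
    and_iff_right_iff_imp]
  intro h
  by_contra hne
  push Not at hne
  simp [occ, hne] at h

theorem occ_pos {T : ContractionTree N.size} {i : ℕ} {j : Fin N.size} (hj : j ∈ T.leaves)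
    (hi : i ∈ N.I j) : 0 < T.occ i :=
  List.length_pos_iff_exists_mem.2 ⟨j, by simp [hj, hi]⟩

/-- The product of the entries of all tensors at the leaves, the indices having the values `σ`. -/
noncomputable def leafProd (lam : N.Labelling d) (T : ContractionTree N.size)
    (σ : ℕ → Fin d × Fin d) : ℂ :=
  (T.leaves.map fun j => lam j fun i => σ i).prod

theorem leafProd_congr (lam : N.Labelling d) (T : ContractionTree N.size)
    {σ σ' : ℕ → Fin d × Fin d} (h : ∀ i, 0 < T.occ i → σ i = σ' i) :
    T.leafProd lam σ = T.leafProd lam σ' := by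
  unfold leafProd
  congr 1
  apply List.map_congr_left
  intro j hj
  congr 1
  funext i
  exact h i (occ_pos hj i.2)

theorem sum_updateFinset {A B : Finset ℕ} (hAB : Disjoint A B) (f : (ℕ → Fin d × Fin d) → ℂ)
    (σ : ℕ → Fin d × Fin d) :
    ∑ ρ : A → Fin d × Fin d, ∑ ρ' : B → Fin d × Fin d,
        f (Function.updateFinset (Function.updateFinset σ A ρ) B ρ') =
      ∑ ρ : (A ∪ B : Finset ℕ) → Fin d × Fin d, f (Function.updateFinset σ (A ∪ B) ρ) := by
  rw [← Fintype.sum_prod_type']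
  refine Fintype.sum_equiv (Equiv.piFinsetUnion (fun _ => Fin d × Fin d) hAB) _ _ ?_
  rintro ⟨ρ, ρ'⟩
  rw [Function.updateFinset_updateFinset hAB]

theorem simulate_eq (lam : N.Labelling d) {T : ContractionTree N.size} (hT : T.leaves.Nodup)
    (σ : ℕ → Fin d × Fin d) :
    T.simulate lam (fun i => σ i) =
      ∑ ρ : T.inner → Fin d × Fin d, T.leafProd lam (Function.updateFinset σ T.inner ρ) := by
  induction T generalizing σ with
  | leaf j =>
    have h0 : (leaf j : ContractionTree N.size).inner = ∅ := by
      ext i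
      rw [mem_inner]
      by_cases h : i ∈ N.I j <;> simp [occ, leaves, h]
    rw [h0]
    simp [simulate, leafProd, leaves]
    rfl
  | node l r ihl ihr =>
    have h2 := occ_le_two hT
    simp only [occ_node] at h2
    have hT' := hT
    rw [leaves, List.nodup_append] at hT'
    have hl := hT'.1
    have hr := hT'.2.1
    have hA : ∀ i, i ∈ l.index N ∩ r.index N ↔ l.occ i = 1 ∧ r.occ i = 1 := fun i => by
      rw [Finset.mem_inter, mem_index hl, mem_index hr]
    have d1 : Disjoint (l.index N ∩ r.index N) l.inner := by
      rw [Finset.disjoint_left]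
      intro i hi hi'
      rw [hA] at hi
      rw [mem_inner] at hi'
      omega
    have d2 : Disjoint ((l.index N ∩ r.index N) ∪ l.inner) r.inner := by
      rw [Finset.disjoint_left]
      intro i hi hi'
      rw [Finset.mem_union, hA, mem_inner] at hi
      rw [mem_inner] at hi'
      have := h2 i
      omega
    have hu : (node l r : ContractionTree N.size).inner =
        ((l.index N ∩ r.index N) ∪ l.inner) ∪ r.inner := by
      ext i
      rw [Finset.mem_union, Finset.mem_union, hA, mem_inner, mem_inner, mem_inner, occ_node]
      have := h2 i
      omega
    have hP : ∀ σ, (node l r : ContractionTree N.size).leafProd lam σ =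
        l.leafProd lam σ * r.leafProd lam σ := fun σ => by simp [leafProd, leaves]
    rw [hu, ← sum_updateFinset d2, ← sum_updateFinset d1 fun σ' =>
      ∑ ρ' : r.inner → Fin d × Fin d, (node l r : ContractionTree N.size).leafProd lam
        (Function.updateFinset σ' r.inner ρ')]
    simp only [simulate, Tensor.contr]
    refine Finset.sum_congr rfl fun ρ _ => ?_
    have e1 : (fun i : l.index N => if hi : (i : ℕ) ∈ r.index N then
          ρ ⟨i, Finset.mem_inter.2 ⟨i.2, hi⟩⟩ else σ i) =
        fun i : l.index N => Function.updateFinset σ (l.index N ∩ r.index N) ρ i := by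
      funext i
      by_cases hi : (i : ℕ) ∈ r.index N <;> simp [Function.updateFinset, hi]
    have e2 : (fun i : r.index N => if hi : (i : ℕ) ∈ l.index N then
          ρ ⟨i, Finset.mem_inter.2 ⟨hi, i.2⟩⟩ else σ i) =
        fun i : r.index N => Function.updateFinset σ (l.index N ∩ r.index N) ρ i := by
      funext i
      by_cases hi : (i : ℕ) ∈ l.index N <;> simp [Function.updateFinset, hi]
    rw [e1, e2, ihl hl, ihr hr, Finset.sum_mul_sum]
    refine Finset.sum_congr rfl fun ρ₁ _ => Finset.sum_congr rfl fun ρ₂ _ => ?_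
    rw [hP]
    congr 1
    · apply leafProd_congr
      intro i hi
      have : i ∉ r.inner := by
        rw [mem_inner]
        have := h2 i
        omega
      simp [Function.updateFinset, this]
    · apply leafProd_congr
      intro i hi
      have : i ∉ l.inner := by
        rw [mem_inner]
        have := h2 i
        omega
      simp [Function.updateFinset, this]

theorem norm_simulate_eq (hd : 0 < d) (lam : N.Labelling d) {T T' : ContractionTree N.size}
    (hT : T.IsFull) (hT' : T'.IsFull) : ‖T.simulate lam‖ = ‖T'.simulate lam‖ := by
  have hp : T.leaves.Perm T'.leaves :=
    (List.perm_ext_iff_of_nodup hT.1.1 hT'.1.1).2 fun j => by simp [hT.2 j, hT'.2 j]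
  have ho : ∀ i, T.occ i = T'.occ i := fun i => (hp.filter _).length_eq
  have hi : T.inner = T'.inner := by
    ext i
    rw [mem_inner, mem_inner, ho]
  have hN : ∀ {S : ContractionTree N.size}, S.IsFull → S.index N = ∅ := by
    intro S hS
    rw [Finset.eq_empty_iff_forall_notMem]
    intro i h
    rw [mem_index hS.1.1, occ_eq_card hS.1.1] at h
    simp only [hS.2, true_and] at h
    obtain ⟨j, hj⟩ := Finset.card_pos.1 (h ▸ Nat.one_pos)
    rw [N.two j i (Finset.mem_filter.1 hj).2] at h
    omega
  let σ : ℕ → Fin d × Fin d := fun _ => (⟨0, hd⟩, ⟨0, hd⟩)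
  have key : ∀ {S : ContractionTree N.size}, S.IsFull →
      ‖S.simulate lam‖ = ‖S.simulate lam (fun i => σ i)‖ := by
    intro S hS
    have : IsEmpty (S.index N) := by
      rw [hN hS]
      infer_instance
    apply le_antisymm
    · rw [pi_norm_le_iff_of_nonneg (norm_nonneg _)]
      intro τ
      rw [Subsingleton.elim τ (fun i => σ i)]
    · exact norm_le_pi_norm (S.simulate lam) _
  rw [key hT, key hT', simulate_eq lam hT.1.1, simulate_eq lam hT'.1.1, hi]
  congr 1
  refine Finset.sum_congr rfl fun ρ _ => ?_
  exact (hp.map _).prod_eq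

theorem exists_isFull (hN : N.IsConnected) : ∃ T : ContractionTree N.size, T.IsFull := by
  have step : ∀ k, k < N.size → ∃ T : ContractionTree N.size,
      T.IsPartial ∧ T.leaves.length = k + 1 := by
    intro k
    induction k with
    | zero => exact fun h => ⟨leaf ⟨0, h⟩, ⟨by simp [leaves], trivial⟩, by simp [leaves]⟩
    | succ k ih =>
      intro hk
      obtain ⟨T, hT, hlen⟩ := ih (by omega)
      have hne : ∃ b, b ∉ T.leaves := by
        by_contra h
        push Not at h
        have : T.leaves.toFinset = Finset.univ := by
          ext j
          simp [h j]
        have h3 := List.toFinset_card_of_nodup hT.1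
        rw [this, Finset.card_univ, Fintype.card_fin] at h3
        omega
      obtain ⟨b₀, hb₀⟩ := hne
      have hne' : ∃ a, a ∈ T.leaves := List.length_pos_iff_exists_mem.1 (by omega)
      obtain ⟨a₀, ha₀⟩ := hne'
      obtain ⟨w⟩ := hN.preconnected ⟨a₀, Set.mem_univ _⟩ ⟨b₀, Set.mem_univ _⟩
      obtain ⟨e, -, ha, hb⟩ := w.exists_boundary_dart {x | x.1 ∈ T.leaves} ha₀ hb₀
      obtain ⟨-, i, hab, hia, hib⟩ := e.adj
      refine ⟨node T (leaf e.snd.1), ⟨?_, hT.2, trivial, i, ?_⟩, by simp [leaves, hlen]⟩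
      · rw [leaves, List.nodup_append]
        refine ⟨hT.1, by simp [leaves], ?_⟩
        intro x hx y hy hxy
        simp only [leaves, List.mem_singleton] at hy
        exact hb (show e.snd.1 ∈ T.leaves by rw [← hy, ← hxy]; exact hx)
      · rw [Finset.mem_inter, mem_index hT.1, occ_eq_card hT.1]
        refine ⟨Finset.card_eq_one.2 ⟨e.fst.1, ?_⟩, hib⟩
        ext j
        simp only [Finset.mem_filter, Finset.mem_univ, true_and, Finset.mem_singleton]
        constructor
        · rintro ⟨h1, h2⟩
          rcases N.eq_or_eq hab hia hib h2 with h | h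
          · exact h
          · exact absurd (show e.snd.1 ∈ T.leaves from h ▸ h1) hb
        · rintro rfl
          exact ⟨ha, hia⟩
  have hpos : 0 < N.size := (hN.nonempty.some : N.graph.vertexSet).1.pos
  obtain ⟨T, hT, hlen⟩ := step (N.size - 1) (by omega)
  refine ⟨T, hT, fun j => ?_⟩
  have h3 := List.toFinset_card_of_nodup hT.1
  have : T.leaves.toFinset = Finset.univ :=
    Finset.eq_univ_of_card _ (by rw [h3, hlen, Fintype.card_fin]; omega)
  rw [← List.mem_toFinset, this]
  exact Finset.mem_univ j

end ContractionTree

/-- The value of a tensor network can be computed by means of any contraction tree (and a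
connected network has one, see `ContractionTree.exists_isFull`). -/
theorem AbstractNetwork.val_eq {N : AbstractNetwork} {d : ℕ} (hd : 0 < d) (lam : N.Labelling d)
    {T : ContractionTree N.size} (hT : T.IsFull) : N.val lam = ‖T.simulate lam‖ := by
  have h : ∃ T : ContractionTree N.size, T.IsFull := ⟨T, hT⟩
  rw [AbstractNetwork.val, dif_pos h]
  exact ContractionTree.norm_simulate_eq hd lam h.choose_spec hT

/-! ### Feasibility tensor networks -/

/-- An abstract network with a finite set of `d`-state tensors for each of its index sets. -/
structure FeasibilityNetwork (d : ℕ) where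
  net : AbstractNetwork
  tensors : ∀ j : Fin net.size, Finset (Tensor d (net.I j))

namespace FeasibilityNetwork

variable {d : ℕ}

/-- A choice of one tensor from each of the sets. -/
def Initialization (F : FeasibilityNetwork d) : Type :=
  {lam : F.net.Labelling d // ∀ j, lam j ∈ F.tensors j}

/-- The maximum value of an initialization (there are finitely many, so that the supremum is a
maximum as soon as there is one). -/
noncomputable def VAL (F : FeasibilityNetwork d) : ℝ :=
  ⨆ lam : F.Initialization, F.net.val lam.1

/-- Tensors have norm at most one: this is demanded of the tensors of an initialization and of
those that arise from them in the course of a contraction of the network. -/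
def IsNormalized (F : FeasibilityNetwork d) : Prop :=
  ∀ (lam : F.Initialization) (T : ContractionTree F.net.size), T.IsPartial →
    ‖T.simulate lam.1‖ ≤ 1

/-- A presentation of `F` by finite data: a list of the elements of each of the sets of tensors,
and, for each tensor of these lists, a table of Gaussian rationals `a + b i`, given as pairs
`(a, b)`, that approximate the entries of the tensor with error at most `η`. -/
structure Presentation (F : FeasibilityNetwork d) (η : ℝ) where
  count : Fin F.net.size → ℕ
  tensor : ∀ j, Fin (count j) → Tensor d (F.net.I j)
  mem_iff : ∀ j g, g ∈ F.tensors j ↔ ∃ k, tensor j k = g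
  table : ∀ j, Fin (count j) → (F.net.I j → Fin d × Fin d) → ℚ × ℚ
  close : ∀ j k σ, ‖tensor j k σ - (((table j k σ).1 : ℂ) + ((table j k σ).2 : ℂ) * Complex.I)‖ ≤ η

/-- The initialization that is specified by a position in each of the lists of tensors. -/
def Presentation.initialization {F : FeasibilityNetwork d} {η : ℝ} (P : F.Presentation η)
    (c : ∀ j, Fin (P.count j)) : F.Initialization :=
  ⟨fun j => P.tensor j (c j), fun j => (P.mem_iff j _).2 ⟨c j, rfl⟩⟩

end FeasibilityNetwork

/-! ### The machine model

Programs act on binary trees. One step is the creation of a leaf or of a pair, an access to a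
component of a pair, a test whether a tree is a leaf, or the overhead of a control structure. This
is the usual cons-cell machine with one atom; pairs are built from references, and no step compares
or copies trees, so that running times agree with those of Turing machines up to a polynomial. -/

inductive Data : Type
  | nil : Data
  | cons (a b : Data) : Data

namespace Data

/-- The number of nodes. -/
def size : Data → ℕ
  | nil => 1
  | cons a b => a.size + b.size + 1

def hd : Data → Data
  | nil => nil
  | cons a _ => a

def tl : Data → Data
  | nil => nil
  | cons _ b => b

def ofList : List Data → Data
  | [] => nil
  | a :: l => cons a (ofList l)

def ofBool : Bool → Data
  | false => nil
  | true => cons nil nil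

/-- Natural numbers are written in binary, the least significant bit first. -/
def ofNat (n : ℕ) : Data := ofList (n.bits.map ofBool)

def ofInt (z : ℤ) : Data := cons (ofBool (decide (z < 0))) (ofNat z.natAbs)

def ofRat (q : ℚ) : Data := cons (ofInt q.num) (ofNat q.den)

end Data

inductive Program : Type
  | id : Program
  | nil : Program
  | hd : Program
  | tl : Program
  | pair (p q : Program) : Program
  | comp (q p : Program) : Program
  | ite (c p q : Program) : Program
  | loop (c p : Program) : Program

/-- `p.Runs x y n`: on the input `x` the program `p` halts with the output `y` after exactly `n`
steps. A tree counts as true if it is not `nil`. -/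
inductive Program.Runs : Program → Data → Data → ℕ → Prop
  | id (x : Data) : Runs .id x x 1
  | nil (x : Data) : Runs .nil x .nil 1
  | hd (x : Data) : Runs .hd x x.hd 1
  | tl (x : Data) : Runs .tl x x.tl 1
  | pair {p q : Program} {x y z : Data} {m n : ℕ} :
      Runs p x y m → Runs q x z n → Runs (.pair p q) x (.cons y z) (m + n + 1)
  | comp {p q : Program} {x y z : Data} {m n : ℕ} :
      Runs p x y m → Runs q y z n → Runs (.comp q p) x z (m + n + 1)
  | ite_true {c p q : Program} {x a b y : Data} {k m : ℕ} :
      Runs c x (.cons a b) k → Runs p x y m → Runs (.ite c p q) x y (k + m + 1)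
  | ite_false {c p q : Program} {x y : Data} {k m : ℕ} :
      Runs c x .nil k → Runs q x y m → Runs (.ite c p q) x y (k + m + 1)
  | loop_stop {c p : Program} {x : Data} {k : ℕ} :
      Runs c x .nil k → Runs (.loop c p) x x (k + 1)
  | loop_step {c p : Program} {x a b y z : Data} {k m n : ℕ} :
      Runs c x (.cons a b) k → Runs p x y m → Runs (.loop c p) y z n →
        Runs (.loop c p) x z (k + m + n + 1)

/-! ### Input and output of the algorithm -/

/-- An index set is written as the increasing list of its elements. -/
def Data.ofIndexSet (I : Finset ℕ) : Data := .ofList ((I.sort (· ≤ ·)).map .ofNat)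

/-- A table of Gaussian rationals is written as the list of its entries. If `i₀ < i₁ < …` are the
elements of `I`, then the entry at `i_s ↦ (a_s, b_s)` stands at position
`∑ s, (b_s + d * a_s) * (d * d) ^ s`. -/
def Data.ofTable {d : ℕ} {I : Finset ℕ} (t : (I → Fin d × Fin d) → ℚ × ℚ) : Data :=
  .ofList (List.ofFn fun n : Fin ((d * d) ^ I.card) =>
    let q := t fun i =>
      finProdFinEquiv.symm (finFunctionFinEquiv.symm n ((I.orderIsoOfFin rfl).symm i))
    .cons (.ofRat q.1) (.ofRat q.2))

namespace FeasibilityNetwork.Presentation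

variable {d : ℕ} {F : FeasibilityNetwork d} {η : ℝ}

/-- The input: `d`, `δ`, and for each position the index set and the list of the tables. -/
def input (P : F.Presentation η) (δ : ℚ) : Data :=
  .cons (.ofNat d) (.cons (.ofRat δ) (.ofList (List.ofFn fun j =>
    .cons (.ofIndexSet (F.net.I j)) (.ofList (List.ofFn fun k => .ofTable (P.table j k))))))

/-- The output: the list of the positions that specify an initialization. -/
def output (P : F.Presentation η) (c : ∀ j, Fin (P.count j)) : Data :=
  .ofList (List.ofFn fun j => .ofNat (c j))

end FeasibilityNetwork.Presentation

/-! ### Typed polynomial-time functions on the machine model -/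

/-! Let `m` be the number of positions. The algorithm is a dynamic program over sets of positions in
which tensors are identified up to a small error. An entry is a choice of tensors on a set `S`
together with the table of their contraction, kept in exact arithmetic. Two entries on disjoint sets
are contracted to a new one if the result has at most `r` indices and is not close to an entry found
before. When nothing new arises, the search stops if some entry covers all positions; otherwise `r`
grows by one. The best entry that covers everything is returned. Treewidth and degree enter the
analysis only.

Few indices suffice: in a rooted tree decomposition of width `t`, the positions whose bags all lie
below a node `u` can be gathered child by child, and then one bag element after the other. Every
index that leaves such a partial union belongs to a position in the bag of `u`, so there are at most
`Δ * (t + 1)` of them (`mergeable_univ`), and `r` never exceeds this number.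

Small errors stay small: replacing the contraction on `S` by one that differs by `ε` changes the
contraction of a larger set by at most `(d * d) ^ |∂S| * ε` times a bound for the remaining
positions (`norm_contraction_sub_le`). These may be disconnected, but their contraction is the
product of those of the components, hence at most one by normalization (`norm_contraction_le_one`).
Closeness is measured with the factor `(d * d) ^ |∂S|` built in, so that each of the `m - 1` merges
costs only `O(1 / M)` (`Mergeable.exists_close`), and a precision `M` of order `m / δ` is enough.
Approximate input is handled by the same estimate, one tensor at a time
(`norm_contraction_sub_le_of_close`).

Few entries occur: up to closeness, an entry is determined by its list of indices, by one bit, since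
in a connected network the boundary determines `S` up to complement (`eq_of_boundary_eq`), and by a
rounded table of at most `Q = (d * d) ^ (Δ * (t + 1))` bounded numbers. The pigeonhole principle
leaves `(m / δ) ^ O(Q ^ 2)` entries (`LoopState.Invariant.length_le`), and `Q ≤ d ^ (4 * Δ * t)` for
`t ≥ 1`. Numerators and denominators are at most `A ^ |S|` with `A` given by the input, so entries
need little space.

That one round of the search takes polynomial time is shown compositionally: `PolyTime` is closed
under composition, case distinction and folds with an accumulator of controlled size. -/

/-- Types whose elements are represented by binary trees. -/
class Coded (α : Type) where
  enc : α → Data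

open Coded (enc)

namespace Coded

variable {α β : Type} [Coded α] [Coded β]

instance : Coded Bool := ⟨Data.ofBool⟩
instance : Coded ℕ := ⟨Data.ofNat⟩
instance : Coded (α × β) := ⟨fun p => .cons (enc p.1) (enc p.2)⟩
instance : Coded (List α) := ⟨fun l => .ofList (l.map enc)⟩
instance : Coded (Option α) := ⟨fun o => o.elim .nil fun a => .cons (enc a) .nil⟩

/-- The size of the representation. -/
def sz (x : α) : ℕ := (enc x).size

theorem enc_cons (a : α) (l : List α) : enc (a :: l) = .cons (enc a) (enc l) := rfl
theorem enc_true : enc true = .cons .nil .nil := rfl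
theorem enc_false : enc false = .nil := rfl

theorem sz_pos (x : α) : 1 ≤ sz x := by
  unfold sz
  cases enc x <;> simp [Data.size]

theorem sz_prod (a : α) (b : β) : sz (a, b) = sz a + sz b + 1 := rfl
theorem sz_nil : sz ([] : List α) = 1 := rfl
theorem sz_cons (a : α) (l : List α) : sz (a :: l) = sz a + sz l + 1 := rfl
theorem sz_none : sz (none : Option α) = 1 := rfl
theorem sz_some (a : α) : sz (some a) = sz a + 2 := rfl

theorem sz_bool (b : Bool) : sz b ≤ 3 := by
  cases b <;> simp [sz, enc, Data.ofBool, Data.size]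

theorem sz_append (l l' : List α) : sz (l ++ l') + 1 = sz l + sz l' := by
  induction l with
  | nil => simp [sz_nil]; omega
  | cons a l ih => simp only [List.cons_append, sz_cons]; omega

theorem sz_reverse (l : List α) : sz l.reverse = sz l := by
  induction l with
  | nil => rfl
  | cons a l ih =>
    have := sz_append l.reverse [a]
    simp only [List.reverse_cons, sz_cons, sz_nil] at *
    omega

theorem length_lt_sz (l : List α) : l.length < sz l := by
  induction l with
  | nil => simp [sz_nil]
  | cons a l ih => simp only [List.length_cons, sz_cons]; omega

theorem sz_lt_of_mem {a : α} {l : List α} (h : a ∈ l) : sz a < sz l := by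
  induction l with
  | nil => simp at h
  | cons b l ih =>
    rw [sz_cons]
    rcases List.mem_cons.1 h with rfl | h
    · omega
    · have := ih h; omega

theorem sz_le_of_forall {l : List α} {b : ℕ} (h : ∀ a ∈ l, sz a ≤ b) :
    sz l ≤ l.length * (b + 1) + 1 := by
  induction l with
  | nil => simp [sz_nil]
  | cons a l ih =>
    have h1 := h a (by simp)
    have h2 := ih fun c hc => h c (by simp [hc])
    rw [sz_cons, List.length_cons, Nat.succ_mul]
    omega

theorem sz_le_of_sublist {l l' : List α} (h : l.Sublist l') : sz l ≤ sz l' := by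
  induction h with
  | slnil => rfl
  | cons a _ ih => rw [sz_cons]; omega
  | cons_cons a _ ih => rw [sz_cons, sz_cons]; omega

end Coded

open Coded

/-- Bounded by a polynomial in the size. -/
def PolyBounded {α : Type} [Coded α] (u : α → ℕ) : Prop := ∃ k, ∀ x, u x ≤ (sz x + 1) ^ k

namespace PolyBounded

variable {α β : Type} [Coded α] [Coded β] {u v : α → ℕ}

theorem mono (hv : PolyBounded v) (h : ∀ x, u x ≤ v x) : PolyBounded u := by
  obtain ⟨k, hk⟩ := hv
  exact ⟨k, fun x => (h x).trans (hk x)⟩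

theorem sz : PolyBounded fun x : α => sz x := ⟨1, fun x => by simp⟩

theorem const (c : ℕ) : PolyBounded fun _ : α => c := by
  refine ⟨c, fun x => ?_⟩
  calc c ≤ 2 ^ c := Nat.lt_two_pow_self.le
    _ ≤ _ := Nat.pow_le_pow_left (by have := sz_pos x; omega) _

theorem mul (hu : PolyBounded u) (hv : PolyBounded v) : PolyBounded fun x => u x * v x := by
  obtain ⟨k, hk⟩ := hu
  obtain ⟨l, hl⟩ := hv
  exact ⟨k + l, fun x => by rw [pow_add]; exact Nat.mul_le_mul (hk x) (hl x)⟩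

theorem add (hu : PolyBounded u) (hv : PolyBounded v) : PolyBounded fun x => u x + v x := by
  have h : PolyBounded fun x => 2 * ((u x + 1) * (v x + 1)) := by
    have aux : ∀ {w : α → ℕ}, PolyBounded w → PolyBounded fun x => w x + 1 := by
      rintro w ⟨k, hk⟩
      refine ⟨k + 1, fun x => ?_⟩
      have h1 : 1 ≤ (Coded.sz x + 1) ^ k := Nat.one_le_pow _ _ (by omega)
      have h2 := sz_pos x
      have := hk x
      rw [pow_succ]
      nlinarith
    exact (const 2).mul ((aux hu).mul (aux hv))
  exact h.mono fun x => by nlinarith [Nat.zero_le (u x * v x)]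

theorem pow (hu : PolyBounded u) (k : ℕ) : PolyBounded fun x => u x ^ k := by
  obtain ⟨l, hl⟩ := hu
  exact ⟨l * k, fun x => by rw [pow_mul]; exact Nat.pow_le_pow_left (hl x) k⟩

theorem comp {w : β → ℕ} (hw : PolyBounded w) {f : α → β}
    (hf : PolyBounded fun x => Coded.sz (f x)) : PolyBounded fun x => w (f x) := by
  obtain ⟨k, hk⟩ := hw
  exact ((hf.add (const 1)).pow k).mono fun x => hk _

end PolyBounded

namespace Program

/-- The whole trajectory `s` is prescribed, so that an application verifies only single rounds. The
test is evaluated once more than the body, which explains the last summand `tc + 1`. -/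
theorem runs_loop {c p : Program} {s : ℕ → Data} {tc tp : ℕ} (N : ℕ)
    (hstep : ∀ i < N, (∃ a b n, n ≤ tc ∧ c.Runs (s i) (.cons a b) n) ∧
      ∃ n ≤ tp, p.Runs (s i) (s (i + 1)) n)
    (hhalt : ∃ n ≤ tc, c.Runs (s N) .nil n) :
    ∃ n ≤ N * (tc + tp + 1) + tc + 1, (loop c p).Runs (s 0) (s N) n := by
  induction N generalizing s with
  | zero =>
    obtain ⟨n, hn, h⟩ := hhalt
    exact ⟨n + 1, by omega, Program.Runs.loop_stop h⟩
  | succ N ih =>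
    obtain ⟨⟨a, b, n, hn, h⟩, n', hn', h'⟩ := hstep 0 (by omega)
    obtain ⟨m, hm, h2⟩ := ih (s := fun i => s (i + 1)) (fun i hi => hstep (i + 1) (by omega)) hhalt
    refine ⟨n + n' + m + 1, ?_, .loop_step h h' h2⟩
    rw [Nat.succ_mul]
    omega

end Program

/-- `f` is computed by a program within polynomial time, and its values have polynomial size. -/
@[fun_prop]
def PolyTime {α β : Type} [Coded α] [Coded β] (f : α → β) : Prop :=
  (∃ (p : Program) (t : α → ℕ), PolyBounded t ∧ ∀ x, ∃ n ≤ t x, p.Runs (enc x) (enc (f x)) n) ∧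
    PolyBounded fun x => sz (f x)

namespace PolyTime

variable {α β γ δ : Type} [Coded α] [Coded β] [Coded γ] [Coded δ]

theorem runs {f : α → β} (hf : PolyTime f) : ∃ (p : Program) (t : α → ℕ), PolyBounded t ∧
    ∀ x, ∃ n ≤ t x, p.Runs (enc x) (enc (f x)) n := hf.1

theorem size {f : α → β} (hf : PolyTime f) : PolyBounded fun x => sz (f x) := hf.2

/-- A program that takes constant time, for functions that increase sizes by a constant at most. -/
theorem of_const {f : α → β} (p : Program) (n c : ℕ) (h : ∀ x, ∃ m ≤ n, p.Runs (enc x) (enc (f x)) m)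
    (hs : ∀ x, sz (f x) ≤ sz x + c) : PolyTime f :=
  ⟨⟨p, fun _ => n, .const n, h⟩, (PolyBounded.sz.add (.const c)).mono hs⟩

/-- Functions that do not change the representation. -/
theorem recode {f : α → β} (h : ∀ x, enc (f x) = enc x) : PolyTime f :=
  of_const .id 1 0 (fun x => ⟨1, le_rfl, by rw [h]; exact .id _⟩) fun x => by simp [sz, h]

@[fun_prop]
theorem id : PolyTime fun x : α => x := recode fun _ => rfl

@[fun_prop]
theorem const (b : β) : PolyTime fun _ : α => b := by
  have h : ∀ D : Data, ∃ (p : Program) (n : ℕ), ∀ x, p.Runs x D n := by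
    intro D
    induction D with
    | nil => exact ⟨.nil, 1, .nil⟩
    | cons a b iha ihb =>
      obtain ⟨p, m, hp⟩ := iha
      obtain ⟨q, n, hq⟩ := ihb
      exact ⟨.pair p q, _, fun x => .pair (hp x) (hq x)⟩
  obtain ⟨p, n, hp⟩ := h (enc b)
  exact of_const p n (sz b) (fun x => ⟨n, le_rfl, hp _⟩) fun x => by omega

@[fun_prop]
theorem comp {g : β → γ} {f : α → β} (hg : PolyTime g) (hf : PolyTime f) :
    PolyTime fun x => g (f x) := by
  obtain ⟨p, t, ht, hp⟩ := hf.runs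
  obtain ⟨q, u, hu, hq⟩ := hg.runs
  refine ⟨⟨.comp q p, fun x => t x + u (f x) + 1,
    (ht.add (hu.comp hf.size)).add (.const 1), fun x => ?_⟩, hg.size.comp hf.size⟩
  obtain ⟨m, hm, h1⟩ := hp x
  obtain ⟨n, hn, h2⟩ := hq (f x)
  exact ⟨m + n + 1, by dsimp only; omega, .comp h1 h2⟩

@[fun_prop]
theorem prodMk {f : α → β} {g : α → γ} (hf : PolyTime f) (hg : PolyTime g) :
    PolyTime fun x => (f x, g x) := by
  obtain ⟨p, t, ht, hp⟩ := hf.runs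
  obtain ⟨q, u, hu, hq⟩ := hg.runs
  refine ⟨⟨.pair p q, fun x => t x + u x + 1, (ht.add hu).add (.const 1), fun x => ?_⟩,
    (hf.size.add hg.size).add (.const 1)⟩
  obtain ⟨m, hm, h1⟩ := hp x
  obtain ⟨n, hn, h2⟩ := hq x
  exact ⟨m + n + 1, by dsimp only; omega, .pair h1 h2⟩

theorem fst' : PolyTime (Prod.fst : α × β → α) :=
  of_const .hd 1 0 (fun _ => ⟨1, le_rfl, .hd _⟩) fun x => by rw [sz_prod x.1 x.2]; omega

theorem snd' : PolyTime (Prod.snd : α × β → β) :=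
  of_const .tl 1 0 (fun _ => ⟨1, le_rfl, .tl _⟩) fun x => by rw [sz_prod x.1 x.2]; omega

@[fun_prop]
theorem fst {f : α → β × γ} (hf : PolyTime f) : PolyTime fun x => (f x).1 := fst'.comp hf

@[fun_prop]
theorem snd {f : α → β × γ} (hf : PolyTime f) : PolyTime fun x => (f x).2 := snd'.comp hf

@[fun_prop]
theorem cond {c : α → Bool} {f g : α → β} (hc : PolyTime c) (hf : PolyTime f) (hg : PolyTime g) :
    PolyTime fun x => bif c x then f x else g x := by
  obtain ⟨r, s, hs, hr⟩ := hc.runs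
  obtain ⟨p, t, ht, hp⟩ := hf.runs
  obtain ⟨q, u, hu, hq⟩ := hg.runs
  refine ⟨⟨.ite r p q, fun x => s x + t x + u x + 1, ((hs.add ht).add hu).add (.const 1),
    fun x => ?_⟩, (hf.size.add hg.size).mono fun x => ?_⟩
  · obtain ⟨k, hk, h0⟩ := hr x
    obtain ⟨m, hm, h1⟩ := hp x
    obtain ⟨n, hn, h2⟩ := hq x
    dsimp only
    cases h : c x
    · rw [h] at h0
      exact ⟨k + n + 1, by omega, .ite_false h0 h2⟩
    · rw [h] at h0
      exact ⟨k + m + 1, by omega, .ite_true h0 h1⟩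
  · dsimp only
    cases c x
    · exact Nat.le_add_left _ _
    · exact Nat.le_add_right _ _

theorem congr_fun {f g : α → β} (hf : PolyTime f) (h : ∀ x, f x = g x) : PolyTime g := funext h ▸ hf

@[fun_prop]
theorem not {f : α → Bool} (hf : PolyTime f) : PolyTime fun x => !(f x) :=
  congr_fun (cond hf (const false) (const true)) fun x => by cases f x <;> rfl

@[fun_prop]
theorem and {f g : α → Bool} (hf : PolyTime f) (hg : PolyTime g) : PolyTime fun x => f x && g x :=
  (cond hf hg (const false)).congr_fun fun x => by cases f x <;> rfl

@[fun_prop]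
theorem or {f g : α → Bool} (hf : PolyTime f) (hg : PolyTime g) : PolyTime fun x => f x || g x :=
  (cond hf (const true) hg).congr_fun fun x => by cases f x <;> rfl

@[fun_prop]
theorem beq_bool {f g : α → Bool} (hf : PolyTime f) (hg : PolyTime g) :
    PolyTime fun x => f x == g x :=
  (cond hf hg hg.not).congr_fun fun x => by cases f x <;> cases g x <;> rfl

@[fun_prop]
theorem listCons {f : α → β} {g : α → List β} (hf : PolyTime f) (hg : PolyTime g) :
    PolyTime fun x => f x :: g x :=
  comp (g := fun p : β × List β => p.1 :: p.2) (recode fun _ => rfl) (prodMk hf hg)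

/-- Case distinction on a list. -/
theorem listCases {f : α → List β} {g : α → γ} {h : α → β → List β → γ} (hf : PolyTime f)
    (hg : PolyTime g) (hh : PolyTime fun p : α × β × List β => h p.1 p.2.1 p.2.2) :
    PolyTime fun x => (f x).casesOn (motive := fun _ => γ) (g x) (h x) := by
  obtain ⟨r, s, hs, hr⟩ := hf.runs
  obtain ⟨p, t, ht, hp⟩ := hg.runs
  obtain ⟨q, u, hu, hq⟩ := hh.runs
  -- A bound in terms of the triple becomes one in terms of `x` alone, because head and tail
  -- together are not larger than `f x`, whose size is polynomial.
  have key : ∀ {w : α × β × List β → ℕ}, PolyBounded w →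
      ∃ v : α → ℕ, PolyBounded v ∧ ∀ x b l, f x = b :: l → w (x, b, l) ≤ v x := by
    rintro w ⟨k, hk⟩
    refine ⟨fun x => (sz x + sz (f x) + 2) ^ k,
      ((PolyBounded.sz.add hf.size).add (.const 2)).pow k, fun x b l h => (hk _).trans ?_⟩
    apply Nat.pow_le_pow_left
    simp only [h, sz_prod, sz_cons]
    omega
  obtain ⟨v, hv, hv'⟩ := key hu
  obtain ⟨w, hw, hw'⟩ := key hh.size
  refine ⟨⟨.ite r (.comp q (.pair .id r)) p, fun x => 2 * s x + t x + v x + 4,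
    ((((PolyBounded.const 2).mul hs).add ht).add hv).add (.const 4), fun x => ?_⟩,
    (hg.size.add hw).mono fun x => ?_⟩
  · obtain ⟨k, hk, h0⟩ := hr x
    dsimp only at *
    cases h : f x with
    | nil =>
      obtain ⟨m, hm, h1⟩ := hp x
      rw [h] at h0
      exact ⟨k + m + 1, by omega, .ite_false h0 h1⟩
    | cons b l =>
      obtain ⟨m, hm, h1⟩ := hq (x, b, l)
      rw [h] at h0
      have := hv' x b l h
      exact ⟨k + ((1 + k + 1) + m + 1) + 1, by omega,
        .ite_true h0 (.comp (.pair (.id _) h0) h1)⟩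
  · dsimp only at *
    cases h : f x with
    | nil => exact Nat.le_add_right _ _
    | cons b l => exact (hw' x b l h).trans (Nat.le_add_left _ _)

/-- Case distinction on an option. -/
theorem optionElim {f : α → Option β} {g : α → γ} {h : α → β → γ} (hf : PolyTime f)
    (hg : PolyTime g) (hh : PolyTime fun p : α × β => h p.1 p.2) :
    PolyTime fun x => (f x).elim (g x) (h x) := by
  -- An option has the same code as the list with at most one element.
  have h1 : PolyTime fun o : Option β => o.toList := by
    refine recode fun o => ?_
    cases o <;> rfl
  refine (listCases (h := fun x b _ => h x b) (h1.comp hf) hg ?_).congr_fun fun x => ?_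
  · exact hh.comp (prodMk fst' (fst'.comp snd'))
  · cases f x <;> rfl

@[fun_prop]
theorem some {f : α → β} (hf : PolyTime f) : PolyTime fun x => Option.some (f x) :=
  comp (g := fun b : β => Option.some b)
    (of_const (.pair .id .nil) 3 2 (fun x => ⟨3, le_rfl, .pair (.id _) (.nil _)⟩) fun x => by
      rw [sz_some]) hf

end PolyTime

/-! ### List functions by folds with accumulators of controlled size -/

namespace PolyTime

variable {α β γ δ : Type} [Coded α] [Coded β] [Coded γ] [Coded δ]

/-- Polynomial time of `h` alone is not enough: pairs share their components, so that a tree can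
double its size in a bounded number of steps. Hence the bound `B` for the accumulator after each
prefix of the list. -/
theorem foldl {f : α → List β} {g : α → γ} {h : α → γ → β → γ} (hf : PolyTime f)
    (hg : PolyTime g) (hh : PolyTime fun p : α × γ × β => h p.1 p.2.1 p.2.2) {B : α → ℕ}
    (hB : PolyBounded B) (hb : ∀ x l, l <+: f x → sz (l.foldl (h x) (g x)) ≤ B x) :
    PolyTime fun x => (f x).foldl (h x) (g x) := by
  obtain ⟨r, s, hs, hr⟩ := hf.runs
  obtain ⟨p, t, ht, hp⟩ := hg.runs
  obtain ⟨q, u, ⟨k, hk⟩, hq⟩ := hh.runs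
  refine ⟨⟨.comp (.comp .hd .tl) (.comp (.loop (.comp .tl .tl)
    (.pair .hd (.pair (.comp q (.pair .hd (.pair (.comp .hd .tl) (.comp .hd (.comp .tl .tl)))))
      (.comp .tl (.comp .tl .tl))))) (.pair .id (.pair p r))),
    fun x => t x + s x + sz (f x) * ((sz x + B x + sz (f x) + 3) ^ k + 40) + 20,
    ((ht.add hs).add (hf.size.mul ((((((PolyBounded.sz.add hB).add hf.size).add
      (.const 3)).pow k).add (.const 40))))).add (.const 20), fun x => ?_⟩,
    hB.mono fun x => hb x _ List.prefix_rfl⟩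
  obtain ⟨m, hm, h1⟩ := hp x
  obtain ⟨n, hn, h2⟩ := hr x
  -- The loop carries the input, the accumulator and the rest of the list. It ends when the last of
  -- these, reached by `tl` twice, is `nil`.
  let S : ℕ → Data := fun i => .cons (enc x)
    (.cons (enc (((f x).take i).foldl (h x) (g x))) (enc ((f x).drop i)))
  have hhalt : ∃ n ≤ 3, (Program.comp .tl .tl).Runs (S (f x).length) .nil n := by
    refine ⟨3, le_rfl, ?_⟩
    have : S (f x).length = .cons (enc x) (.cons (enc (((f x).take (f x).length).foldl (h x) (g x)))
      (enc ([] : List β))) := by simp [S]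
    rw [this]
    exact .comp (.tl _) (.tl _)
  obtain ⟨n', hn', h3⟩ := Program.runs_loop (c := .comp .tl .tl) (p := .pair .hd (.pair (.comp q
    (.pair .hd (.pair (.comp .hd .tl) (.comp .hd (.comp .tl .tl))))) (.comp .tl (.comp .tl .tl))))
    (s := S) (tc := 3) (tp := (sz x + B x + sz (f x) + 3) ^ k + 30) (f x).length (fun i hi => by
      have e : (f x).drop i = (f x)[i] :: (f x).drop (i + 1) := List.drop_eq_getElem_cons hi
      have e' : (f x).take (i + 1) = (f x).take i ++ [(f x)[i]] := by
        rw [List.take_concat_get' _ _ hi]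
      have hS : S i = .cons (enc x) (.cons (enc (((f x).take i).foldl (h x) (g x)))
        (.cons (enc (f x)[i]) (enc ((f x).drop (i + 1))))) := by
        simp only [S]
        rw [e, enc_cons]
      refine ⟨⟨enc (f x)[i], enc ((f x).drop (i + 1)), 3, le_rfl, ?_⟩, ?_⟩
      · rw [hS]
        exact .comp (.tl _) (.tl _)
      · obtain ⟨l, hl, h4⟩ := hq (x, ((f x).take i).foldl (h x) (g x), (f x)[i])
        have hl' : l ≤ (sz x + B x + sz (f x) + 3) ^ k := by
          refine hl.trans ((hk _).trans (Nat.pow_le_pow_left ?_ _))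
          rw [sz_prod, sz_prod]
          have := hb x _ (List.take_prefix i (f x))
          have := sz_lt_of_mem (List.getElem_mem hi)
          omega
        have hS' : S (i + 1) = .cons (enc x) (.cons (enc (h x (((f x).take i).foldl (h x) (g x))
            (f x)[i])) (enc ((f x).drop (i + 1)))) := by
          simp only [S]
          rw [e', List.foldl_append]
          rfl
        rw [hS, hS']
        exact ⟨_, by omega, .pair (.hd _) (.pair (.comp (.pair (.hd _) (.pair (.comp (.tl _) (.hd _))
          (.comp (.comp (.tl _) (.tl _)) (.hd _)))) h4) (.comp (.comp (.tl _) (.tl _)) (.tl _)))⟩)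
    hhalt
  have hS0 : S 0 = .cons (enc x) (.cons (enc (g x)) (enc (f x))) := by simp [S]
  have hSN : S (f x).length = .cons (enc x) (.cons (enc ((f x).foldl (h x) (g x)))
      (enc ([] : List β))) := by simp [S]
  rw [hS0, hSN] at h3
  refine ⟨_, ?_, .comp (.comp (.pair (.id _) (.pair h1 h2)) h3) (.comp (.tl _) (.hd _))⟩
  dsimp only
  have h5 : (f x).length * (3 + ((sz x + B x + sz (f x) + 3) ^ k + 30) + 1) ≤
      sz (f x) * ((sz x + B x + sz (f x) + 3) ^ k + 40) :=
    Nat.mul_le_mul (length_lt_sz _).le (by omega)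
  omega

/-- Folds in which each step increases a measure of the size of the accumulator by a bounded
amount. -/
theorem foldl_of_measure {f : α → List β} {g : α → γ} {h : α → γ → β → γ} (hf : PolyTime f)
    (hg : PolyTime g) (hh : PolyTime fun p : α × γ × β => h p.1 p.2.1 p.2.2) (μ : γ → ℕ) (K : ℕ)
    (hμ : ∀ c, sz c ≤ K * μ c + K) (hμ' : ∀ c, μ c ≤ sz c) {w : α × β → ℕ}
    (hw : PolyBounded w) (hb : ∀ x c b, μ (h x c b) ≤ μ c + w (x, b)) :
    PolyTime fun x => (f x).foldl (h x) (g x) := by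
  obtain ⟨k, hk⟩ := hw
  refine foldl (B := fun x => K * (sz (g x) + sz (f x) * (sz x + sz (f x) + 2) ^ k) + K) hf hg hh
    (((PolyBounded.const K).mul (hg.size.add (hf.size.mul (((PolyBounded.sz.add hf.size).add
      (.const 2)).pow k)))).add (.const K)) ?_
  intro x l hl
  have key : ∀ (l : List β) c, (∀ b ∈ l, b ∈ f x) →
      μ (l.foldl (h x) c) ≤ μ c + l.length * (sz x + sz (f x) + 2) ^ k := by
    intro l
    induction l with
    | nil => simp
    | cons b l ih =>
      intro c hc
      have h1 := ih (h x c b) fun b' hb' => hc b' (by simp [hb'])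
      have h2 := hb x c b
      have h3 : w (x, b) ≤ (sz x + sz (f x) + 2) ^ k := by
        refine (hk _).trans (Nat.pow_le_pow_left ?_ _)
        have := sz_lt_of_mem (hc b (by simp))
        rw [sz_prod]
        omega
      rw [List.foldl_cons, List.length_cons, Nat.succ_mul]
      omega
  refine (hμ _).trans (Nat.add_le_add_right (Nat.mul_le_mul_left _
    ((key l _ fun b hb => hl.subset hb).trans ?_)) _)
  have h4 : l.length ≤ sz (f x) := (hl.length_le).trans (length_lt_sz _).le
  have := Nat.mul_le_mul_right ((sz x + sz (f x) + 2) ^ k) h4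
  have := hμ' (g x)
  omega

/-- Folds in which each step increases the size of the accumulator by a bounded amount. -/
theorem foldl_of_add {f : α → List β} {g : α → γ} {h : α → γ → β → γ} (hf : PolyTime f)
    (hg : PolyTime g) (hh : PolyTime fun p : α × γ × β => h p.1 p.2.1 p.2.2) {w : α × β → ℕ}
    (hw : PolyBounded w) (hb : ∀ x c b, sz (h x c b) ≤ sz c + w (x, b)) :
    PolyTime fun x => (f x).foldl (h x) (g x) :=
  foldl_of_measure hf hg hh sz 1 (fun _ => by omega) (fun _ => le_rfl) hw hb

@[fun_prop]
theorem reverse {f : α → List β} (hf : PolyTime f) : PolyTime fun x => (f x).reverse := by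
  have : PolyTime fun l : List β => l.foldl (fun acc b => b :: acc) [] :=
    foldl_of_add (w := fun p => sz p.2 + 1) id (const _) (by fun_prop)
      ((PolyBounded.sz.comp (f := Prod.snd) snd'.size).add (.const 1))
      fun x c b => by rw [sz_cons]; dsimp only; omega
  refine comp (g := fun l : List β => l.reverse) (this.congr_fun fun l => ?_) hf
  simp

@[fun_prop]
theorem append {f g : α → List β} (hf : PolyTime f) (hg : PolyTime g) :
    PolyTime fun x => f x ++ g x := by
  have : PolyTime fun p : List β × List β => p.1.reverse.foldl (fun acc b => b :: acc) p.2 :=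
    foldl_of_add (w := fun p => sz p.2 + 1) (by fun_prop) (by fun_prop) (by fun_prop)
      ((PolyBounded.sz.comp (f := Prod.snd) snd'.size).add (.const 1))
      fun x c b => by rw [sz_cons]; dsimp only; omega
  refine (this.comp (hf.prodMk hg)).congr_fun fun x => ?_
  simp

@[fun_prop]
theorem map {f : α → List β} {g : α → β → γ} (hf : PolyTime f)
    (hg : PolyTime fun p : α × β => g p.1 p.2) : PolyTime fun x => (f x).map (g x) := by
  have : PolyTime fun x => (f x).foldl (fun acc b => g x b :: acc) [] :=
    foldl_of_add (w := fun p => sz (g p.1 p.2) + 1) hf (const _)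
      ((hg.comp (f := fun p : α × List γ × β => (p.1, p.2.2)) (by fun_prop)).listCons
        (by fun_prop))
      (hg.size.add (.const 1)) fun x c b => by rw [sz_cons]; dsimp only; omega
  refine this.reverse.congr_fun fun x => ?_
  rw [← List.reverse_reverse ((f x).map (g x))]
  congr 1
  rw [← List.foldl_map (f := g x) (g := fun acc c => c :: acc)]
  simp

@[fun_prop]
theorem flatten {f : α → List (List β)} (hf : PolyTime f) : PolyTime fun x => (f x).flatten := by
  have : PolyTime fun l : List (List β) => l.foldl (fun acc b => acc ++ b) [] :=
    foldl_of_add (w := fun p => sz p.2) id (const _) (by fun_prop)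
      (PolyBounded.sz.comp (f := Prod.snd) snd'.size)
      fun x c b => by have := sz_append c b; dsimp only; omega
  refine comp (g := fun l : List (List β) => l.flatten) (this.congr_fun fun l => ?_) hf
  have : ∀ (l : List (List β)) (c : List β), l.foldl (fun acc b => acc ++ b) c = c ++ l.flatten := by
    intro l
    induction l with
    | nil => simp
    | cons b l ih => intro c; simp [ih]
  simp [this]

@[fun_prop]
theorem flatMap {f : α → List β} {g : α → β → List γ} (hf : PolyTime f)
    (hg : PolyTime fun p : α × β => g p.1 p.2) : PolyTime fun x => (f x).flatMap (g x) :=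
  (hf.map hg).flatten

@[fun_prop]
theorem filter {f : α → List β} {g : α → β → Bool} (hf : PolyTime f)
    (hg : PolyTime fun p : α × β => g p.1 p.2) : PolyTime fun x => (f x).filter (g x) := by
  have : PolyTime fun x => (f x).flatMap fun b => bif g x b then [b] else [] := by
    fun_prop
  refine this.congr_fun fun x => ?_
  induction f x with
  | nil => rfl
  | cons b l ih => cases h : g x b <;> simp_all

@[fun_prop]
theorem isEmpty {f : α → List β} (hf : PolyTime f) : PolyTime fun x => (f x).isEmpty :=
  (listCases (h := fun _ _ _ => false) hf (const true) (const false)).congr_fun fun x => by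
    cases f x <;> rfl

@[fun_prop]
theorem any {f : α → List β} {g : α → β → Bool} (hf : PolyTime f)
    (hg : PolyTime fun p : α × β => g p.1 p.2) : PolyTime fun x => (f x).any (g x) := by
  have : PolyTime fun x => !((f x).filter (g x)).isEmpty := by fun_prop
  refine this.congr_fun fun x => ?_
  induction f x with
  | nil => rfl
  | cons b l ih => cases h : g x b <;> simp_all

@[fun_prop]
theorem all {f : α → List β} {g : α → β → Bool} (hf : PolyTime f)
    (hg : PolyTime fun p : α × β => g p.1 p.2) : PolyTime fun x => (f x).all (g x) := by
  have : PolyTime fun x => !(f x).any fun b => !g x b := by fun_prop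
  exact this.congr_fun fun x => by rw [List.all_eq_not_any_not]

@[fun_prop]
theorem isSome {f : α → Option β} (hf : PolyTime f) : PolyTime fun x => (f x).isSome :=
  (optionElim (h := fun _ _ => true) hf (const false) (const true)).congr_fun fun x => by
    cases f x <;> rfl

@[fun_prop]
theorem isNone {f : α → Option β} (hf : PolyTime f) : PolyTime fun x => (f x).isNone :=
  (optionElim (h := fun _ _ => false) hf (const true) (const false)).congr_fun fun x => by
    cases f x <;> rfl

@[fun_prop]
theorem or_option {f g : α → Option β} (hf : PolyTime f) (hg : PolyTime g) :
    PolyTime fun x => (f x).or (g x) :=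
  (optionElim (h := fun _ b => Option.some b) hf hg (by fun_prop)).congr_fun fun x => by
    cases f x <;> rfl

@[fun_prop]
theorem getD {f : α → Option β} {g : α → β} (hf : PolyTime f) (hg : PolyTime g) :
    PolyTime fun x => (f x).getD (g x) :=
  (optionElim (h := fun _ b => b) hf hg (by fun_prop)).congr_fun fun x => by
    cases f x <;> rfl

@[fun_prop]
theorem head? {f : α → List β} (hf : PolyTime f) : PolyTime fun x => (f x).head? :=
  (listCases (h := fun _ b _ => Option.some b) hf (const none) (by fun_prop)).congr_fun fun x => by
    cases f x <;> rfl

@[fun_prop]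
theorem tail {f : α → List β} (hf : PolyTime f) : PolyTime fun x => (f x).tail :=
  (listCases (h := fun _ _ l => l) hf (const []) (by fun_prop)).congr_fun fun x => by
    cases f x <;> rfl

@[fun_prop]
theorem zip {f : α → List β} {g : α → List γ} (hf : PolyTime f) (hg : PolyTime g) :
    PolyTime fun x => (f x).zip (g x) := by
  have : PolyTime fun p : List β × List γ => (p.1.foldl (fun (c : List γ × List (β × γ)) b =>
      (c.1.tail, c.1.head?.elim c.2 fun a => (b, a) :: c.2)) (p.2, [])).2.reverse := by
    refine reverse (snd (foldl_of_add (w := fun p => sz p.2 + 1) (by fun_prop) (by fun_prop) ?_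
      ((PolyBounded.sz.comp (f := Prod.snd) snd'.size).add (.const 1)) ?_))
    · refine prodMk (by fun_prop) (optionElim
        (h := fun (p : (List β × List γ) × (List γ × List (β × γ)) × β) a => (p.2.2, a) :: p.2.1.2)
        ?_ ?_ ?_) <;> fun_prop
    · rintro x ⟨_ | ⟨a, l⟩, l'⟩ b
      · exact Nat.le_add_right _ _
      · simp only [List.tail_cons, List.head?_cons, Option.elim_some, sz_prod, sz_cons]
        omega
  refine (this.comp (hf.prodMk hg)).congr_fun fun x => ?_
  have : ∀ (l : List β) (l' : List γ) (c : List (β × γ)),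
      (l.foldl (fun (c : List γ × List (β × γ)) b =>
      (c.1.tail, c.1.head?.elim c.2 fun a => (b, a) :: c.2)) (l', c)).2 =
        (l.zip l').reverse ++ c := by
    intro l
    induction l with
    | nil => simp
    | cons b l ih =>
      rintro (_ | ⟨a, l'⟩) c
      · rw [List.foldl_cons, List.tail_nil, ih]; simp
      · rw [List.foldl_cons, ih]; simp
  simp [this]

/-- Equality of lists is decided by means of equality of their elements. -/
theorem beq_list [BEq β] (hb : PolyTime fun p : β × β => p.1 == p.2) {f g : α → List β}
    (hf : PolyTime f) (hg : PolyTime g) : PolyTime fun x => f x == g x := by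
  -- Since `zip` cuts off the longer list, both lists receive the end mark `none`; a difference in
  -- length then shows up as a mark against an element.
  have h1 : PolyTime fun l : List β => (l.map fun b => Option.some b) ++ [none] := by fun_prop
  have h2 : PolyTime fun x => (((f x).map fun b => Option.some b) ++ [none]).zip
      (((g x).map fun b => Option.some b) ++ [none]) := (h1.comp hf).zip (h1.comp hg)
  have h3 : PolyTime fun p : Option β × Option β => (p.1.elim p.2.isNone fun a =>
      p.2.elim false fun b => a == b) :=
    optionElim (h := fun (p : Option β × Option β) a => p.2.elim false fun b => a == b)
      (by fun_prop) (by fun_prop) (optionElim (h := fun (p : (Option β × Option β) × β) b =>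
        p.2 == b) (by fun_prop) (by fun_prop) (hb.comp (f := fun q : ((Option β × Option β) × β) × β =>
        (q.1.2, q.2)) (by fun_prop)))
  refine (h2.all (g := fun _ p => (p.1.elim p.2.isNone fun a =>
      p.2.elim false fun b => a == b)) (h3.comp snd')).congr_fun fun x => ?_
  generalize f x = l
  generalize g x = l'
  induction l generalizing l' with
  | nil => cases l' <;> simp
  | cons b l ih =>
    cases l' with
    | nil => simp
    | cons b' l' => have := ih l'; simp_all

end PolyTime

/-! ### Binary arithmetic in polynomial time -/

namespace Coded

theorem sz_nat_le (n : ℕ) : sz n ≤ 4 * n.size + 1 := by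
  have : sz n = sz n.bits := rfl
  rw [this, ← Nat.size_eq_bits_len]
  refine (sz_le_of_forall (b := 3) fun b _ => sz_bool b).trans (by omega)

theorem size_lt_sz (n : ℕ) : n.size < sz n := by
  have : sz n = sz n.bits := rfl
  rw [this, ← Nat.size_eq_bits_len]
  exact length_lt_sz _

theorem lt_two_pow_sz (n : ℕ) : n < 2 ^ sz n :=
  (Nat.lt_size_self n).trans_le (Nat.pow_le_pow_right (by omega) (size_lt_sz n).le)

theorem sz_nat_le_self (n : ℕ) : sz n ≤ 4 * n + 1 := by
  have h1 := sz_nat_le n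
  have h2 : n.size ≤ n := Nat.size_le.2 Nat.lt_two_pow_self
  omega

end Coded

namespace PolyTime

variable {α β γ δ : Type} [Coded α] [Coded β] [Coded γ] [Coded δ]

theorem of_enc_eq {f : α → β} {g : α → γ} (hg : PolyTime g) (h : ∀ x, enc (f x) = enc (g x)) :
    PolyTime f := by
  obtain ⟨⟨p, t, ht, hp⟩, hs⟩ := hg
  refine ⟨⟨p, t, ht, fun x => by rw [h]; exact hp x⟩, hs.mono fun x => ?_⟩
  rw [sz, sz, h]

@[fun_prop]
theorem bits {f : α → ℕ} (hf : PolyTime f) : PolyTime fun x => (f x).bits :=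
  of_enc_eq hf fun _ => rfl

@[fun_prop]
theorem div2 {f : α → ℕ} (hf : PolyTime f) : PolyTime fun x => (f x).div2 :=
  of_enc_eq hf.bits.tail fun x => by rw [← Nat.div2_bits_eq_tail]; rfl

@[fun_prop]
theorem bodd {f : α → ℕ} (hf : PolyTime f) : PolyTime fun x => (f x).bodd := by
  refine (hf.bits.head?.getD (const false)).congr_fun fun x => ?_
  rw [Nat.bodd_eq_bits_head]
  cases (f x).bits <;> rfl

@[fun_prop]
theorem bit {f : α → Bool} {g : α → ℕ} (hf : PolyTime f) (hg : PolyTime g) :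
    PolyTime fun x => Nat.bit (f x) (g x) := by
  -- Codes of numbers have no leading zeros; a zero bit put below the number `0` has to vanish.
  have : PolyTime fun x => bif f x || !(g x).bits.isEmpty then f x :: (g x).bits else [] := by
    fun_prop
  refine of_enc_eq this fun x => ?_
  change enc (Nat.bit (f x) (g x)).bits = _
  rcases h : f x with _ | _
  · rcases Nat.eq_zero_or_pos (g x) with h0 | h0
    · simp [h0]
    · rw [Nat.bits_append_bit _ _ (by omega)]
      have : (g x).bits.isEmpty = false := by
        rw [List.isEmpty_eq_false_iff]
        intro h1
        have := Nat.size_eq_bits_len (g x)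
        rw [h1] at this
        simp only [List.length_nil] at this
        have := Nat.size_eq_zero.1 this.symm
        omega
      simp [this]
  · rw [Nat.bits_append_bit _ _ (by simp)]
    simp

theorem sz_bit (b : Bool) (n : ℕ) : sz (Nat.bit b n) ≤ sz n + 4 := by
  change sz (Nat.bit b n).bits ≤ sz n.bits + 4
  by_cases h : n = 0 ∧ b = false
  · rw [h.1, h.2]
    simp [sz_nil]
  · rw [Nat.bits_append_bit _ _ (by grind), sz_cons]
    have := sz_bool b
    omega

theorem sz_div2 (n : ℕ) : sz n.div2 ≤ sz n := by
  change sz n.div2.bits ≤ sz n.bits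
  rw [Nat.div2_bits_eq_tail]
  exact sz_le_of_sublist (List.tail_sublist _)

/-- One step of the school algorithm for the sum of two binary numbers: the state consists of the
remaining numbers, the carry bit, and the bits of the sum found so far, the last one first. -/
def addStep (s : (ℕ × ℕ) × Bool × List Bool) : (ℕ × ℕ) × Bool × List Bool :=
  ((s.1.1.div2, s.1.2.div2), (s.1.1.bodd && s.1.2.bodd) || (s.2.1 && (s.1.1.bodd || s.1.2.bodd)),
    (s.1.1.bodd == (s.1.2.bodd == s.2.1)) :: s.2.2)

theorem addStep_sum (s : (ℕ × ℕ) × Bool × List Bool) :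
    2 * ((addStep s).1.1 + (addStep s).1.2 + (addStep s).2.1.toNat) +
      (s.1.1.bodd == (s.1.2.bodd == s.2.1)).toNat = s.1.1 + s.1.2 + s.2.1.toNat := by
  have h1 := Nat.bodd_add_div2 s.1.1
  have h2 := Nat.bodd_add_div2 s.1.2
  simp only [addStep]
  generalize s.1.1.bodd = x at *
  generalize s.1.2.bodd = y at *
  generalize s.2.1 = z at *
  generalize s.1.1.div2 = x' at *
  generalize s.1.2.div2 = y' at *
  rw [← h1, ← h2]
  cases x <;> cases y <;> cases z <;> simp <;> omega

/-- The invariant is the value of the output bits with the sum still to be processed standing above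
them as higher part. The hypothesis makes this part zero at the end. -/
theorem foldl_addStep {β : Type} (l : List β) (s : (ℕ × ℕ) × Bool × List Bool)
    (h : s.1.1 + s.1.2 + s.2.1.toNat < 2 ^ l.length) :
    (l.foldl (fun s _ => addStep s) s).2.2.foldl (fun n b => Nat.bit b n) 0 =
      s.2.2.foldl (fun n b => Nat.bit b n) (s.1.1 + s.1.2 + s.2.1.toNat) := by
  induction l generalizing s with
  | nil =>
    simp only [List.length_nil, pow_zero, Nat.lt_one_iff] at h
    simp [h]
  | cons b l ih =>
    have h1 := addStep_sum s
    rw [List.foldl_cons, ih]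
    · conv_rhs => rw [← h1]
      have : (addStep s).2.2 = (s.1.1.bodd == (s.1.2.bodd == s.2.1)) :: s.2.2 := rfl
      rw [this, List.foldl_cons, Nat.bit_val]
    · rw [List.length_cons, pow_succ] at h
      omega

theorem ofBits' {f : α → List Bool} (hf : PolyTime f) :
    PolyTime fun x => (f x).foldl (fun n b => Nat.bit b n) 0 :=
  foldl_of_add (w := fun _ => 4) hf (const _) (by fun_prop) (.const _) fun _ _ _ => sz_bit _ _

@[fun_prop]
theorem add {f g : α → ℕ} (hf : PolyTime f) (hg : PolyTime g) : PolyTime fun x => f x + g x := by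
  -- The list is only a clock. Its length is at least that of both numbers, and the additional
  -- `false` gives one more round for the last carry.
  have h : PolyTime fun p : ℕ × ℕ => (false :: (p.1.bits ++ p.2.bits)).foldl
      (fun s _ => addStep s) (p, false, []) := by
    refine foldl_of_add (w := fun _ => 7) (by fun_prop) (by fun_prop) ?_ (.const _) ?_
    · unfold addStep
      fun_prop
    · intro p s b
      have h1 := sz_div2 s.1.1
      have h2 := sz_div2 s.1.2
      have h3 := sz_bool ((s.1.1.bodd && s.1.2.bodd) || (s.2.1 && (s.1.1.bodd || s.1.2.bodd)))
      have h4 := sz_bool (s.1.1.bodd == (s.1.2.bodd == s.2.1))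
      have h5 := sz_pos s.2.1
      obtain ⟨⟨a, b⟩, c, o⟩ := s
      simp only [addStep, sz_prod, sz_cons] at *
      omega
  refine ((ofBits' h.snd.snd).comp (hf.prodMk hg)).congr_fun fun x => ?_
  rw [foldl_addStep]
  · simp
  · have h1 := Nat.lt_size_self (f x)
    have h2 := Nat.lt_size_self (g x)
    have h3 := Nat.pow_le_pow_right (n := 2) (by omega) (Nat.le_add_right (f x).size (g x).size)
    have h4 := Nat.pow_le_pow_right (n := 2) (by omega) (Nat.le_add_left (g x).size (f x).size)
    simp only [List.length_cons, List.length_append, Nat.size_eq_bits_len, pow_succ,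
      Bool.toNat_false]
    omega

/-- One step of the comparison of two binary numbers, starting with the least significant bits. -/
def leStep (s : (ℕ × ℕ) × Bool) : (ℕ × ℕ) × Bool :=
  ((s.1.1.div2, s.1.2.div2), bif s.1.1.bodd == s.1.2.bodd then s.2 else s.1.2.bodd)

/-- Bits are read upwards, so the last difference that is seen is the decisive one; the flag gives
the answer in case of equality. -/
theorem foldl_leStep {β : Type} (l : List β) (s : (ℕ × ℕ) × Bool) (h1 : s.1.1 < 2 ^ l.length)
    (h2 : s.1.2 < 2 ^ l.length) :
    (l.foldl (fun s _ => leStep s) s).2 = decide (s.1.1 < s.1.2 ∨ s.1.1 = s.1.2 ∧ s.2 = true) := by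
  induction l generalizing s with
  | nil =>
    simp only [List.length_nil, pow_zero, Nat.lt_one_iff] at h1 h2
    simp [h1, h2]
  | cons b l ih =>
    have h3 := Nat.bodd_add_div2 s.1.1
    have h4 := Nat.bodd_add_div2 s.1.2
    rw [List.length_cons, pow_succ] at h1 h2
    rw [List.foldl_cons, ih]
    · rw [Bool.eq_iff_iff, decide_eq_true_iff, decide_eq_true_iff]
      simp only [leStep]
      generalize s.1.1.bodd = x at *
      generalize s.1.2.bodd = y at *
      generalize s.2 = z at *
      generalize s.1.1.div2 = x' at *
      generalize s.1.2.div2 = y' at *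
      rw [← h3, ← h4]
      cases x <;> cases y <;> cases z <;> simp <;> omega
    · simp only [leStep]
      omega
    · simp only [leStep]
      omega

@[fun_prop]
theorem le {f g : α → ℕ} (hf : PolyTime f) (hg : PolyTime g) :
    PolyTime fun x => decide (f x ≤ g x) := by
  have h : PolyTime fun p : ℕ × ℕ => (p.1.bits ++ p.2.bits).foldl
      (fun s _ => leStep s) (p, true) := by
    refine foldl_of_add (w := fun _ => 3) (by fun_prop) (by fun_prop) ?_ (.const _) ?_
    · unfold leStep
      fun_prop
    · intro p s b
      have h1 := sz_div2 s.1.1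
      have h2 := sz_div2 s.1.2
      have h3 := sz_bool (bif s.1.1.bodd == s.1.2.bodd then s.2 else s.1.2.bodd)
      obtain ⟨⟨a, b⟩, c⟩ := s
      simp only [leStep, sz_prod] at *
      omega
  refine (h.snd.comp (hf.prodMk hg)).congr_fun fun x => ?_
  rw [foldl_leStep]
  · simp [le_iff_lt_or_eq]
  · refine (Nat.lt_size_self (f x)).trans_le (Nat.pow_le_pow_right (by omega) ?_)
    simp [Nat.size_eq_bits_len]
  · refine (Nat.lt_size_self (g x)).trans_le (Nat.pow_le_pow_right (by omega) ?_)
    simp [Nat.size_eq_bits_len]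

@[fun_prop]
theorem lt {f g : α → ℕ} (hf : PolyTime f) (hg : PolyTime g) :
    PolyTime fun x => decide (f x < g x) :=
  (hg.le hf).not.congr_fun fun x => by
    rw [Bool.eq_iff_iff, Bool.not_eq_true', decide_eq_false_iff_not, decide_eq_true_iff, not_le]

@[fun_prop]
theorem beq_nat {f g : α → ℕ} (hf : PolyTime f) (hg : PolyTime g) : PolyTime fun x => f x == g x :=
  ((hf.le hg).and (hg.le hf)).congr_fun fun x => by
    rw [Bool.eq_iff_iff, Bool.and_eq_true, decide_eq_true_iff, decide_eq_true_iff, beq_iff_eq,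
      ← le_antisymm_iff]

theorem size_add_le (a b : ℕ) : (a + b).size ≤ a.size + b.size := by
  rw [Nat.size_le, pow_add]
  have h1 := Nat.lt_size_self a
  have h2 := Nat.lt_size_self b
  nlinarith

theorem size_mul_le (a b : ℕ) : (a * b).size ≤ a.size + b.size := by
  rw [Nat.size_le, pow_add]
  exact Nat.mul_lt_mul'' (Nat.lt_size_self a) (Nat.lt_size_self b)

/-- Folds with a natural number as accumulator, whose binary length grows by a bounded amount in
each step. -/
theorem foldl_nat {f : α → List β} {g : α → ℕ} {h : α → ℕ → β → ℕ} (hf : PolyTime f)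
    (hg : PolyTime g) (hh : PolyTime fun p : α × ℕ × β => h p.1 p.2.1 p.2.2) {w : α × β → ℕ}
    (hw : PolyBounded w) (hb : ∀ x c b, (h x c b).size ≤ c.size + w (x, b)) :
    PolyTime fun x => (f x).foldl (h x) (g x) :=
  foldl_of_measure hf hg hh Nat.size 4 (fun c => by have := sz_nat_le c; omega)
    (fun c => (size_lt_sz c).le) hw hb

theorem size_horner (a n : ℕ) (b : Bool) :
    (Nat.bit false n + bif b then a else 0).size ≤ n.size + (1 + sz a) := by
  have h2 := size_lt_sz a
  have h4 : (Nat.bit false n).size ≤ n.size + 1 := by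
    rw [Nat.size_le, Nat.bit_val, pow_succ]
    have := Nat.lt_size_self n
    simp only [Bool.toNat_false]
    omega
  have h5 := size_add_le (Nat.bit false n) (bif b then a else 0)
  have h6 : (bif b then a else 0).size ≤ a.size := by cases b <;> simp
  omega

@[fun_prop]
theorem mul {f g : α → ℕ} (hf : PolyTime f) (hg : PolyTime g) : PolyTime fun x => f x * g x := by
  -- Horner's scheme on the bits of the first factor, the most significant one first. Each round
  -- increases the binary length by at most one plus the size of the second factor.
  have h : PolyTime fun p : ℕ × ℕ => p.1.bits.reverse.foldl
      (fun n b => Nat.bit false n + bif b then p.2 else 0) 0 := by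
    have hw : PolyBounded fun p : (ℕ × ℕ) × Bool => 1 + sz p.1.2 :=
      (PolyBounded.const 1).add (PolyBounded.sz.comp (f := fun p : (ℕ × ℕ) × Bool => p.1.2)
        (fst'.snd).size)
    have hh : PolyTime fun p : (ℕ × ℕ) × ℕ × Bool =>
        Nat.bit false p.2.1 + bif p.2.2 then p.1.2 else 0 := by fun_prop
    have hf' : PolyTime fun p : ℕ × ℕ => p.1.bits.reverse := by fun_prop
    exact foldl_nat (h := fun (p : ℕ × ℕ) (n : ℕ) (b : Bool) =>
      Nat.bit false n + bif b then p.2 else 0) (w := fun p => 1 + sz p.1.2) hf' (const 0) hh hw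
      fun p n b => size_horner p.2 n b
  have h' := comp h (hf.prodMk hg)
  refine congr_fun h' fun x => ?_
  rw [List.foldl_reverse]
  dsimp only
  generalize g x = b
  induction f x using Nat.binaryRec' with
  | zero => simp
  | bit c n hn ih =>
    rw [Nat.bits_append_bit _ _ hn, List.foldr_cons, ih, Nat.bit_val, Nat.bit_val]
    cases c <;> simp <;> ring

@[fun_prop]
theorem sum {f : α → List ℕ} (hf : PolyTime f) : PolyTime fun x => (f x).sum := by
  have : PolyTime fun l : List ℕ => l.foldl (fun n b => n + b) 0 :=
    foldl_nat (w := fun p => sz p.2) id (const _) (by fun_prop)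
      (PolyBounded.sz.comp (f := Prod.snd) snd'.size)
      fun x c b => (size_add_le c b).trans (by have := size_lt_sz b; dsimp only; omega)
  exact (this.comp hf).congr_fun fun x => List.sum_eq_foldl.symm

@[fun_prop]
theorem prod {f : α → List ℕ} (hf : PolyTime f) : PolyTime fun x => (f x).prod := by
  have : PolyTime fun l : List ℕ => l.foldl (fun n b => n * b) 1 :=
    foldl_nat (w := fun p => sz p.2) id (const _) (by fun_prop)
      (PolyBounded.sz.comp (f := Prod.snd) snd'.size)
      fun x c b => (size_mul_le c b).trans (by have := size_lt_sz b; dsimp only; omega)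
  exact (this.comp hf).congr_fun fun x => List.prod_eq_foldl.symm

@[fun_prop]
theorem length {f : α → List β} (hf : PolyTime f) : PolyTime fun x => (f x).length := by
  have : PolyTime fun l : List β => (l.map fun _ => 1).sum := by fun_prop
  exact (this.comp hf).congr_fun fun x => by simp

/-- The list of the positions of a list. -/
@[fun_prop]
theorem range_length {f : α → List β} (hf : PolyTime f) :
    PolyTime fun x => List.range (f x).length := by
  have key : ∀ l : List β, l.foldl (fun (c : List ℕ) _ => c.length :: c) [] =
      (List.range l.length).reverse := by
    intro l
    induction l using List.reverseRecOn with
    | nil => rfl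
    | append_singleton l b ih => simp [ih, List.range_succ]
  have : PolyTime fun l : List β => l.foldl (fun (c : List ℕ) _ => c.length :: c) [] := by
    -- The element added in a round depends on the accumulator, so that the growth is not bounded by
    -- input and list element alone; the size after each prefix is computed instead.
    refine foldl (B := fun l => sz l * (4 * sz l + 2) + 1) id (const _) (by fun_prop)
      ((PolyBounded.sz.mul (((PolyBounded.const 4).mul .sz).add (.const 2))).add (.const 1)) ?_
    intro l l' hl
    rw [key, sz_reverse]
    have h1 := length_lt_sz l
    have h2 := hl.length_le
    refine (sz_le_of_forall (b := 4 * sz l + 1) fun n hn => ?_).trans ?_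
    · rw [List.mem_range] at hn
      exact (sz_nat_le_self n).trans (by omega)
    · rw [List.length_range]
      exact Nat.add_le_add_right (Nat.mul_le_mul (by omega) le_rfl) _
  refine (this.comp hf).reverse.congr_fun fun x => ?_
  rw [key, List.reverse_reverse]

end PolyTime

/-! ### The algorithm -/

/-- Rational numbers as sign, absolute value of the numerator, and denominator. -/
abbrev RawRat : Type := (Bool × ℕ) × ℕ

/-- The integer `a - b` is represented by `(a, b)`. -/
abbrev ZPair : Type := ℕ × ℕ

/-- Gaussian integers, given by real and imaginary part. -/
abbrev GPair : Type := ZPair × ZPair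

/-- A partial assignment of values to indices. -/
abbrev Key : Type := List (ℕ × ℕ)

/-- A partial initialization with the tensor that results from it: for each position of the
network the chosen tensor, if any; the list of the indices of the tensor; a common denominator
of its entries; and the table of the numerators. -/
abbrev Entry : Type := List (Option ℕ) × List ℕ × ℕ × List (Key × GPair)

/-- The data on which the main loop operates: a flag that tells whether to go on, the precision,
the bound for the number of indices of a tensor, and the entries found so far. -/
abbrev LoopState : Type := Bool × ℕ × ℕ × List Entry

abbrev RawInput : Type := ℕ × RawRat × List (List ℕ × List (List (RawRat × RawRat)))

def RawRat.scale (q : RawRat) (c : ℕ) : ZPair := bif q.1.1 then (0, q.1.2 * c) else (q.1.2 * c, 0)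

/-- Products of differences are expanded without cancellation. No subtraction is needed, and the sum
of the four components is exactly multiplicative, which controls the growth of the numbers. -/
def GPair.mul (x y : GPair) : GPair :=
  ((x.1.1 * y.1.1 + x.1.2 * y.1.2 + (x.2.1 * y.2.2 + x.2.2 * y.2.1),
    x.1.1 * y.1.2 + x.1.2 * y.1.1 + (x.2.1 * y.2.1 + x.2.2 * y.2.2)),
   (x.1.1 * y.2.1 + x.1.2 * y.2.2 + (x.2.1 * y.1.1 + x.2.2 * y.1.2),
    x.1.1 * y.2.2 + x.1.2 * y.2.1 + (x.2.1 * y.1.2 + x.2.2 * y.1.1)))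

def GPair.sum (l : List GPair) : GPair :=
  (((l.map fun x => x.1.1).sum, (l.map fun x => x.1.2).sum),
    ((l.map fun x => x.2.1).sum, (l.map fun x => x.2.2).sum))

namespace Key

/-- The assignment of the digits of `n` in base `q` to the indices in a list. -/
def ofDigits (q : ℕ) : List ℕ → ℕ → Key
  | [], _ => []
  | i :: I, n => (i, n % q) :: ofDigits q I (n / q)

/-- The successor in the enumeration of all assignments. -/
def succ (q : ℕ) : Key → Key
  | [] => []
  | p :: k => bif p.2 + 1 == q then (p.1, 0) :: succ q k else (p.1, p.2 + 1) :: k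

def Compatible (k k' : Key) : Bool := k.all fun p => k'.all fun p' => !(p.1 == p'.1) || p.2 == p'.2

def restrict (k : Key) (I : List ℕ) : Key := k.filter fun p => !(I.any fun i => p.1 == i)

def merge (I I' : List ℕ) (k k' : Key) : Key := k.restrict I' ++ k'.restrict I

/-- The assignments that occur in a list, without repetitions. -/
def nub (l : List Key) : List Key :=
  l.foldl (fun acc k => bif acc.any (fun k' => k' == k) then acc else k :: acc) []

end Key

/-- Add up all entries with the same key. -/
def aggregate (l : List (Key × GPair)) : List (Key × GPair) :=
  (Key.nub (l.map fun p => p.1)).map fun k =>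
    (k, GPair.sum ((l.filter fun p => p.1 == k).map fun p => p.2))

def keyedRows {β : Type} (q : ℕ) (I : List ℕ) (l : List β) : List (Key × β) :=
  ((List.range l.length).map (Key.ofDigits q I)).zip l

/-- The product of the denominators of a list of Gaussian rationals. -/
def rowsDen (l : List (Key × RawRat × RawRat)) : ℕ := (l.map fun p => p.2.1.2 * p.2.2.2).prod

/-- Reduction of a table to a common denominator. -/
def scaledRows (l : List (Key × RawRat × RawRat)) : List (Key × GPair) :=
  l.map fun p => (p.1,
    (p.2.1.scale (p.2.2.2 * rowsDen (l.filter fun p' => !(p'.1 == p.1))),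
     p.2.2.scale (p.2.1.2 * rowsDen (l.filter fun p' => !(p'.1 == p.1)))))

namespace Entry

def leaf (q : ℕ) (I : List ℕ) (c : List (Option ℕ)) (l : List (RawRat × RawRat)) : Entry :=
  (c, I, rowsDen (keyedRows q I l), scaledRows (keyedRows q I l))

def Apart (e e' : Entry) : Bool := (e.1.zip e'.1).all fun p => p.1.isNone || p.2.isNone

/-- The products of the entries of two tables that agree on the common indices. -/
def products (e e' : Entry) : List (Key × GPair) :=
  e.2.2.2.flatMap fun p => (e'.2.2.2.filter fun p' => p.1.Compatible p'.1).map fun p' =>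
    (Key.merge e.2.1 e'.2.1 p.1 p'.1, GPair.mul p.2 p'.2)

/-- The contraction of two tensors. -/
def merge (e e' : Entry) : Entry :=
  ((e.1.zip e'.1).map fun p => p.1.or p.2,
    (e.2.1.filter fun i => !(e'.2.1.any fun i' => i == i')) ++
      (e'.2.1.filter fun i => !(e.2.1.any fun i' => i == i')),
    e.2.2.1 * e'.2.2.1, aggregate (products e e'))

/-- `|z / D - z' / D'| ≤ 1 / k` -/
def closeZ (k D D' : ℕ) (z z' : ZPair) : Bool :=
  decide (k * (z.1 * D' + z'.2 * D) ≤ D * D' + k * (z'.1 * D + z.2 * D')) &&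
    decide (k * (z'.1 * D + z.2 * D') ≤ D * D' + k * (z.1 * D' + z'.2 * D))

/-- The two entries are based on the same positions and their tensors are almost equal. -/
def Close (M : ℕ) (e e' : Entry) : Bool :=
  ((e.2.1 == e'.2.1) && (e.1.map fun o => o.isSome) == (e'.1.map fun o => o.isSome)) &&
    e.2.2.2.all fun p => e'.2.2.2.all fun p' => !(p.1 == p'.1) ||
      (closeZ (M * e.2.2.2.length) e.2.2.1 e'.2.2.1 p.2.1 p'.2.1 &&
        closeZ (M * e.2.2.2.length) e.2.2.1 e'.2.2.1 p.2.2 p'.2.2)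

def Full (e : Entry) : Bool := e.1.all fun o => o.isSome

def total (e : Entry) : GPair := GPair.sum (e.2.2.2.map fun p => p.2)

/-- The square of the absolute value of `x`. -/
def normSq (x : GPair) : ZPair :=
  (x.1.1 * x.1.1 + x.1.2 * x.1.2 + (x.2.1 * x.2.1 + x.2.2 * x.2.2),
    x.1.1 * x.1.2 + x.1.2 * x.1.1 + (x.2.1 * x.2.2 + x.2.2 * x.2.1))

/-- Comparison of the absolute values of two tensors without indices. -/
def Le (e e' : Entry) : Bool :=
  decide ((normSq e.total).1 * (e'.2.2.1 * e'.2.2.1) + (normSq e'.total).2 * (e.2.2.1 * e.2.2.1) ≤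
    (normSq e'.total).1 * (e.2.2.1 * e.2.2.1) + (normSq e.total).2 * (e'.2.2.1 * e'.2.2.1))

def best (l : List Entry) : Option Entry :=
  l.foldl (fun o e => o.elim (some e) fun e' => bif Le e' e then some e else some e') none

end Entry

namespace LoopState

/-- The two entries need not have a common index; without one, the merge is a tensor product. This
does no harm, as the norm bounds hold for disconnected sets of positions as well. -/
def candidates (s : LoopState) : List Entry :=
  (((s.2.2.2.flatMap fun e => s.2.2.2.map fun e' => (e, e')).filter fun p =>
    Entry.Apart p.1 p.2).map fun p => Entry.merge p.1 p.2).filter fun e =>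
      decide (e.2.1.length ≤ s.2.2.1) && !(s.2.2.2.any fun e' => Entry.Close s.2.1 e e')

/-- The admitted number of indices grows only when the entries are saturated and none of them is
full. Thus the search finds a sufficient bound without a tree decomposition. -/
def step (s : LoopState) : LoopState :=
  s.candidates.head?.elim
    (bif s.2.2.2.any fun e => e.Full then (false, s.2) else (true, s.2.1, s.2.2.1 + 1, s.2.2.2))
    fun e => (true, s.2.1, s.2.2.1, e :: s.2.2.2)

def result (s : LoopState) : List ℕ :=
  (Entry.best (s.2.2.2.filter fun e => e.Full)).elim [] fun e => e.1.map fun o => o.getD 0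

end LoopState

namespace RawInput

/-- A power of two between `1 / δ` and `2 / δ`. -/
def invDelta (δ : RawRat) : ℕ :=
  δ.2.bits.foldl (fun n _ => bif decide (n * δ.1.2 < δ.2) then 2 * n else n) 1

def leaves (x : RawInput) : List Entry :=
  (x.2.2.zip (List.range x.2.2.length)).flatMap fun p =>
    (p.1.2.zip (List.range p.1.2.length)).map fun t =>
      Entry.leaf (x.1 * x.1) p.1.1
        ((List.range x.2.2.length).map fun j => bif j == p.2 then some t.2 else none) t.1

/-- With `D = invDelta δ ≥ 1 / δ` and contractions of norm at most two, fewer than `m` merges of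
error `2 / M` cost at most `4 * m / (64 * m * D) ≤ δ / 16` in total. -/
def start (x : RawInput) : LoopState := (true, 64 * x.2.2.length * invDelta x.2.1, 0, x.leaves)

end RawInput

/-! ### The parts of the algorithm take polynomial time -/

namespace PolyTime

variable {α β γ δ : Type} [Coded α] [Coded β] [Coded γ] [Coded δ]

@[fun_prop]
theorem option_elim_const {f : α → Option β} {g : α → γ} {h : α → β → γ} (hf : PolyTime f)
    (hg : PolyTime g) (hh : PolyTime fun p : α × β => h p.1 p.2) :
    PolyTime fun x => Option.elim (f x) (g x) (h x) := optionElim hf hg hh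

@[fun_prop]
theorem rawRat_scale {f : α → RawRat} {g : α → ℕ} (hf : PolyTime f) (hg : PolyTime g) :
    PolyTime fun x => (f x).scale (g x) := by
  unfold RawRat.scale
  fun_prop

@[fun_prop]
theorem gPair_mul {f g : α → GPair} (hf : PolyTime f) (hg : PolyTime g) :
    PolyTime fun x => GPair.mul (f x) (g x) := by
  unfold GPair.mul
  fun_prop

@[fun_prop]
theorem gPair_sum {f : α → List GPair} (hf : PolyTime f) :
    PolyTime fun x => GPair.sum (f x) := by
  unfold GPair.sum
  fun_prop

@[fun_prop]
theorem beq_pair {f g : α → ℕ × ℕ} (hf : PolyTime f) (hg : PolyTime g) :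
    PolyTime fun x => f x == g x :=
  ((hf.fst.beq_nat hg.fst).and (hf.snd.beq_nat hg.snd)).congr_fun fun _ => rfl

@[fun_prop]
theorem beq_key {f g : α → Key} (hf : PolyTime f) (hg : PolyTime g) :
    PolyTime fun x => f x == g x := beq_list (by fun_prop) hf hg

@[fun_prop]
theorem beq_listNat {f g : α → List ℕ} (hf : PolyTime f) (hg : PolyTime g) :
    PolyTime fun x => f x == g x := beq_list (by fun_prop) hf hg

@[fun_prop]
theorem beq_listBool {f g : α → List Bool} (hf : PolyTime f) (hg : PolyTime g) :
    PolyTime fun x => f x == g x := beq_list (by fun_prop) hf hg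

@[fun_prop]
theorem key_compatible {f g : α → Key} (hf : PolyTime f) (hg : PolyTime g) :
    PolyTime fun x => (f x).Compatible (g x) := by
  unfold Key.Compatible
  fun_prop

@[fun_prop]
theorem key_merge {f g : α → Key} {I J : α → List ℕ} (hI : PolyTime I) (hJ : PolyTime J)
    (hf : PolyTime f) (hg : PolyTime g) :
    PolyTime fun x => Key.merge (I x) (J x) (f x) (g x) := by
  unfold Key.merge Key.restrict
  fun_prop

@[fun_prop]
theorem key_nub {f : α → List Key} (hf : PolyTime f) : PolyTime fun x => Key.nub (f x) := by
  refine comp (g := Key.nub) (foldl_of_add (h := fun (_ : List Key) (acc : List Key) (k : Key) =>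
    bif acc.any (fun k' => k' == k) then acc else k :: acc) (w := fun p => sz p.2 + 1) id (const _)
    (by fun_prop) ((PolyBounded.sz.comp (f := Prod.snd) snd'.size).add (.const 1)) ?_) hf
  intro _ c k
  dsimp only
  cases c.any (fun k' => k' == k)
  · rw [cond_false, sz_cons]
    omega
  · exact Nat.le_add_right _ _

@[fun_prop]
theorem aggregate {f : α → List (Key × GPair)} (hf : PolyTime f) :
    PolyTime fun x => aggregate (f x) := by
  unfold _root_.aggregate
  fun_prop

@[fun_prop]
theorem key_succ {q : α → ℕ} {f : α → Key} (hq : PolyTime q) (hf : PolyTime f) :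
    PolyTime fun x => Key.succ (q x) (f x) := by
  -- The recursion is turned into a left fold whose flag tells whether the carry is still to be
  -- propagated.
  have h : PolyTime fun p : ℕ × Key => (p.2.foldl (fun (s : Bool × Key) b =>
      bif s.1 then (bif b.2 + 1 == p.1 then (true, (b.1, 0) :: s.2)
        else (false, (b.1, b.2 + 1) :: s.2)) else (false, b :: s.2)) (true, [])).2.reverse := by
    refine reverse (snd (foldl_of_add (h := fun (p : ℕ × Key) (s : Bool × Key) b =>
      bif s.1 then (bif b.2 + 1 == p.1 then (true, (b.1, 0) :: s.2)
        else (false, (b.1, b.2 + 1) :: s.2)) else (false, b :: s.2))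
      (w := fun p => sz p.2.1 + sz (p.2.2 + 1) + sz p.2.2 + 7) (by fun_prop) (by fun_prop)
      (by fun_prop) ?_ ?_))
    · refine PolyBounded.add (PolyBounded.add (PolyBounded.add ?_ ?_) ?_) (.const _)
      · exact PolyBounded.sz.comp (f := fun p : (ℕ × Key) × ℕ × ℕ => p.2.1) (size (by fun_prop))
      · exact PolyBounded.sz.comp (f := fun p : (ℕ × Key) × ℕ × ℕ => p.2.2 + 1)
          (size (by fun_prop))
      · exact PolyBounded.sz.comp (f := fun p : (ℕ × Key) × ℕ × ℕ => p.2.2) (size (by fun_prop))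
    · rintro p ⟨c, k⟩ ⟨i, b⟩
      have h0 : sz 0 = 1 := rfl
      have h1 := sz_bool true
      have h2 := sz_bool false
      have h3 := sz_pos c
      dsimp only
      cases c
      · simp only [cond_false, sz_prod, sz_cons]
        omega
      · cases (b + 1 == p.1)
        · simp only [cond_false, cond_true, sz_prod, sz_cons]
          omega
        · simp only [cond_true, sz_prod, sz_cons]
          omega
  refine (h.comp (hq.prodMk hf)).congr_fun fun x => ?_
  dsimp only
  have h1 : ∀ (q : ℕ) (k k' : Key), (k.foldl (fun (s : Bool × Key) b =>
      bif s.1 then (bif b.2 + 1 == q then (true, (b.1, 0) :: s.2)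
        else (false, (b.1, b.2 + 1) :: s.2)) else (false, b :: s.2)) (false, k')).2 =
        k.reverse ++ k' := by
    intro q k
    induction k with
    | nil => simp
    | cons b k ih => intro k'; rw [List.foldl_cons, cond_false, ih]; simp
  have h2 : ∀ (q : ℕ) (k k' : Key), (k.foldl (fun (s : Bool × Key) b =>
      bif s.1 then (bif b.2 + 1 == q then (true, (b.1, 0) :: s.2)
        else (false, (b.1, b.2 + 1) :: s.2)) else (false, b :: s.2)) (true, k')).2 =
        (Key.succ q k).reverse ++ k' := by
    intro q k
    induction k with
    | nil => simp [Key.succ]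
    | cons b k ih =>
      intro k'
      rw [List.foldl_cons, cond_true, Key.succ]
      cases b.2 + 1 == q
      · rw [cond_false, h1]; simp
      · rw [cond_true, ih]; simp
  simp [h2]

end PolyTime

namespace Key

theorem ofDigits_zero (q : ℕ) (I : List ℕ) : ofDigits q I 0 = I.map fun i => (i, 0) := by
  induction I with
  | nil => rfl
  | cons i I ih => simp [ofDigits, ih]

theorem succ_ofDigits (q : ℕ) (I : List ℕ) (n : ℕ) :
    succ q (ofDigits q I n) = ofDigits q I (n + 1) := by
  induction I generalizing n with
  | nil => rfl
  | cons i I ih =>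
    rw [ofDigits, succ, ofDigits, ih]
    rcases Nat.eq_zero_or_pos q with rfl | hq
    · simp
    · by_cases h : n % q + 1 = q
      · have h1 : (n + 1) % q = 0 := by rw [← Nat.mod_add_mod, h, Nat.mod_self]
        have h2 : (n + 1) / q = n / q + 1 := by
          rw [Nat.succ_div, if_pos (Nat.dvd_of_mod_eq_zero h1)]
        simp [h, h1, h2]
      · have h1 : (n + 1) % q = n % q + 1 := by
          rw [← Nat.mod_add_mod, Nat.mod_eq_of_lt]
          have := Nat.mod_lt n hq
          omega
        have h2 : (n + 1) / q = n / q := by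
          rw [Nat.succ_div, if_neg]
          · rfl
          intro h3
          have := Nat.mod_eq_zero_of_dvd h3
          omega
        rw [h1, h2, beq_eq_false_iff_ne.2 h, cond_false]

theorem sz_ofDigits (q : ℕ) (I : List ℕ) (n : ℕ) :
    sz (ofDigits q I n) ≤ sz I + I.length * (4 * n + 2) := by
  induction I generalizing n with
  | nil => simp [ofDigits, sz_nil]
  | cons i I ih =>
    have h1 := ih (n / q)
    have h2 := sz_nat_le_self (n % q)
    have h3 := Nat.mod_le n q
    have h4 : I.length * (4 * (n / q) + 2) ≤ I.length * (4 * n + 2) := by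
      have := Nat.div_le_self n q
      gcongr
    rw [ofDigits, sz_cons, sz_prod, sz_cons, List.length_cons, Nat.succ_mul]
    omega

end Key

namespace PolyTime

variable {α β γ δ : Type} [Coded α] [Coded β] [Coded γ] [Coded δ]

@[fun_prop]
theorem ofDigits_range {q : α → ℕ} {I : α → List ℕ} {f : α → List β} (hq : PolyTime q)
    (hI : PolyTime I) (hf : PolyTime f) :
    PolyTime fun x => (List.range (f x).length).map (Key.ofDigits (q x) (I x)) := by
  -- All assignments are enumerated by repeated application of the successor, which avoids division
  -- by `q`.
  have key : ∀ (q : ℕ) (I : List ℕ) (l : List β), l.foldl (fun (s : Key × List Key) _ =>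
      (s.1.succ q, s.1 :: s.2)) (I.map fun i => (i, 0), []) =
      (Key.ofDigits q I l.length, ((List.range l.length).map (Key.ofDigits q I)).reverse) := by
    intro q I l
    induction l using List.reverseRecOn with
    | nil => simp [Key.ofDigits_zero]
    | append_singleton l b ih => simp [ih, List.range_succ, Key.succ_ofDigits]
  have h : PolyTime fun x => (((f x).foldl (fun (s : Key × List Key) _ =>
      (s.1.succ (q x), s.1 :: s.2)) ((I x).map fun i => (i, 0), [])).2).reverse := by
    refine reverse (snd (foldl (h := fun x (s : Key × List Key) _ => (s.1.succ (q x), s.1 :: s.2))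
      (B := fun x => (sz (f x) + 1) * (sz (I x) + sz (I x) * (4 * sz (f x) + 2) + 1) + 2)
      (by fun_prop) (by fun_prop) (by fun_prop) ?_ ?_))
    · exact ((hf.size.add (.const 1)).mul ((hI.size.add (hI.size.mul
        (((PolyBounded.const 4).mul hf.size).add (.const 2)))).add (.const 1))).add (.const 2)
    · intro x l hl
      rw [key, sz_prod, sz_reverse]
      have hl' : l.length ≤ sz (f x) := (hl.length_le).trans (length_lt_sz _).le
      have h1 : ∀ n ≤ sz (f x), sz (Key.ofDigits (q x) (I x) n) ≤
          sz (I x) + sz (I x) * (4 * sz (f x) + 2) := by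
        intro n hn
        refine (Key.sz_ofDigits _ _ _).trans (Nat.add_le_add_left (Nat.mul_le_mul ?_ ?_) _)
        · exact (length_lt_sz _).le
        · omega
      have h2 := h1 _ hl'
      have h3 : sz ((List.range l.length).map (Key.ofDigits (q x) (I x))) ≤ _ :=
        sz_le_of_forall (b := sz (I x) + sz (I x) * (4 * sz (f x) + 2)) fun k hk => by
          obtain ⟨n, hn, rfl⟩ := List.mem_map.1 hk
          rw [List.mem_range] at hn
          exact h1 n (by omega)
      rw [List.length_map, List.length_range] at h3
      have h4 := Nat.mul_le_mul_right (sz (I x) + sz (I x) * (4 * sz (f x) + 2) + 1) hl'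
      rw [Nat.succ_mul]
      omega
  exact h.congr_fun fun x => by rw [key, List.reverse_reverse]

@[fun_prop]
theorem keyedRows {q : α → ℕ} {I : α → List ℕ} {f : α → List β} (hq : PolyTime q)
    (hI : PolyTime I) (hf : PolyTime f) : PolyTime fun x => keyedRows (q x) (I x) (f x) :=
  (ofDigits_range hq hI hf).zip hf

@[fun_prop]
theorem rowsDen {f : α → List (Key × RawRat × RawRat)} (hf : PolyTime f) :
    PolyTime fun x => rowsDen (f x) := by
  unfold _root_.rowsDen
  fun_prop

@[fun_prop]
theorem scaledRows {f : α → List (Key × RawRat × RawRat)} (hf : PolyTime f) :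
    PolyTime fun x => scaledRows (f x) := by
  unfold _root_.scaledRows
  fun_prop

@[fun_prop]
theorem entry_leaf {q : α → ℕ} {I : α → List ℕ} {c : α → List (Option ℕ)}
    {f : α → List (RawRat × RawRat)} (hq : PolyTime q) (hI : PolyTime I) (hc : PolyTime c)
    (hf : PolyTime f) : PolyTime fun x => Entry.leaf (q x) (I x) (c x) (f x) := by
  unfold Entry.leaf
  fun_prop

@[fun_prop]
theorem entry_apart {f g : α → Entry} (hf : PolyTime f) (hg : PolyTime g) :
    PolyTime fun x => (f x).Apart (g x) := by
  unfold Entry.Apart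
  fun_prop

@[fun_prop]
theorem entry_products {f g : α → Entry} (hf : PolyTime f) (hg : PolyTime g) :
    PolyTime fun x => (f x).products (g x) := by
  unfold Entry.products
  fun_prop

@[fun_prop]
theorem entry_merge {f g : α → Entry} (hf : PolyTime f) (hg : PolyTime g) :
    PolyTime fun x => (f x).merge (g x) := by
  unfold Entry.merge
  fun_prop

@[fun_prop]
theorem entry_closeZ {k D D' : α → ℕ} {z z' : α → ZPair} (hk : PolyTime k) (hD : PolyTime D)
    (hD' : PolyTime D') (hz : PolyTime z) (hz' : PolyTime z') :
    PolyTime fun x => Entry.closeZ (k x) (D x) (D' x) (z x) (z' x) := by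
  unfold Entry.closeZ
  fun_prop

@[fun_prop]
theorem entry_close {M : α → ℕ} {f g : α → Entry} (hM : PolyTime M) (hf : PolyTime f)
    (hg : PolyTime g) : PolyTime fun x => Entry.Close (M x) (f x) (g x) := by
  unfold Entry.Close
  fun_prop

@[fun_prop]
theorem entry_full {f : α → Entry} (hf : PolyTime f) : PolyTime fun x => (f x).Full := by
  unfold Entry.Full
  fun_prop

@[fun_prop]
theorem entry_le {f g : α → Entry} (hf : PolyTime f) (hg : PolyTime g) :
    PolyTime fun x => Entry.Le (f x) (g x) := by
  unfold Entry.Le Entry.normSq Entry.total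
  fun_prop

@[fun_prop]
theorem entry_best {f : α → List Entry} (hf : PolyTime f) :
    PolyTime fun x => Entry.best (f x) := by
  refine comp (g := Entry.best) (foldl_of_add (h := fun (_ : List Entry) (o : Option Entry) (e : Entry) =>
    o.elim (Option.some e) fun e' =>
    bif Entry.Le e' e then Option.some e else Option.some e') (w := fun p => sz p.2 + 2) id
    (const _) (by fun_prop) ((PolyBounded.sz.comp (f := Prod.snd) snd'.size).add (.const 2)) ?_) hf
  rintro _ (_ | e') e
  · simp only [Option.elim_none, sz_some]
    omega
  · simp only [Option.elim_some]
    cases Entry.Le e' e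
    · exact Nat.le_add_right _ _
    · simp only [cond_true, sz_some]
      omega

theorem step : PolyTime LoopState.step := by
  have h : PolyTime LoopState.candidates := by
    unfold LoopState.candidates
    fun_prop
  unfold LoopState.step
  fun_prop

theorem result : PolyTime LoopState.result := by
  unfold LoopState.result
  fun_prop

@[fun_prop]
theorem invDelta {f : α → RawRat} (hf : PolyTime f) :
    PolyTime fun x => RawInput.invDelta (f x) := by
  refine comp (g := RawInput.invDelta) (foldl_nat (h := fun (δ : RawRat) n _ =>
    bif decide (n * δ.1.2 < δ.2) then 2 * n else n) (w := fun _ => 2) (by fun_prop) (const _)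
    (by fun_prop) (.const _) ?_) hf
  intro δ n _
  have h1 := size_mul_le 2 n
  have h3 : Nat.size 2 = 2 := by decide
  cases decide (n * δ.1.2 < δ.2)
  · exact Nat.le_add_right _ _
  · rw [cond_true]
    omega

theorem start : PolyTime RawInput.start := by
  unfold RawInput.start RawInput.leaves
  fun_prop

end PolyTime

/-- A loop whose body takes polynomial time. -/
theorem PolyTime.exists_loop {α β γ : Type} [Coded α] [Coded β] [Coded γ] {start : α → Bool × γ}
    {step : Bool × γ → Bool × γ} {result : Bool × γ → β} (h1 : PolyTime start)
    (h2 : PolyTime step) (h3 : PolyTime result) :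
    ∃ (A : Program) (k : ℕ), ∀ x N Z, (∀ i < N, (step^[i] (start x)).1 = true) →
      (step^[N] (start x)).1 = false → (∀ i ≤ N, sz (step^[i] (start x)) ≤ Z) →
      ∃ n ≤ ((sz x + 1) * ((N + 1) * (Z + 1))) ^ k,
        A.Runs (enc x) (enc (result (step^[N] (start x)))) n := by
  obtain ⟨p, t, ⟨k₁, ht⟩, hp⟩ := h1.runs
  obtain ⟨q, u, ⟨k₂, hu⟩, hq⟩ := h2.runs
  obtain ⟨r, v, ⟨k₃, hv⟩, hr⟩ := h3.runs
  refine ⟨.comp r (.comp (.loop .hd q) p), k₁ + k₂ + k₃ + 4, fun x N Z hN hN' hZ => ?_⟩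
  obtain ⟨n₁, hn₁, r₁⟩ := hp x
  obtain ⟨n₃, hn₃, r₃⟩ := hr (step^[N] (start x))
  obtain ⟨n₂, hn₂, r₂⟩ := Program.runs_loop (c := .hd) (p := q)
    (s := fun i => enc (step^[i] (start x))) (tc := 1) (tp := (Z + 1) ^ k₂) N (fun i hi => by
      constructor
      · refine ⟨.nil, .nil, 1, le_rfl, ?_⟩
        have : (enc (step^[i] (start x))).hd = .cons .nil .nil := by
          change enc (step^[i] (start x)).1 = _
          rw [hN i hi, enc_true]
        rw [← this]
        exact .hd _
      · obtain ⟨n, hn, h⟩ := hq (step^[i] (start x))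
        rw [← Function.iterate_succ_apply' step] at h
        exact ⟨n, hn.trans ((hu _).trans (Nat.pow_le_pow_left
          (Nat.succ_le_succ (hZ i (by omega))) _)), h⟩) (by
      refine ⟨1, le_rfl, ?_⟩
      have : (enc (step^[N] (start x))).hd = .nil := by
        change enc (step^[N] (start x)).1 = _
        rw [hN', enc_false]
      rw [← this]
      exact .hd _)
  refine ⟨n₁ + n₂ + 1 + n₃ + 1, ?_, .comp (.comp r₁ r₂) r₃⟩
  have e1 : n₁ ≤ (sz x + 1) ^ k₁ := hn₁.trans (ht x)
  have e3 : n₃ ≤ (Z + 1) ^ k₃ := hn₃.trans ((hv _).trans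
    (Nat.pow_le_pow_left (Nat.succ_le_succ (hZ N le_rfl)) _))
  have hZ1 : 1 ≤ Z := (sz_pos _).trans (hZ N le_rfl)
  set a := sz x + 1 with ha
  have ha2 : 2 ≤ a := by have := sz_pos x; omega
  set b := Z + 1 with hb
  have hb2 : 2 ≤ b := by omega
  set c := N + 1 with hc
  have f1 : 1 ≤ a ^ k₁ := Nat.one_le_pow _ _ (by omega)
  have f2 : 1 ≤ b ^ k₂ := Nat.one_le_pow _ _ (by omega)
  have f3 : 1 ≤ b ^ k₃ := Nat.one_le_pow _ _ (by omega)
  have g1 : N * (1 + b ^ k₂ + 1) + 1 + 1 ≤ 4 * (c * b ^ k₂) := by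
    rw [hc]
    nlinarith
  have g2 : 1 ≤ c := by omega
  have g3 : a ^ k₁ ≤ a ^ k₁ * (c * (b ^ k₂ * b ^ k₃)) :=
    Nat.le_mul_of_pos_right _ (by positivity)
  have g4 : c * b ^ k₂ ≤ a ^ k₁ * (c * (b ^ k₂ * b ^ k₃)) := by
    calc c * b ^ k₂ = 1 * (c * (b ^ k₂ * 1)) := by ring
      _ ≤ _ := by gcongr
  have g5 : b ^ k₃ ≤ a ^ k₁ * (c * (b ^ k₂ * b ^ k₃)) := by
    calc b ^ k₃ = 1 * (1 * (1 * b ^ k₃)) := by ring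
      _ ≤ _ := by gcongr
  calc n₁ + n₂ + 1 + n₃ + 1 ≤ 16 * (a ^ k₁ * (c * (b ^ k₂ * b ^ k₃))) := by linarith
    _ ≤ a ^ 4 * (a ^ k₁ * (c * (b ^ k₂ * b ^ k₃))) := by
        gcongr
        calc 16 = 2 ^ 4 := by norm_num
          _ ≤ a ^ 4 := by gcongr
    _ = a ^ (k₁ + 4) * (c ^ 1 * b ^ (k₂ + k₃)) := by ring
    _ ≤ a ^ (k₁ + k₂ + k₃ + 4) * (c ^ (k₁ + k₂ + k₃ + 4) * b ^ (k₁ + k₂ + k₃ + 4)) := by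
        exact Nat.mul_le_mul (Nat.pow_le_pow_right (by omega) (by omega))
          (Nat.mul_le_mul (Nat.pow_le_pow_right (by omega) (by omega))
            (Nat.pow_le_pow_right (by omega) (by omega)))
    _ = _ := by rw [← mul_pow, ← mul_pow]

/-! ### Contractions of arbitrary sets of tensors of a network -/

namespace AbstractNetwork

variable (N : AbstractNetwork) {d : ℕ}

/-- The number of positions in `S` at which the index `i` occurs. -/
def occ (S : Finset (Fin N.size)) (i : ℕ) : ℕ := (S.filter fun j => i ∈ N.I j).card

def indices : Finset ℕ := Finset.univ.biUnion N.I

/-- The indices that occur exactly once in `S`. -/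
def boundary (S : Finset (Fin N.size)) : Finset ℕ := N.indices.filter fun i => N.occ S i = 1

/-- The indices that occur twice in `S`. -/
def interior (S : Finset (Fin N.size)) : Finset ℕ := N.indices.filter fun i => N.occ S i = 2

variable {N}

theorem mem_indices {i : ℕ} : i ∈ N.indices ↔ ∃ j, i ∈ N.I j := by simp [indices]

theorem occ_le_two (S : Finset (Fin N.size)) (i : ℕ) : N.occ S i ≤ 2 := by
  by_cases h : ∃ j, i ∈ N.I j
  · obtain ⟨j, hj⟩ := h
    rw [← N.two j i hj]
    exact Finset.card_le_card (Finset.filter_subset_filter _ (Finset.subset_univ S))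
  · push Not at h
    simp [occ, h]

theorem occ_pos_iff {S : Finset (Fin N.size)} {i : ℕ} : 0 < N.occ S i ↔ ∃ j ∈ S, i ∈ N.I j := by
  simp [occ, Finset.card_pos, Finset.Nonempty]

theorem mem_indices_of_occ_ne_zero {S : Finset (Fin N.size)} {i : ℕ} (h : N.occ S i ≠ 0) :
    i ∈ N.indices := by
  obtain ⟨j, -, hj⟩ := occ_pos_iff.1 (Nat.pos_of_ne_zero h)
  exact mem_indices.2 ⟨j, hj⟩

theorem mem_boundary {S : Finset (Fin N.size)} {i : ℕ} : i ∈ N.boundary S ↔ N.occ S i = 1 := by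
  rw [boundary, Finset.mem_filter, and_iff_right_iff_imp]
  exact fun h => mem_indices_of_occ_ne_zero (S := S) (by rw [h]; decide)

theorem mem_interior {S : Finset (Fin N.size)} {i : ℕ} : i ∈ N.interior S ↔ N.occ S i = 2 := by
  rw [interior, Finset.mem_filter, and_iff_right_iff_imp]
  exact fun h => mem_indices_of_occ_ne_zero (S := S) (by rw [h]; decide)

theorem occ_union {S T : Finset (Fin N.size)} (h : Disjoint S T) (i : ℕ) :
    N.occ (S ∪ T) i = N.occ S i + N.occ T i := by
  rw [occ, Finset.filter_union, Finset.card_union_of_disjoint (Finset.disjoint_filter_filter h)]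
  rfl

theorem occ_singleton (j : Fin N.size) (i : ℕ) : N.occ {j} i = if i ∈ N.I j then 1 else 0 := by
  rw [occ, Finset.filter_singleton]
  split_ifs <;> rfl

theorem boundary_singleton (j : Fin N.size) : N.boundary {j} = N.I j := by
  ext i
  simp [mem_boundary, occ_singleton]

theorem interior_singleton (j : Fin N.size) : N.interior {j} = ∅ := by
  ext i
  rw [mem_interior, occ_singleton]
  split_ifs <;> simp

theorem boundary_union {S T : Finset (Fin N.size)} (h : Disjoint S T) :
    N.boundary (S ∪ T) = symmDiff (N.boundary S) (N.boundary T) := by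
  ext i
  have h2 := N.occ_le_two (S ∪ T) i
  rw [Finset.mem_symmDiff, mem_boundary, mem_boundary, mem_boundary, occ_union h] at *
  omega

theorem boundary_univ : N.boundary Finset.univ = ∅ := by
  ext i
  simp only [mem_boundary, Finset.notMem_empty, iff_false]
  intro h
  obtain ⟨j, -, hj⟩ := occ_pos_iff.1 (h ▸ Nat.one_pos)
  have := N.two j i hj
  rw [occ, this] at h
  omega

/-- The contraction of the tensors at the positions in `S`, evaluated at the values `σ` of the
indices. -/
noncomputable def contraction (lam : N.Labelling d) (S : Finset (Fin N.size))
    (σ : ℕ → Fin d × Fin d) : ℂ :=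
  ∑ ρ : N.interior S → Fin d × Fin d,
    ∏ j ∈ S, lam j fun i => Function.updateFinset σ (N.interior S) ρ i

/-- An index at a position of `S` is either on the boundary or in the interior of `S`, and in the
latter case the value given by `σ` is overwritten in the sum. -/
theorem contraction_congr {lam lam' : N.Labelling d} {S : Finset (Fin N.size)}
    {σ σ' : ℕ → Fin d × Fin d} (h : ∀ j ∈ S, lam j = lam' j) (hσ : ∀ i ∈ N.boundary S, σ i = σ' i) :
    N.contraction lam S σ = N.contraction lam' S σ' := by
  refine Finset.sum_congr rfl fun ρ _ => Finset.prod_congr rfl fun j hj => ?_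
  rw [h j hj]
  congr 1
  funext i
  by_cases hi : (i : ℕ) ∈ N.interior S
  · simp [Function.updateFinset, hi]
  · have h1 : (i : ℕ) ∈ N.boundary S := by
      have h2 := N.occ_le_two S i
      have h3 := (occ_pos_iff (S := S)).2 ⟨j, hj, i.2⟩
      rw [mem_interior] at hi
      rw [mem_boundary]
      omega
    simp [Function.updateFinset, hi, hσ i h1]

theorem contraction_empty (lam : N.Labelling d) (σ : ℕ → Fin d × Fin d) :
    N.contraction lam ∅ σ = 1 := by
  have : N.interior ∅ = ∅ := by
    ext i
    simp [mem_interior, occ]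
  rw [contraction, this]
  simp

theorem contraction_singleton (lam : N.Labelling d) (j : Fin N.size) (σ : ℕ → Fin d × Fin d) :
    N.contraction lam {j} σ = lam j fun i => σ i := by
  rw [contraction, interior_singleton]
  simp [Function.updateFinset]

/-- The gluing law behind both the error estimates and the correctness of merging. As no index
occurs more than twice, the interior of the union is the disjoint union of the two interiors and the
common boundary, and an interior index of one set does not occur in the other; hence the sum
factors. -/
theorem contraction_union (lam : N.Labelling d) {S T : Finset (Fin N.size)} (h : Disjoint S T)
    (σ : ℕ → Fin d × Fin d) :
    N.contraction lam (S ∪ T) σ = ∑ ρ : (N.boundary S ∩ N.boundary T : Finset ℕ) → Fin d × Fin d,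
      N.contraction lam S (Function.updateFinset σ _ ρ) *
        N.contraction lam T (Function.updateFinset σ _ ρ) := by
  have h2 : ∀ i, N.occ S i + N.occ T i ≤ 2 := fun i => by
    rw [← occ_union h]
    exact occ_le_two _ _
  have hA : ∀ i, i ∈ N.boundary S ∩ N.boundary T ↔ N.occ S i = 1 ∧ N.occ T i = 1 := fun i => by
    rw [Finset.mem_inter, mem_boundary, mem_boundary]
  have d1 : Disjoint (N.boundary S ∩ N.boundary T) (N.interior S) := by
    rw [Finset.disjoint_left]
    intro i hi hi'
    rw [hA] at hi
    rw [mem_interior] at hi'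
    omega
  have d2 : Disjoint ((N.boundary S ∩ N.boundary T) ∪ N.interior S) (N.interior T) := by
    rw [Finset.disjoint_left]
    intro i hi hi'
    rw [Finset.mem_union, hA, mem_interior] at hi
    rw [mem_interior] at hi'
    have := h2 i
    omega
  have hu : N.interior (S ∪ T) =
      ((N.boundary S ∩ N.boundary T) ∪ N.interior S) ∪ N.interior T := by
    ext i
    rw [Finset.mem_union, Finset.mem_union, hA, mem_interior, mem_interior, mem_interior,
      occ_union h]
    have := h2 i
    omega
  have key := fun f => ContractionTree.sum_updateFinset (d := d) d2 f σ
  have key' := fun f => ContractionTree.sum_updateFinset (d := d) d1 f σ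
  rw [contraction, hu]
  rw [← key fun σ' => ∏ j ∈ S ∪ T, lam j fun i => σ' i]
  rw [← key' fun σ' => ∑ ρ' : N.interior T → Fin d × Fin d, ∏ j ∈ S ∪ T, lam j fun i =>
    Function.updateFinset σ' (N.interior T) ρ' i]
  refine Finset.sum_congr rfl fun ρ _ => ?_
  rw [contraction, contraction, Finset.sum_mul_sum]
  refine Finset.sum_congr rfl fun ρ₁ _ => Finset.sum_congr rfl fun ρ₂ _ => ?_
  rw [Finset.prod_union h]
  congr 1
  · refine Finset.prod_congr rfl fun j hj => ?_
    congr 1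
    funext i
    have h3 := (occ_pos_iff (S := S)).2 ⟨j, hj, i.2⟩
    have : (i : ℕ) ∉ N.interior T := by
      rw [mem_interior]
      have := h2 i
      omega
    simp [Function.updateFinset, this]
  · refine Finset.prod_congr rfl fun j hj => ?_
    congr 1
    funext i
    have h3 := (occ_pos_iff (S := T)).2 ⟨j, hj, i.2⟩
    have : (i : ℕ) ∉ N.interior S := by
      rw [mem_interior]
      have := h2 i
      omega
    simp [Function.updateFinset, this]

theorem simulate_eq_contraction (lam : N.Labelling d) {T : ContractionTree N.size}
    (hT : T.leaves.Nodup) (σ : ℕ → Fin d × Fin d) :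
    T.simulate lam (fun i => σ i) = N.contraction lam T.leaves.toFinset σ := by
  have h1 : ∀ i, T.occ i = N.occ T.leaves.toFinset i := fun i => by
    rw [ContractionTree.occ_eq_card hT, occ]
    congr 1
    ext j
    simp
  have h2 : T.inner = N.interior T.leaves.toFinset := by
    ext i
    rw [ContractionTree.mem_inner, mem_interior, h1]
  rw [ContractionTree.simulate_eq lam hT, contraction, h2]
  refine Finset.sum_congr rfl fun ρ _ => ?_
  rw [ContractionTree.leafProd, List.prod_toFinset _ hT]

theorem val_eq_norm_contraction (hd : 0 < d) (hN : N.IsConnected) (lam : N.Labelling d)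
    (σ : ℕ → Fin d × Fin d) : N.val lam = ‖N.contraction lam Finset.univ σ‖ := by
  obtain ⟨T, hT⟩ := ContractionTree.exists_isFull hN
  have h1 : T.leaves.toFinset = Finset.univ := by
    ext j
    simp [hT.2 j]
  have h2 : T.index N = ∅ := by
    ext i
    rw [ContractionTree.mem_index hT.1.1, ContractionTree.occ_eq_card hT.1.1]
    have := congrArg (i ∈ ·) (boundary_univ (N := N))
    simp only [mem_boundary, occ, eq_iff_iff] at this
    simpa [hT.2] using this
  have : IsEmpty (T.index N) := by
    rw [h2]
    infer_instance
  rw [val_eq hd lam hT, ← h1, ← simulate_eq_contraction lam hT.1.1]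
  apply le_antisymm
  · rw [pi_norm_le_iff_of_nonneg (norm_nonneg _)]
    intro τ
    rw [Subsingleton.elim τ (fun i => σ i)]
  · exact norm_le_pi_norm (T.simulate lam) _

/-- If all contractions along trees have norm at most one, then so has the contraction of each set
of tensors, since it is the product of those of the connected components. -/
theorem norm_contraction_le_one {lam : N.Labelling d}
    (hlam : ∀ T : ContractionTree N.size, T.IsPartial → ‖T.simulate lam‖ ≤ 1)
    (S : Finset (Fin N.size)) (σ : ℕ → Fin d × Fin d) : ‖N.contraction lam S σ‖ ≤ 1 := by
  induction S using Finset.strongInduction generalizing σ with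
  | H S ih =>
    rcases S.eq_empty_or_nonempty with rfl | ⟨a, ha⟩
    · simp [contraction_empty]
    -- A contraction tree in `S` with the largest number of leaves exhausts a connected component of
    -- `S`.
    let P : ℕ → Prop := fun n => ∃ T : ContractionTree N.size, T.IsPartial ∧
      T.leaves.toFinset ⊆ S ∧ T.leaves.length = n
    have hP : ∀ n, P n → n ≤ S.card := by
      rintro n ⟨T, hT, hTS, rfl⟩
      rw [← List.toFinset_card_of_nodup hT.1]
      exact Finset.card_le_card hTS
    have hP1 : P 1 := ⟨.leaf a, ⟨by simp [ContractionTree.leaves], trivial⟩,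
      by simpa [ContractionTree.leaves] using ha, by simp [ContractionTree.leaves]⟩
    classical
    obtain ⟨T, hT, hTS, hn⟩ := Nat.findGreatest_spec (hP 1 hP1) hP1
    have hmax : ∀ n, P n → n ≤ T.leaves.length := fun n hn' => by
      rw [hn]
      exact Nat.le_findGreatest (hP n hn') hn'
    have hlen := hmax 1 hP1
    set Y := T.leaves.toFinset with hY
    have hYne : Y.Nonempty := by
      rw [← Finset.card_pos, hY, List.toFinset_card_of_nodup hT.1]
      omega
    -- A common index would allow one more position to be attached to the tree, against maximality.
    have hJ : N.boundary Y ∩ N.boundary (S \ Y) = ∅ := by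
      rw [Finset.eq_empty_iff_forall_notMem]
      intro i hi
      rw [Finset.mem_inter, mem_boundary, mem_boundary] at hi
      obtain ⟨j, hj, hij⟩ := occ_pos_iff.1 (hi.2 ▸ Nat.one_pos)
      rw [Finset.mem_sdiff] at hj
      have hjT : j ∉ T.leaves := fun h => hj.2 (by simpa [hY] using h)
      have : P (T.leaves.length + 1) := by
        refine ⟨.node T (.leaf j), ⟨?_, hT.2, trivial, i, ?_⟩, ?_, by simp [ContractionTree.leaves]⟩
        · rw [ContractionTree.leaves, List.nodup_append]
          refine ⟨hT.1, by simp [ContractionTree.leaves], ?_⟩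
          intro x hx y hy hxy
          simp only [ContractionTree.leaves, List.mem_singleton] at hy
          exact hjT (hy ▸ hxy ▸ hx)
        · rw [Finset.mem_inter, ContractionTree.mem_index hT.1, ContractionTree.occ_eq_card hT.1]
          refine ⟨?_, hij⟩
          rw [← hi.1, occ]
          congr 1
          ext j
          simp [hY]
        · intro x hx
          simp only [ContractionTree.leaves, List.toFinset_append, List.toFinset_cons,
            List.toFinset_nil, Finset.mem_union, Finset.mem_insert, Finset.notMem_empty,
            or_false] at hx
          rcases hx with hx | rfl
          · exact hTS hx
          · exact hj.1
      have := hmax _ this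
      omega
    have hS : S = Y ∪ S \ Y := (Finset.union_sdiff_of_subset hTS).symm
    have h1 := contraction_union lam (Finset.disjoint_sdiff (s := Y) (t := S)) σ
    rw [← hS] at h1
    rw [h1]
    have : IsEmpty (N.boundary Y ∩ N.boundary (S \ Y) : Finset ℕ) := by
      rw [hJ]
      infer_instance
    rw [Fintype.sum_unique, norm_mul]
    refine mul_le_one₀ ?_ (norm_nonneg _) (ih _ (Finset.sdiff_ssubset hTS hYne) _)
    have h3 := simulate_eq_contraction lam hT.1
    rw [← hY] at h3
    rw [← h3]
    exact (norm_le_pi_norm (T.simulate lam) _).trans (hlam T hT)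

/-- The effect of a change of the tensors in `S` on the contraction of a larger set. -/
theorem norm_contraction_sub_le {lam lam' : N.Labelling d} {S X : Finset (Fin N.size)}
    (hSX : S ⊆ X) (h : ∀ j ∈ X \ S, lam j = lam' j) {ε B : ℝ}
    (hε : ∀ σ, ‖N.contraction lam S σ - N.contraction lam' S σ‖ ≤ ε)
    (hB : ∀ σ, ‖N.contraction lam (X \ S) σ‖ ≤ B) (hd : 0 < d) (σ : ℕ → Fin d × Fin d) :
    ‖N.contraction lam X σ - N.contraction lam' X σ‖ ≤
      ((d * d : ℕ) : ℝ) ^ (N.boundary S).card * ε * B := by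
  have hX : X = S ∪ X \ S := (Finset.union_sdiff_of_subset hSX).symm
  have h0 : ∀ σ, N.contraction lam' (X \ S) σ = N.contraction lam (X \ S) σ := fun σ =>
    contraction_congr (fun j hj => (h j hj).symm) fun _ _ => rfl
  have hε0 : 0 ≤ ε := (norm_nonneg _).trans (hε σ)
  have hB0 : 0 ≤ B := (norm_nonneg _).trans (hB σ)
  have h1 := contraction_union lam (Finset.disjoint_sdiff (s := S) (t := X)) σ
  have h2 := contraction_union lam' (Finset.disjoint_sdiff (s := S) (t := X)) σ
  rw [← hX] at h1 h2
  rw [h1, h2, ← Finset.sum_sub_distrib]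
  simp only [h0, ← sub_mul]
  refine (norm_sum_le_of_le (f := fun _ => _) (n := fun _ => ε * B) _ fun ρ _ => ?_).trans ?_
  · rw [norm_mul]
    exact mul_le_mul (hε _) (hB _) (norm_nonneg _) hε0
  · rw [Finset.sum_const, Finset.card_univ, nsmul_eq_mul, mul_assoc]
    refine mul_le_mul_of_nonneg_right ?_ (mul_nonneg hε0 hB0)
    rw [Fintype.card_fun, Fintype.card_prod, Fintype.card_fin, Fintype.card_coe, ← Nat.cast_pow,
      Nat.cast_le]
    exact Nat.pow_le_pow_right (by positivity) (Finset.card_le_card Finset.inter_subset_left)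

/-- The effect of approximation of all tensors. -/
theorem norm_contraction_sub_le_of_close {lam lam' : N.Labelling d} (hd : 0 < d)
    (hlam : ∀ S σ, ‖N.contraction lam S σ‖ ≤ 1) {η : ℝ} {Δ : ℕ} (hΔ : ∀ j, (N.I j).card ≤ Δ)
    (hη : ∀ j τ, ‖lam j τ - lam' j τ‖ ≤ η) (hη0 : 0 ≤ η) (S : Finset (Fin N.size))
    (σ : ℕ → Fin d × Fin d) :
    ‖N.contraction lam S σ - N.contraction lam' S σ‖ ≤
      (1 + ((d * d : ℕ) : ℝ) ^ Δ * η) ^ N.size - 1 := by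
  set κ : ℝ := ((d * d : ℕ) : ℝ) ^ Δ * η with hκ
  have hκ0 : 0 ≤ κ := by positivity
  -- The tensors are exchanged one by one; `A` is the set of positions where this has been done.
  have key : ∀ (A S : Finset (Fin N.size)) σ,
      ‖N.contraction lam S σ - N.contraction (A.piecewise lam' lam) S σ‖ ≤ (1 + κ) ^ A.card - 1 := by
    intro A
    induction A using Finset.induction_on with
    | empty => simp
    | insert a A ha ih =>
      intro S σ
      have hpow : 0 ≤ (1 + κ) ^ A.card := by positivity
      rw [Finset.card_insert_of_notMem ha, pow_succ]
      by_cases haS : a ∈ S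
      · have h1 : ‖N.contraction (A.piecewise lam' lam) S σ -
            N.contraction ((insert a A).piecewise lam' lam) S σ‖ ≤
            ((d * d : ℕ) : ℝ) ^ (N.boundary {a}).card * η * (1 + κ) ^ A.card := by
          refine norm_contraction_sub_le (by simpa using haS) ?_ ?_ ?_ hd σ
          · intro j hj
            simp only [Finset.mem_sdiff, Finset.mem_singleton] at hj
            rw [Finset.piecewise_insert_of_ne _ _ _ hj.2]
          · intro σ
            rw [contraction_singleton, contraction_singleton, Finset.piecewise_insert_self,
              Finset.piecewise_eq_of_notMem _ _ _ ha]
            exact hη _ _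
          · intro σ
            -- The estimate for the tensors already exchanged also bounds the contraction of the
            -- remaining positions, by `1 + ((1 + κ) ^ |A| - 1)`.
            have h2 := ih (S \ {a}) σ
            have h3 := hlam (S \ {a}) σ
            have h4 := norm_sub_norm_le (N.contraction (A.piecewise lam' lam) (S \ {a}) σ)
              (N.contraction lam (S \ {a}) σ)
            rw [norm_sub_rev] at h4
            linarith
        have h5 : ((d * d : ℕ) : ℝ) ^ (N.boundary {a}).card * η ≤ κ := by
          rw [boundary_singleton, hκ]
          refine mul_le_mul_of_nonneg_right (pow_le_pow_right₀ ?_ (hΔ a)) hη0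
          exact_mod_cast Nat.mul_pos hd hd
        have h6 := mul_le_mul_of_nonneg_right h5 hpow
        have h7 := norm_sub_le_norm_sub_add_norm_sub (N.contraction lam S σ)
          (N.contraction (A.piecewise lam' lam) S σ)
          (N.contraction ((insert a A).piecewise lam' lam) S σ)
        have h8 := ih S σ
        nlinarith
      · have h1 : N.contraction ((insert a A).piecewise lam' lam) S σ =
            N.contraction (A.piecewise lam' lam) S σ :=
          contraction_congr (fun j hj => Finset.piecewise_insert_of_ne _ _ _
            fun h : j = a => haS (h ▸ hj)) fun _ _ => rfl
        rw [h1]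
        have := ih S σ
        nlinarith
  have h := key Finset.univ S σ
  rwa [Finset.piecewise_univ, Finset.card_univ, Fintype.card_fin] at h

end AbstractNetwork

/-! ### Rooted trees and connected sets of nodes -/

namespace SimpleGraph

/-- The parents of the vertices of a finite tree with root `r`. -/
theorem IsTree.exists_parent {V : Type*} {T : SimpleGraph V} (hT : T.IsTree) (r : V) :
    ∃ (p : V → V) (D : V → ℕ), p r = r ∧ (∀ x, x ≠ r → D (p x) < D x) ∧
      ∀ a b, T.Adj a b → p a = b ∨ p b = a := by
  -- The parent is the second node on the unique path to the root, and `D` is the length of this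
  -- path.
  choose f hf hu using fun v => hT.existsUnique_path v r
  refine ⟨fun v => (f v).snd, fun v => (f v).length, ?_, fun x hx => ?_, fun a b hab => ?_⟩
  · have : Walk.nil = f r := hu r _ Walk.IsPath.nil
    dsimp only
    rw [← this]
    rfl
  · have hn : ¬ (f x).Nil := fun h => hx h.eq
    have h1 : (f x).tail = f (f x).snd := hu _ _ (hf x).tail
    have h2 := Walk.length_tail_add_one hn
    rw [h1] at h2
    dsimp only
    omega
  · by_cases h : b ∈ (f a).support
    · exact Or.inl (hT.isAcyclic.eq_snd_of_adj_start (hf a) hab h).symm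
    · have h1 : Walk.cons hab.symm (f a) = f b := hu _ _ ((Walk.cons_isPath_iff _ _).2 ⟨hf a, h⟩)
      right
      dsimp only
      rw [← h1]
      simp

/-- A connected set that meets a subtree of a rooted tree as well as its complement holds the root
of the subtree and the parent of the latter. -/
theorem mem_of_connected_of_parent {V : Type*} {T : SimpleGraph V} {p : V → V}
    (hp : ∀ a b, T.Adj a b → p a = b ∨ p b = a) {B : Set V} (hB : (T.induce B).Connected)
    {u x y : V} (hx : x ∈ B) (hxu : ∃ k, p^[k] x = u) (hy : y ∈ B) (hyu : ¬ ∃ k, p^[k] y = u) :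
    u ∈ B ∧ p u ∈ B := by
  obtain ⟨w⟩ := hB.preconnected ⟨x, hx⟩ ⟨y, hy⟩
  -- A walk inside `B` leaves the subtree of `u` somewhere, and the only edge by which this is
  -- possible joins `u` with its parent.
  obtain ⟨e, -, ha, hb⟩ := w.exists_boundary_dart {z | ∃ k, p^[k] z.1 = u} hxu hyu
  have hadj : T.Adj e.fst.1 e.snd.1 := e.adj
  have hb' : ¬ ∃ k, p^[k] e.snd.1 = u := hb
  rcases hp _ _ hadj with h | h
  · obtain ⟨_ | k, hk⟩ := ha
    · have hk' : e.fst.1 = u := hk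
      rw [← hk', h]
      exact ⟨e.fst.2, e.snd.2⟩
    · rw [Function.iterate_succ_apply, h] at hk
      exact absurd ⟨k, hk⟩ hb'
  · obtain ⟨k, hk⟩ := ha
    refine absurd ⟨k + 1, ?_⟩ hb'
    rw [Function.iterate_succ_apply, h, hk]

end SimpleGraph

/-! ### From tree decompositions to merges with few indices -/

namespace AbstractNetwork

variable {N : AbstractNetwork}

/-- The sets of positions that can be built from single positions by disjoint unions, such that
the contraction of each of the unions has at most `r` indices. -/
inductive Mergeable (N : AbstractNetwork) (r : ℕ) : Finset (Fin N.size) → Prop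
  | singleton (j : Fin N.size) : Mergeable N r {j}
  | union {S T : Finset (Fin N.size)} : Mergeable N r S → Mergeable N r T → Disjoint S T →
      (N.boundary (S ∪ T)).card ≤ r → Mergeable N r (S ∪ T)

theorem exists_other {i : ℕ} {v : Fin N.size} (h : i ∈ N.I v) : ∃ w, w ≠ v ∧ i ∈ N.I w := by
  have h2 := N.two v i h
  obtain ⟨w, hw, hwv⟩ := Finset.exists_mem_ne (by omega : 1 < (Finset.univ.filter fun k =>
    i ∈ N.I k).card) v
  exact ⟨w, hwv, (Finset.mem_filter.1 hw).2⟩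

theorem card_index_eq_edgeDegree (j : Fin N.size) : (N.I j).card = N.graph.edgeDegree j := by
  have : {e : ℕ | N.graph.Inc e j} = (N.I j : Set ℕ) := by
    ext i
    simp only [Set.mem_ofPred_eq, Finset.mem_coe]
    constructor
    · rintro ⟨w, hw⟩
      exact hw.2.1
    · intro h
      obtain ⟨w, hwj, hw⟩ := exists_other h
      exact ⟨w, hwj.symm, h, hw⟩
  rw [Graph.edgeDegree, this, Set.ncard_coe_finset]

theorem card_index_le (j : Fin N.size) : (N.I j).card ≤ N.graph.maximumDegree := by
  rw [card_index_eq_edgeDegree]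
  exact Finset.le_sup (f := N.graph.edgeDegree) (Finset.mem_univ j)

/-- The positions are gathered from the leaves of a rooted tree decomposition towards its root. At a
node `u`, the sets of the children are united first and single positions of the bag are added
afterwards. All indices that leave a union formed in this way belong to the at most `w + 1`
positions in the bag of `u`. -/
theorem mergeable_univ {w Δ : ℕ} (hw : N.graph.HasTreeDecomposition w)
    (hΔ : ∀ j, (N.I j).card ≤ Δ) (hm : 0 < N.size) : N.Mergeable (Δ * (w + 1)) Finset.univ := by
  classical
  obtain ⟨n, T, β, hT, -, hedge, hconn, hcard⟩ := hw
  obtain ⟨r⟩ := hT.connected.nonempty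
  obtain ⟨p, D, hpr, hD, hadj⟩ := hT.exists_parent r
  have hD' : ∀ k x, D (p^[k] x) ≤ D x := by
    intro k
    induction k with
    | zero => exact fun _ => le_rfl
    | succ k ih =>
      intro x
      rw [Function.iterate_succ_apply']
      by_cases h : p^[k] x = r
      · rw [h, hpr, ← h]
        exact ih x
      · exact (hD _ h).le.trans (ih x)
  have hB : ∀ v, (T.induce {u | v ∈ β u}).Connected := fun v => hconn v (Set.mem_univ _)
  have hBne : ∀ v, ∃ x, v ∈ β x := fun v => by
    obtain ⟨x⟩ := (hB v).nonempty
    exact ⟨x.1, x.2⟩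
  -- The positions all of whose bags lie in the subtree below `u`; for the root, these are all
  -- positions.
  let A : Fin n → Finset (Fin N.size) := fun u =>
    Finset.univ.filter fun v => ∀ x, v ∈ β x → ∃ k, p^[k] x = u
  have hA : ∀ {u v}, v ∈ A u ↔ ∀ x, v ∈ β x → ∃ k, p^[k] x = u := by simp [A]
  let ch : Fin n → Finset (Fin n) := fun u => Finset.univ.filter fun c => c ≠ r ∧ p c = u
  have hch : ∀ {u c}, c ∈ ch u ↔ c ≠ r ∧ p c = u := by simp [ch]
  have hchD : ∀ {u c}, c ∈ ch u → D u < D c := fun h => by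
    rw [hch] at h
    rw [← h.2]
    exact hD _ h.1
  -- If a bag lies below two different children of `u`, then one of these lies above the other,
  -- hence not deeper than `u`, which contradicts the depths.
  have hdisj : ∀ {u c c'}, c ∈ ch u → c' ∈ ch u → c ≠ c' → Disjoint (A c) (A c') := by
    have aux : ∀ {u c c' : Fin n} {x : Fin n} {k l : ℕ}, c ∈ ch u → c' ∈ ch u → c ≠ c' →
        p^[k] x = c → p^[l] x = c' → k < l → False := by
      intro u c c' x k l hc hc' hne hk hl hkl
      obtain ⟨e, rfl⟩ := Nat.exists_eq_add_of_lt hkl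
      rw [show k + e + 1 = (e + 1) + k by ring, Function.iterate_add_apply, hk,
        Function.iterate_succ_apply, (hch.1 hc).2] at hl
      have h1 := hD' e u
      rw [hl] at h1
      have := hchD hc'
      omega
    intro u c c' hc hc' hne
    rw [Finset.disjoint_left]
    intro v hv hv'
    obtain ⟨x, hx⟩ := hBne v
    obtain ⟨k, hk⟩ := hA.1 hv x hx
    obtain ⟨l, hl⟩ := hA.1 hv' x hx
    rcases lt_trichotomy k l with h | h | h
    · exact aux hc hc' hne hk hl h
    · rw [← hk, ← hl, h] at hne
      exact hne rfl
    · exact aux hc' hc hne.symm hl hk h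
  have hβA : ∀ {u c v}, c ∈ ch u → v ∈ β u → v ∉ A c := by
    intro u c v hc hv hvA
    obtain ⟨k, hk⟩ := hA.1 hvA u hv
    have h1 := hD' k u
    rw [hk] at h1
    have := hchD hc
    omega
  -- Let an index leave the union at `v` towards `v'`. If `v ∈ A c`, then a common bag of `v` and
  -- `v'` lies below `c`, but some bag of `v'` does not; by connectedness `v'` is in the bag of the
  -- parent `u`. Otherwise `v` itself is in this bag.
  have hbd : ∀ {u} {C : Finset (Fin n)} {W : Finset (Fin N.size)}, C ⊆ ch u → W ⊆ β u →
      (N.boundary (C.biUnion A ∪ W)).card ≤ Δ * (w + 1) := by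
    intro u C W hC hW
    have h1 : N.boundary (C.biUnion A ∪ W) ⊆ (β u).biUnion N.I := by
      intro i hi
      rw [mem_boundary] at hi
      obtain ⟨v, hv, hiv⟩ := occ_pos_iff.1 (hi ▸ Nat.one_pos)
      obtain ⟨v', hvv', hiv'⟩ := exists_other hiv
      have hv'X : v' ∉ C.biUnion A ∪ W := fun h => by
        obtain ⟨a, ha⟩ := Finset.card_eq_one.1 hi
        have h1 : v ∈ ({a} : Finset _) := ha ▸ Finset.mem_filter.2 ⟨hv, hiv⟩
        have h2 : v' ∈ ({a} : Finset _) := ha ▸ Finset.mem_filter.2 ⟨h, hiv'⟩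
        rw [Finset.mem_singleton] at h1 h2
        exact hvv' (h2.trans h1.symm)
      rw [Finset.mem_biUnion]
      rcases Finset.mem_union.1 hv with hv | hv
      · obtain ⟨c, hc, hvc⟩ := Finset.mem_biUnion.1 hv
        obtain ⟨x, hx, hx'⟩ := hedge i v v' ⟨hvv'.symm, hiv, hiv'⟩
        have hv'c : v' ∉ A c := fun h =>
          hv'X (Finset.mem_union_left _ (Finset.mem_biUnion.2 ⟨c, hc, h⟩))
        rw [hA] at hv'c
        push Not at hv'c
        obtain ⟨y, hy, hy'⟩ := hv'c
        have := (SimpleGraph.mem_of_connected_of_parent hadj (hB v') hx' (hA.1 hvc x hx) hy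
          (by push Not; exact hy')).2
        rw [(hch.1 (hC hc)).2] at this
        exact ⟨v', this, hiv'⟩
      · exact ⟨v, hW hv, hiv⟩
    calc _ ≤ ((β u).biUnion N.I).card := Finset.card_le_card h1
      _ ≤ (β u).card * Δ := Finset.card_biUnion_le_card_mul _ _ _ fun v _ => hΔ v
      _ ≤ Δ * (w + 1) := by rw [mul_comm]; exact Nat.mul_le_mul_left _ (hcard u)
  have hunion : ∀ {S S' : Finset (Fin N.size)}, (S = ∅ ∨ N.Mergeable (Δ * (w + 1)) S) →
      (S' = ∅ ∨ N.Mergeable (Δ * (w + 1)) S') → Disjoint S S' →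
      (N.boundary (S ∪ S')).card ≤ Δ * (w + 1) →
      (S ∪ S' = ∅ ∨ N.Mergeable (Δ * (w + 1)) (S ∪ S')) := by
    rintro S S' (rfl | h) (rfl | h') hd hb
    · simp
    · rw [Finset.empty_union]
      exact Or.inr h'
    · rw [Finset.union_empty]
      exact Or.inr h
    · exact Or.inr (.union h h' hd hb)
  -- A position with all bags below `u`, but not in the bag of `u`, belongs to a single child:
  -- starting from any of its bags, take the last node before `u` on the way up. A further bag
  -- outside that subtree would force the position into the bag of `u`.
  have hAu : ∀ u, A u = (ch u).biUnion A ∪ (A u ∩ β u) := by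
    intro u
    ext v
    rw [Finset.mem_union, Finset.mem_biUnion, Finset.mem_inter]
    constructor
    · intro hv
      by_cases hvu : v ∈ β u
      · exact Or.inr ⟨hv, hvu⟩
      left
      obtain ⟨x, hx⟩ := hBne v
      have hex := hA.1 hv x hx
      obtain ⟨k, hk⟩ : ∃ k, Nat.find hex = k + 1 := by
        refine Nat.exists_eq_succ_of_ne_zero fun h0 => hvu ?_
        have := Nat.find_spec hex
        rw [h0] at this
        exact this ▸ hx
      have hspec := Nat.find_spec hex
      rw [hk, Function.iterate_succ_apply'] at hspec
      have hmin := Nat.find_min hex (m := k) (by omega)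
      have hc : p^[k] x ∈ ch u := hch.2 ⟨fun h => by
        rw [h, hpr] at hspec
        exact hmin (h.trans hspec), hspec⟩
      refine ⟨_, hc, hA.2 fun y hy => ?_⟩
      by_contra hcon
      have := (SimpleGraph.mem_of_connected_of_parent hadj (hB v) hx ⟨k, rfl⟩ hy hcon).2
      rw [hspec] at this
      exact hvu this
    · rintro (⟨c, hc, hv⟩ | h)
      · refine hA.2 fun x hx => ?_
        obtain ⟨k, hk⟩ := hA.1 hv x hx
        exact ⟨k + 1, by rw [Function.iterate_succ_apply', hk, (hch.1 hc).2]⟩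
      · exact h.1
  -- Induction from the deepest nodes upwards. The alternative is needed since `A u` may be empty,
  -- whereas mergeable sets are not.
  have main : ∀ k u, Finset.univ.sup D - D u ≤ k →
      (A u = ∅ ∨ N.Mergeable (Δ * (w + 1)) (A u)) := by
    intro k
    induction k using Nat.strong_induction_on with
    | _ k ih =>
      intro u hu
      have h1 : ∀ C ⊆ ch u, (C.biUnion A = ∅ ∨ N.Mergeable (Δ * (w + 1)) (C.biUnion A)) := by
        intro C
        induction C using Finset.induction_on with
        | empty => simp
        | insert c C hc ihC =>
          intro hC
          have hcu := hC (Finset.mem_insert_self c C)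
          have hCu := (Finset.subset_insert c C).trans hC
          rw [Finset.biUnion_insert]
          refine hunion ?_ (ihC hCu) ?_ ?_
          · have h2 := hchD hcu
            have h3 : D c ≤ Finset.univ.sup D := Finset.le_sup (Finset.mem_univ c)
            exact ih (Finset.univ.sup D - D c) (by omega) c le_rfl
          · rw [Finset.disjoint_biUnion_right]
            intro c' hc'
            exact hdisj hcu (hCu hc') fun h => hc (h ▸ hc')
          · have := hbd (W := ∅) hC (Finset.empty_subset _)
            rwa [Finset.union_empty, Finset.biUnion_insert] at this
      have h2 : ∀ W ⊆ A u ∩ β u, ((ch u).biUnion A ∪ W = ∅ ∨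
          N.Mergeable (Δ * (w + 1)) ((ch u).biUnion A ∪ W)) := by
        intro W
        induction W using Finset.induction_on with
        | empty =>
          intro _
          rw [Finset.union_empty]
          exact h1 _ subset_rfl
        | insert v W hv ihW =>
          intro hW
          have hb := hbd (u := u) (W := insert v W) subset_rfl (hW.trans Finset.inter_subset_right)
          rw [Finset.insert_eq, Finset.union_comm {v}, ← Finset.union_assoc] at hb ⊢
          refine hunion (ihW ((Finset.subset_insert v W).trans hW)) (Or.inr (.singleton v)) ?_ hb
          rw [Finset.disjoint_singleton_right, Finset.mem_union, Finset.mem_biUnion]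
          rintro (⟨c, hc, hvc⟩ | h)
          · exact hβA hc (Finset.mem_inter.1 (hW (Finset.mem_insert_self v W))).2 hvc
          · exact hv h
      rw [hAu u]
      exact h2 _ subset_rfl
  have hroot : A r = Finset.univ := by
    ext v
    simp only [hA, Finset.mem_univ, iff_true]
    intro x hx
    clear hx
    induction h : D x using Nat.strong_induction_on generalizing x with
    | _ k ih =>
      by_cases hx : x = r
      · exact ⟨0, hx⟩
      · obtain ⟨l, hl⟩ := ih (D (p x)) (h ▸ hD x hx) (p x) rfl
        exact ⟨l + 1, hl⟩
  rcases main _ r le_rfl with h | h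
  · rw [hroot] at h
    exact absurd (h ▸ Finset.mem_univ (⟨0, hm⟩ : Fin N.size)) (Finset.notMem_empty _)
  · rwa [hroot] at h

/-- There is a tree decomposition whose width is the treewidth. -/
theorem hasTreeDecomposition_treeWidth : N.graph.HasTreeDecomposition N.graph.treeWidth := by
  refine Nat.sInf_mem (s := {w | N.graph.HasTreeDecomposition w}) ⟨N.size, 1, ⊥,
    fun _ => Finset.univ, SimpleGraph.IsTree.of_subsingleton, ?_, fun e v v' _ => ⟨0, by simp⟩,
    fun v _ => ?_, fun u => by simp⟩
  · simp only [Finset.coe_univ, Set.iUnion_const]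
    rfl
  · have : Nonempty {u : Fin 1 | v ∈ (Finset.univ : Finset (Fin N.size))} := ⟨⟨0, by simp⟩⟩
    exact ⟨SimpleGraph.Preconnected.of_subsingleton⟩

/-- Positions with a common index. -/
theorem exists_adj_of_connected (hN : N.IsConnected) (P : Fin N.size → Prop) {a b : Fin N.size}
    (ha : P a) (hb : ¬ P b) : ∃ v w i, v ≠ w ∧ i ∈ N.I v ∧ i ∈ N.I w ∧ P v ∧ ¬ P w := by
  obtain ⟨w⟩ := hN.preconnected ⟨a, Set.mem_univ _⟩ ⟨b, Set.mem_univ _⟩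
  obtain ⟨e, -, ha, hb⟩ := w.exists_boundary_dart {x | P x.1} ha hb
  obtain ⟨-, i, hab, hia, hib⟩ := e.adj
  exact ⟨_, _, i, hab, hia, hib, ha, hb⟩

theorem exists_edge_of_two_le_size (hN : N.IsConnected) (hm : 2 ≤ N.size) :
    ∃ v w i, v ≠ w ∧ i ∈ N.I v ∧ i ∈ N.I w := by
  obtain ⟨v, w, i, hvw, hiv, hiw, -⟩ := exists_adj_of_connected hN
    (fun x => x.val = 0) (a := ⟨0, by omega⟩) (b := ⟨1, by omega⟩) rfl (by simp)
  exact ⟨v, w, i, hvw, hiv, hiw⟩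

/-- Makes the exponent `Δ * t` positive, so that it absorbs constants and `t + 1`. The network with
a single position has to be treated separately. -/
theorem one_le_of_two_le_size (hN : N.IsConnected) (hm : 2 ≤ N.size) :
    1 ≤ N.graph.treeWidth ∧ 1 ≤ N.graph.maximumDegree := by
  obtain ⟨v, w, i, hvw, hiv, hiw⟩ := exists_edge_of_two_le_size hN hm
  constructor
  · obtain ⟨n, T, β, -, -, hedge, -, hcard⟩ := hasTreeDecomposition_treeWidth (N := N)
    obtain ⟨u, hu, hu'⟩ := hedge i v w ⟨hvw, hiv, hiw⟩
    have h1 := Finset.one_lt_card.2 ⟨v, hu, w, hu', hvw⟩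
    have := hcard u
    omega
  · exact (Finset.card_pos.2 ⟨i, hiv⟩).trans_le (card_index_le v)

/-- In a connected network, a set of positions is determined by its boundary, up to complement. -/
theorem eq_of_boundary_eq (hN : N.IsConnected) {S S' : Finset (Fin N.size)}
    (h : N.boundary S = N.boundary S') {a : Fin N.size} (ha : a ∈ S ↔ a ∈ S') : S = S' := by
  by_contra hne
  obtain ⟨b, hb⟩ : ∃ b, ¬ (b ∈ S ↔ b ∈ S') := by
    by_contra hcon
    push Not at hcon
    exact hne (Finset.ext hcon)
  obtain ⟨v, w, i, hvw, hiv, hiw, hv, hw⟩ :=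
    exists_adj_of_connected hN (fun x => x ∈ S ↔ x ∈ S') ha hb
  -- The index `i` joins a position `v` where `S` and `S'` agree with a position `w` where they
  -- differ. It is on the boundary of a set exactly if the set separates `v` from `w`, and only one
  -- of `S` and `S'` does.
  have key : ∀ X : Finset (Fin N.size), i ∈ N.boundary X ↔ ¬ (v ∈ X ↔ w ∈ X) := by
    intro X
    have h1 : (X.filter fun j => i ∈ N.I j) = ({v, w} : Finset _).filter fun j => j ∈ X := by
      ext j
      simp only [Finset.mem_filter, Finset.mem_insert, Finset.mem_singleton]
      constructor
      · exact fun hj => ⟨N.eq_or_eq hvw hiv hiw hj.2, hj.1⟩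
      · rintro ⟨rfl | rfl, hj⟩
        · exact ⟨hj, hiv⟩
        · exact ⟨hj, hiw⟩
    rw [mem_boundary, occ, h1, Finset.filter_insert, Finset.filter_singleton]
    by_cases h2 : v ∈ X <;> by_cases h3 : w ∈ X <;> simp [h2, h3, hvw]
  have h1 := (key S).symm.trans (h ▸ key S')
  clear key
  rw [not_iff_not, hv] at h1
  refine hw ?_
  by_cases h2 : v ∈ S'
  · simpa [h2] using h1
  · simpa [h2, not_iff_not] using h1

end AbstractNetwork

/-! ### Accumulation of errors along merges -/

namespace AbstractNetwork

variable {N : AbstractNetwork} {d : ℕ}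

/-- The labelling given by the positions `c` in lists of tensors. -/
def labelling (tens : ∀ j : Fin N.size, ℕ → Tensor d (N.I j)) (c : Fin N.size → ℕ) :
    N.Labelling d := fun j => tens j (c j)

/-- Let `K` be a family of partial choices that holds all choices at single positions, and, up to a
small error, the disjoint unions of its members whose contractions have few indices. Then each
choice can be replaced on a mergeable set by a member of `K`, with a small effect on contractions.
-/
theorem Mergeable.exists_close (hd : 0 < d) {tens : ∀ j : Fin N.size, ℕ → Tensor d (N.I j)}
    {count : Fin N.size → ℕ} {K : Finset (Fin N.size) → (Fin N.size → ℕ) → Prop} {r : ℕ}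
    {ε B : ℝ}
    (hB : ∀ c, (∀ j, c j < count j) → ∀ S σ, ‖N.contraction (labelling tens c) S σ‖ ≤ B)
    (hvalid : ∀ S f, K S f → ∀ j ∈ S, f j < count j)
    (hleaf : ∀ j k, k < count j → ∃ f, K {j} f ∧ f j = k)
    (hmerge : ∀ S S' f g, K S f → K S' g → Disjoint S S' → (N.boundary (S ∪ S')).card ≤ r →
      ∃ h, K (S ∪ S') h ∧ ∀ σ,
        ‖N.contraction (labelling tens (S.piecewise f g)) (S ∪ S') σ -
          N.contraction (labelling tens h) (S ∪ S') σ‖ *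
            ((d * d : ℕ) : ℝ) ^ (N.boundary (S ∪ S')).card ≤ ε)
    {S : Finset (Fin N.size)} (hS : N.Mergeable r S) :
    1 ≤ S.card ∧ ∀ c : Fin N.size → ℕ, (∀ j, c j < count j) →
      ∃ h, K S h ∧ ∀ X, S ⊆ X → ∀ σ, ‖N.contraction (labelling tens c) X σ -
        N.contraction (labelling tens (S.piecewise h c)) X σ‖ ≤ (S.card - 1) * (ε * B) := by
  induction hS with
  | singleton j =>
    refine ⟨by simp, fun c hc => ?_⟩
    obtain ⟨f, hf, hfj⟩ := hleaf j (c j) (hc j)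
    refine ⟨f, hf, fun X _ σ => ?_⟩
    have : ({j} : Finset (Fin N.size)).piecewise f c = c := by
      funext i
      by_cases hi : i = j
      · subst hi
        simp [hfj]
      · rw [Finset.piecewise_eq_of_notMem _ _ _ (by simpa using hi)]
    rw [this]
    simp
  | @union S S' _ _ hdisj hcard ih ih' =>
    obtain ⟨h1, ih⟩ := ih
    obtain ⟨h1', ih'⟩ := ih'
    have hcardU := Finset.card_union_of_disjoint hdisj
    refine ⟨by omega, fun c hc => ?_⟩
    -- The choice is changed in three stages: to `f` on `S`, then, within the changed choice, to `g`
    -- on `S'`, and finally to `h` on the union. The numbers of error terms are `|S| - 1`, `|S'| -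
    -- 1` and `1`, in total `|S ∪ S'| - 1`.
    obtain ⟨f, hf, hfX⟩ := ih c hc
    have hc1 : ∀ j, S.piecewise f c j < count j := fun j => by
      by_cases hj : j ∈ S
      · rw [Finset.piecewise_eq_of_mem _ _ _ hj]
        exact hvalid S f hf j hj
      · rw [Finset.piecewise_eq_of_notMem _ _ _ hj]
        exact hc j
    obtain ⟨g, hg, hgX⟩ := ih' _ hc1
    have hc2 : ∀ j, S'.piecewise g (S.piecewise f c) j < count j := fun j => by
      by_cases hj : j ∈ S'
      · rw [Finset.piecewise_eq_of_mem _ _ _ hj]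
        exact hvalid S' g hg j hj
      · rw [Finset.piecewise_eq_of_notMem _ _ _ hj]
        exact hc1 j
    obtain ⟨h, hh, hhσ⟩ := hmerge S S' f g hf hg hdisj hcard
    refine ⟨h, hh, fun X hX σ => ?_⟩
    have e1 := hfX X (Finset.subset_union_left.trans hX) σ
    have e2 := hgX X (Finset.subset_union_right.trans hX) σ
    have hq : 0 < ((d * d : ℕ) : ℝ) ^ (N.boundary (S ∪ S')).card := by positivity
    -- The closeness provided by `hmerge` is divided by the number of assignments to the boundary,
    -- so that it cancels the amplification on insertion into `X`.
    have e3 : ‖N.contraction (labelling tens (S'.piecewise g (S.piecewise f c))) X σ -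
        N.contraction (labelling tens ((S ∪ S').piecewise h c)) X σ‖ ≤
        ((d * d : ℕ) : ℝ) ^ (N.boundary (S ∪ S')).card *
          (ε / ((d * d : ℕ) : ℝ) ^ (N.boundary (S ∪ S')).card) * B := by
      refine norm_contraction_sub_le hX ?_ ?_ (fun σ => hB _ hc2 _ σ) hd σ
      · intro j hj
        rw [Finset.mem_sdiff, Finset.mem_union, not_or] at hj
        simp [labelling, hj.2.1, hj.2.2]
      · intro σ
        rw [le_div_iff₀ hq, contraction_congr (lam := labelling tens
            (S'.piecewise g (S.piecewise f c))) (lam' := labelling tens (S.piecewise f g))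
            (fun j hj => ?_) fun _ _ => rfl,
          contraction_congr (lam := labelling tens ((S ∪ S').piecewise h c))
            (lam' := labelling tens h) (fun j hj => ?_) fun _ _ => rfl]
        · exact hhσ σ
        · simp only [labelling]
          rw [Finset.piecewise_eq_of_mem _ _ _ hj]
        · by_cases hjS : j ∈ S
          · have : j ∉ S' := Finset.disjoint_left.1 hdisj hjS
            simp [labelling, hjS, this]
          · have : j ∈ S' := (Finset.mem_union.1 hj).resolve_left hjS
            simp [labelling, hjS, this]
    rw [mul_div_cancel₀ _ hq.ne'] at e3
    have e4 := norm_sub_le_norm_sub_add_norm_sub (N.contraction (labelling tens c) X σ)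
      (N.contraction (labelling tens (S.piecewise f c)) X σ)
      (N.contraction (labelling tens ((S ∪ S').piecewise h c)) X σ)
    have e5 := norm_sub_le_norm_sub_add_norm_sub
      (N.contraction (labelling tens (S.piecewise f c)) X σ)
      (N.contraction (labelling tens (S'.piecewise g (S.piecewise f c))) X σ)
      (N.contraction (labelling tens ((S ∪ S').piecewise h c)) X σ)
    rw [hcardU]
    push_cast
    linarith

end AbstractNetwork

/-! ### The meaning of the data of the algorithm -/

namespace GPair

/-- The Gaussian integer represented by `x`. -/
noncomputable def val (x : GPair) : ℂ :=
  ((x.1.1 : ℂ) - x.1.2) + ((x.2.1 : ℂ) - x.2.2) * Complex.I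

/-- Differences are never reduced, so that the absolute value does not bound the components. The
weight does, and it is additive for sums and multiplicative for products. -/
def weight (x : GPair) : ℕ := x.1.1 + x.1.2 + (x.2.1 + x.2.2)

theorem val_mul (x y : GPair) : (x.mul y).val = x.val * y.val := by
  have h := Complex.I_mul_I
  simp only [val, mul]
  push_cast
  linear_combination -(((x.2.1 : ℂ) - x.2.2) * ((y.2.1 : ℂ) - y.2.2)) * h

theorem weight_mul (x y : GPair) : (x.mul y).weight = x.weight * y.weight := by
  simp only [weight, mul]
  ring

theorem val_sum (l : List GPair) : (sum l).val = (l.map val).sum := by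
  induction l with
  | nil => simp [sum, val]
  | cons a l ih =>
    rw [List.map_cons, List.sum_cons, ← ih]
    simp only [sum, val, List.map_cons, List.sum_cons]
    push_cast
    ring

theorem weight_sum (l : List GPair) : (sum l).weight = (l.map weight).sum := by
  induction l with
  | nil => simp [sum, weight]
  | cons a l ih =>
    rw [List.map_cons, List.sum_cons, ← ih]
    simp only [sum, weight, List.map_cons, List.sum_cons]
    ring

theorem re_val (x : GPair) : x.val.re = (x.1.1 : ℝ) - x.1.2 := by simp [val]

theorem im_val (x : GPair) : x.val.im = (x.2.1 : ℝ) - x.2.2 := by simp [val]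

theorem normSq_val (x : GPair) :
    Complex.normSq x.val = ((Entry.normSq x).1 : ℝ) - (Entry.normSq x).2 := by
  rw [Complex.normSq_apply, re_val, im_val, Entry.normSq]
  push_cast
  ring

end GPair

namespace Key

theorem nub_aux (l acc : List Key) (hacc : acc.Nodup) :
    (l.foldl (fun acc k => bif acc.any (fun k' => k' == k) then acc else k :: acc) acc).Nodup ∧
      ∀ k, k ∈ l.foldl (fun acc k => bif acc.any (fun k' => k' == k) then acc else k :: acc) acc ↔
        k ∈ acc ∨ k ∈ l := by
  induction l generalizing acc with
  | nil => simpa using hacc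
  | cons a l ih =>
    rw [List.foldl_cons]
    by_cases h : a ∈ acc
    · have h1 : acc.any (fun k' => k' == a) = true := by simpa using h
      rw [h1, cond_true]
      refine ⟨(ih acc hacc).1, fun k => ?_⟩
      rw [(ih acc hacc).2, List.mem_cons]
      constructor
      · tauto
      · rintro (h | rfl | h) <;> tauto
    · have h1 : acc.any (fun k' => k' == a) = false := by
        simpa using fun x hx (hxa : x = a) => h (hxa ▸ hx)
      rw [h1, cond_false]
      have := ih (a :: acc) (List.nodup_cons.2 ⟨h, hacc⟩)
      refine ⟨this.1, fun k => ?_⟩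
      rw [this.2, List.mem_cons, List.mem_cons]
      tauto

theorem nodup_nub (l : List Key) : (nub l).Nodup := (nub_aux l [] List.nodup_nil).1

theorem mem_nub {l : List Key} {k : Key} : k ∈ nub l ↔ k ∈ l := by
  rw [nub, (nub_aux l [] List.nodup_nil).2]
  simp

end Key

/-- The sum of the values with key `k` in a table. -/
noncomputable def tableSum (l : List (Key × GPair)) (k : Key) : ℂ :=
  (l.map fun p => if p.1 = k then p.2.val else 0).sum

theorem tableSum_aggregate (l : List (Key × GPair)) (k : Key) :
    tableSum (aggregate l) k = tableSum l k := by
  have h1 : ∀ (f : Key → ℂ) (K : List Key), K.Nodup →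
      (K.map fun k' => if k' = k then f k' else 0).sum = if k ∈ K then f k else 0 := by
    intro f K
    induction K with
    | nil => simp
    | cons a K ih =>
      intro hK
      rw [List.nodup_cons] at hK
      rw [List.map_cons, List.sum_cons, ih hK.2]
      by_cases h : a = k
      · subst h
        simp [hK.1]
      · simp [h, Ne.symm h]
  have h2 : (GPair.sum ((l.filter fun p => p.1 == k).map fun p => p.2)).val = tableSum l k := by
    rw [GPair.val_sum, tableSum]
    induction l with
    | nil => simp
    | cons a l ih =>
      by_cases h : a.1 = k
      · simp [h, ← ih]
      · simp [h, ← ih]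
  rw [tableSum, aggregate, List.map_map]
  have h3 := h1 (fun k' => (GPair.sum ((l.filter fun p => p.1 == k').map fun p => p.2)).val) _
    (Key.nodup_nub (l.map fun p => p.1))
  rw [h2] at h3
  refine Eq.trans (Eq.trans rfl h3) ?_
  split_ifs with h
  · rfl
  · rw [Key.mem_nub] at h
    rw [tableSum, eq_comm]
    apply List.sum_eq_zero
    intro x hx
    obtain ⟨p, hp, rfl⟩ := List.mem_map.1 hx
    rw [if_neg]
    rintro rfl
    exact h (List.mem_map_of_mem hp)

theorem keys_aggregate (l : List (Key × GPair)) :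
    (aggregate l).map (fun p => p.1) = Key.nub (l.map fun p => p.1) := by
  rw [aggregate, List.map_map]
  exact List.map_id _

/-- The sum of the weights of the values in a table. -/
def tableWeight (l : List (Key × GPair)) : ℕ := (l.map fun p => p.2.weight).sum

theorem tableWeight_aggregate_le (l : List (Key × GPair)) :
    tableWeight (aggregate l) ≤ tableWeight l := by
  -- With the keys fixed, the rows are added one by one; each row contributes to at most one key.
  have h1 : ∀ K : List Key, K.Nodup → (K.map fun k =>
      (GPair.sum ((l.filter fun p => p.1 == k).map fun p => p.2)).weight).sum ≤ tableWeight l := by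
    intro K hK
    induction l with
    | nil =>
      rw [List.sum_eq_zero]
      · exact Nat.zero_le _
      · intro x hx
        obtain ⟨k, -, rfl⟩ := List.mem_map.1 hx
        rfl
    | cons a l ih =>
      have h2 : ∀ k, (GPair.sum (((a :: l).filter fun p => p.1 == k).map fun p => p.2)).weight =
          (if a.1 = k then a.2.weight else 0) +
            (GPair.sum ((l.filter fun p => p.1 == k).map fun p => p.2)).weight := by
        intro k
        rw [GPair.weight_sum, GPair.weight_sum]
        by_cases h : a.1 = k <;> simp [h]
      have h3 : ∀ K : List Key, K.Nodup →
          (K.map fun k => if a.1 = k then a.2.weight else 0).sum ≤ a.2.weight := by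
        intro K
        induction K with
        | nil => simp
        | cons b K ihK =>
          intro hK
          rw [List.nodup_cons] at hK
          rw [List.map_cons, List.sum_cons]
          by_cases h : a.1 = b
          · rw [if_pos h, List.sum_eq_zero]
            · rfl
            · intro x hx
              obtain ⟨k, hk, rfl⟩ := List.mem_map.1 hx
              rw [if_neg]
              rintro rfl
              exact hK.1 (h ▸ hk)
          · rw [if_neg h, zero_add]
            exact ihK hK.2
      simp only [h2]
      rw [List.sum_map_add]
      exact Nat.add_le_add (h3 K hK) ih
  have := h1 _ (Key.nodup_nub (l.map fun p => p.1))
  rwa [tableWeight, aggregate, List.map_map]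

theorem tableWeight_products (e e' : Entry) :
    tableWeight (e.products e') ≤ tableWeight e.2.2.2 * tableWeight e'.2.2.2 := by
  rw [Entry.products]
  generalize e.2.2.2 = l
  induction l with
  | nil => simp [tableWeight]
  | cons p l ih =>
    have h1 : tableWeight ((e'.2.2.2.filter fun p' => p.1.Compatible p'.1).map fun p' =>
        (Key.merge e.2.1 e'.2.1 p.1 p'.1, GPair.mul p.2 p'.2)) ≤
        p.2.weight * tableWeight e'.2.2.2 := by
      generalize e'.2.2.2 = l'
      induction l' with
      | nil => simp [tableWeight]
      | cons p' l' ih' =>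
        simp only [tableWeight, List.filter_cons, List.map_cons, List.sum_cons, mul_add] at *
        split_ifs
        · rw [List.map_cons, List.map_cons, List.sum_cons]
          exact Nat.add_le_add (GPair.weight_mul _ _).le ih'
        · exact ih'.trans (Nat.le_add_left _ _)
    simp only [tableWeight, List.flatMap_cons, List.map_append, List.sum_append, List.map_cons,
      List.sum_cons, add_mul] at *
    exact Nat.add_le_add h1 ih

/-- The number that stands for a pair of basis vectors. -/
def digit {d : ℕ} (x : Fin d × Fin d) : ℕ := finProdFinEquiv x

theorem digit_injective {d : ℕ} : Function.Injective (digit (d := d)) :=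
  Fin.val_injective.comp finProdFinEquiv.injective

theorem digit_lt {d : ℕ} (x : Fin d × Fin d) : digit x < d * d := (finProdFinEquiv x).2

namespace Key

variable {d : ℕ}

/-- The values at the indices in `I` of an assignment to all indices. -/
def ofFun (σ : ℕ → Fin d × Fin d) (I : List ℕ) : Key := I.map fun i => (i, digit (σ i))

theorem ofFun_eq_iff {σ τ : ℕ → Fin d × Fin d} {I : List ℕ} :
    ofFun σ I = ofFun τ I ↔ ∀ i ∈ I, σ i = τ i := by
  rw [ofFun, ofFun, List.map_inj_left]
  refine forall₂_congr fun i _ => ?_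
  rw [Prod.mk.injEq, and_iff_right rfl, digit_injective.eq_iff]

theorem compatible_iff {σ τ : ℕ → Fin d × Fin d} {I J : List ℕ} :
    Compatible (ofFun σ I) (ofFun τ J) = true ↔ ∀ i ∈ I, i ∈ J → σ i = τ i := by
  simp only [Compatible, ofFun, List.all_map, List.all_eq_true, Function.comp_apply,
    Bool.or_eq_true, Bool.not_eq_true', beq_eq_false_iff_ne, beq_iff_eq, digit_injective.eq_iff]
  constructor
  · intro h i hi hj
    exact (h i hi i hj).resolve_left fun h => h rfl
  · intro h i hi j hj
    by_cases hij : i = j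
    · subst hij
      exact Or.inr (h i hi hj)
    · exact Or.inl hij

theorem restrict_ofFun (σ : ℕ → Fin d × Fin d) (I J : List ℕ) :
    restrict (ofFun σ I) J = ofFun σ (I.filter fun i => !(J.any fun j => i == j)) := by
  rw [restrict, ofFun, List.filter_map]
  rfl

theorem merge_eq_iff {σ τ τ' : ℕ → Fin d × Fin d} {I J : List ℕ} :
    merge I J (ofFun τ I) (ofFun τ' J) = ofFun σ ((I.filter fun i => !(J.any fun j => i == j)) ++
      (J.filter fun i => !(I.any fun j => i == j))) ↔
        (∀ i ∈ I, i ∉ J → τ i = σ i) ∧ ∀ i ∈ J, i ∉ I → τ' i = σ i := by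
  rw [merge, restrict_ofFun, restrict_ofFun]
  have : ofFun σ ((I.filter fun i => !(J.any fun j => i == j)) ++
      (J.filter fun i => !(I.any fun j => i == j))) =
      ofFun σ (I.filter fun i => !(J.any fun j => i == j)) ++
      ofFun σ (J.filter fun i => !(I.any fun j => i == j)) := by simp [ofFun]
  have h1 : ∀ {I J : List ℕ} {τ : ℕ → Fin d × Fin d},
      ofFun τ (I.filter fun i => !(J.any fun j => i == j)) =
        ofFun σ (I.filter fun i => !(J.any fun j => i == j)) ↔ ∀ i ∈ I, i ∉ J → τ i = σ i := by
    intro I J τ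
    rw [ofFun_eq_iff]
    refine ⟨fun h i hi hj => h i (List.mem_filter.2 ⟨hi, ?_⟩), fun h i hi => ?_⟩
    · simpa using fun x hx (hxi : i = x) => hj (hxi ▸ hx)
    · rw [List.mem_filter] at hi
      refine h i hi.1 fun hj => ?_
      have h2 : (J.any fun j => i == j) = true := List.any_eq_true.2 ⟨i, hj, beq_self_eq_true i⟩
      rw [h2] at hi
      exact absurd hi.2 (by decide)
  rw [this, ← h1, ← h1]
  exact ⟨fun h => List.append_inj h (by simp [ofFun]), fun h => by rw [h.1, h.2]⟩

end Key

/-! ### Contraction of tables -/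

section Products

variable {d : ℕ}

/-- The indices of `I` that are not in `J`, followed by those of `J` that are not in `I`. -/
def mergeIndex (I J : List ℕ) : List ℕ :=
  (I.filter fun i => !(J.any fun j => i == j)) ++ (J.filter fun i => !(I.any fun j => i == j))

theorem mem_mergeIndex {I J : List ℕ} {i : ℕ} :
    i ∈ mergeIndex I J ↔ i ∈ I ∧ i ∉ J ∨ i ∈ J ∧ i ∉ I := by
  have h : ∀ J : List ℕ, (!(J.any fun j => i == j)) = true ↔ i ∉ J := fun J => by
    rw [Bool.not_eq_true', ← Bool.not_eq_true, List.any_eq_true]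
    simp
  rw [mergeIndex, List.mem_append, List.mem_filter, List.mem_filter, h, h]

theorem nodup_mergeIndex {I J : List ℕ} (hI : I.Nodup) (hJ : J.Nodup) :
    (mergeIndex I J).Nodup := by
  rw [mergeIndex, List.nodup_append]
  refine ⟨hI.filter _, hJ.filter _, ?_⟩
  rintro x hx _ hy rfl
  rw [List.mem_filter] at hx hy
  have : (J.any fun j => x == j) = true := List.any_eq_true.2 ⟨x, hy.1, beq_self_eq_true x⟩
  rw [this] at hx
  exact absurd hx.2 (by decide)

/-- The share of one pair of rows in a contraction. Only the assignment `ρ` that agrees with `τ` on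
the common indices can contribute, and it does so exactly if the two keys are compatible and their
merge is the key in question. -/
theorem sum_update_pair (σ τ τ' : ℕ → Fin d × Fin d) (I J : List ℕ) (z z' : ℂ) :
    (∑ ρ : (I.toFinset ∩ J.toFinset : Finset ℕ) → Fin d × Fin d,
      (if Key.ofFun τ I = Key.ofFun (Function.updateFinset σ (I.toFinset ∩ J.toFinset) ρ) I
        then z else 0) *
      (if Key.ofFun τ' J = Key.ofFun (Function.updateFinset σ (I.toFinset ∩ J.toFinset) ρ) J
        then z' else 0)) =
      if (Key.ofFun τ I).Compatible (Key.ofFun τ' J) = true ∧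
        Key.merge I J (Key.ofFun τ I) (Key.ofFun τ' J) = Key.ofFun σ (mergeIndex I J)
      then z * z' else 0 := by
  simp only [mergeIndex, Key.compatible_iff, Key.merge_eq_iff, Key.ofFun_eq_iff]
  have hu : ∀ (ρ : (I.toFinset ∩ J.toFinset : Finset ℕ) → Fin d × Fin d) i,
      Function.updateFinset σ (I.toFinset ∩ J.toFinset) ρ i =
        if h : i ∈ I.toFinset ∩ J.toFinset then ρ ⟨i, h⟩ else σ i := fun ρ i => rfl
  rw [Fintype.sum_eq_single fun i : (I.toFinset ∩ J.toFinset : Finset ℕ) => τ i]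
  · rw [ite_zero_mul_ite_zero]
    refine if_congr ?_ rfl rfl
    constructor
    · rintro ⟨h1, h2⟩
      refine ⟨fun i hi hj => ?_, fun i hi hj => ?_, fun i hj hi => ?_⟩
      · rw [h1 i hi, h2 i hj]
      · rw [h1 i hi, hu, dif_neg]
        simp [hj]
      · rw [h2 i hj, hu, dif_neg]
        simp [hi]
    · rintro ⟨h1, h2, h3⟩
      refine ⟨fun i hi => ?_, fun i hj => ?_⟩
      · rw [hu]
        split_ifs with h
        · rfl
        · exact h2 i hi fun hj => h (by simp [hi, hj])
      · rw [hu]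
        split_ifs with h
        · exact (h1 i (by simpa using (Finset.mem_inter.1 h).1) hj).symm
        · exact h3 i hj fun hi => h (by simp [hi, hj])
  · intro ρ hρ
    rw [ite_zero_mul_ite_zero, if_neg]
    rintro ⟨h1, -⟩
    apply hρ
    funext i
    have h2 := Finset.mem_inter.1 i.2
    have h3 := h1 i (by simpa using h2.1)
    rw [hu, dif_pos i.2] at h3
    exact h3.symm

theorem tableSum_append (l l' : List (Key × GPair)) (k : Key) :
    tableSum (l ++ l') k = tableSum l k + tableSum l' k := by simp [tableSum]

theorem tableSum_cons (p : Key × GPair) (l : List (Key × GPair)) (k : Key) :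
    tableSum (p :: l) k = (if p.1 = k then p.2.val else 0) + tableSum l k := by simp [tableSum]

theorem tableSum_eq_of_mem {l : List (Key × GPair)} (hl : (l.map fun p => p.1).Nodup) {k : Key}
    {x : GPair} (hx : (k, x) ∈ l) : tableSum l k = x.val := by
  induction l with
  | nil => simp at hx
  | cons p l ih =>
    rw [List.map_cons, List.nodup_cons] at hl
    rw [tableSum_cons]
    rcases List.mem_cons.1 hx with rfl | hx
    · rw [if_pos rfl, tableSum, List.sum_eq_zero, add_zero]
      intro y hy
      obtain ⟨q, hq, rfl⟩ := List.mem_map.1 hy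
      rw [if_neg]
      intro hq'
      exact hl.1 (List.mem_map.2 ⟨q, hq, hq'⟩)
    · rw [if_neg, zero_add, ih hl.2 hx]
      intro hp
      exact hl.1 (List.mem_map.2 ⟨_, hx, hp.symm⟩)

/-- All keys of the table are assignments to the indices in `I`. -/
def HasKeys (d : ℕ) (I : List ℕ) (l : List (Key × GPair)) : Prop :=
  ∀ p ∈ l, ∃ τ : ℕ → Fin d × Fin d, p.1 = Key.ofFun τ I

/-- Both sides are additive in each of the two tables, which reduces the claim to single rows, that
is, to `sum_update_pair`. -/
theorem tableSum_products {e e' : Entry} (he : HasKeys d e.2.1 e.2.2.2)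
    (he' : HasKeys d e'.2.1 e'.2.2.2) (σ : ℕ → Fin d × Fin d) :
    tableSum (e.products e') (Key.ofFun σ (mergeIndex e.2.1 e'.2.1)) =
      ∑ ρ : (e.2.1.toFinset ∩ e'.2.1.toFinset : Finset ℕ) → Fin d × Fin d,
        tableSum e.2.2.2 (Key.ofFun
          (Function.updateFinset σ (e.2.1.toFinset ∩ e'.2.1.toFinset) ρ) e.2.1) *
        tableSum e'.2.2.2 (Key.ofFun
          (Function.updateFinset σ (e.2.1.toFinset ∩ e'.2.1.toFinset) ρ) e'.2.1) := by
  rw [Entry.products]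
  obtain ⟨_, I, _, l⟩ := e
  obtain ⟨_, J, _, l'⟩ := e'
  replace he : HasKeys d I l := he
  replace he' : HasKeys d J l' := he'
  dsimp only
  induction l with
  | nil => simp [tableSum]
  | cons p l ih =>
    rw [List.flatMap_cons, tableSum_append, ih fun q hq => he q (List.mem_cons_of_mem _ hq)]
    simp only [tableSum_cons p, add_mul, Finset.sum_add_distrib]
    congr 1
    obtain ⟨τ, hτ⟩ := he p List.mem_cons_self
    clear ih he
    induction l' with
    | nil => simp [tableSum]
    | cons p' l' ih =>
      simp only [tableSum_cons p', mul_add, Finset.sum_add_distrib]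
      rw [← ih fun q hq => he' q (List.mem_cons_of_mem _ hq)]
      obtain ⟨τ', hτ'⟩ := he' p' List.mem_cons_self
      rw [hτ, hτ', sum_update_pair, List.filter_cons, hτ']
      by_cases h : (Key.ofFun τ I).Compatible (Key.ofFun τ' J) = true
      · rw [if_pos h, List.map_cons, tableSum_cons, GPair.val_mul]
        simp [h, hτ']
      · simp [h]

theorem hasKeys_products {e e' : Entry} (he : HasKeys d e.2.1 e.2.2.2)
    (he' : HasKeys d e'.2.1 e'.2.2.2) :
    HasKeys d (mergeIndex e.2.1 e'.2.1) (e.products e') := by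
  intro p hp
  rw [Entry.products, List.mem_flatMap] at hp
  obtain ⟨p₁, h₁, hp⟩ := hp
  obtain ⟨p₂, h₂, rfl⟩ := List.mem_map.1 hp
  obtain ⟨τ, hτ⟩ := he p₁ h₁
  obtain ⟨τ', hτ'⟩ := he' p₂ (List.mem_filter.1 h₂).1
  refine ⟨fun i => if i ∈ e.2.1 then τ i else τ' i, ?_⟩
  dsimp only
  rw [hτ, hτ', mergeIndex, Key.merge_eq_iff]
  refine ⟨fun i hi _ => ?_, fun i _ hi => ?_⟩ <;> simp [hi]

theorem hasKeys_aggregate {I : List ℕ} {l : List (Key × GPair)} (h : HasKeys d I l) :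
    HasKeys d I (aggregate l) := by
  intro p hp
  have h1 := List.mem_map_of_mem (f := fun p : Key × GPair => p.1) hp
  rw [keys_aggregate, Key.mem_nub] at h1
  obtain ⟨q, hq, h2⟩ := List.mem_map.1 h1
  rw [← h2]
  exact h q hq

/-- Each assignment to the indices in `I` occurs as a key of the table. -/
def HasAllKeys (d : ℕ) (I : List ℕ) (l : List (Key × GPair)) : Prop :=
  ∀ τ : ℕ → Fin d × Fin d, ∃ p ∈ l, p.1 = Key.ofFun τ I

theorem hasAllKeys_products {e e' : Entry} (he : HasAllKeys d e.2.1 e.2.2.2)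
    (he' : HasAllKeys d e'.2.1 e'.2.2.2) :
    HasAllKeys d (mergeIndex e.2.1 e'.2.1) (e.products e') := by
  intro τ
  obtain ⟨p, hp, h⟩ := he τ
  obtain ⟨p', hp', h'⟩ := he' τ
  refine ⟨(Key.merge e.2.1 e'.2.1 p.1 p'.1, GPair.mul p.2 p'.2), ?_, ?_⟩
  · rw [Entry.products, List.mem_flatMap]
    refine ⟨p, hp, List.mem_map.2 ⟨p', List.mem_filter.2 ⟨hp', ?_⟩, rfl⟩⟩
    rw [h, h', Key.compatible_iff]
    exact fun _ _ _ => rfl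
  · dsimp only
    rw [h, h', mergeIndex, Key.merge_eq_iff]
    exact ⟨fun _ _ _ => rfl, fun _ _ _ => rfl⟩

theorem hasAllKeys_aggregate {I : List ℕ} {l : List (Key × GPair)} (h : HasAllKeys d I l) :
    HasAllKeys d I (aggregate l) := by
  intro τ
  obtain ⟨p, hp, h1⟩ := h τ
  have h2 : p.1 ∈ (aggregate l).map fun p => p.1 := by
    rw [keys_aggregate, Key.mem_nub]
    exact List.mem_map_of_mem hp
  obtain ⟨q, hq, h3⟩ := List.mem_map.1 h2
  exact ⟨q, hq, h3.trans h1⟩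

end Products

/-! ### Entries as representations of partial choices -/

namespace Entry

variable {N : AbstractNetwork} {d : ℕ}

/-- The entry describes the choice of the tensors at the positions `f j` for `j ∈ S` together with
the resulting tensor, in numbers that are bounded by powers of `A`. -/
structure Represents (tens : ∀ j : Fin N.size, ℕ → Tensor d (N.I j)) (count : Fin N.size → ℕ)
    (A : ℕ) (e : Entry) (S : Finset (Fin N.size)) (f : Fin N.size → ℕ) : Prop where
  choice : e.1 = List.ofFn fun j => if j ∈ S then some (f j) else none
  valid : ∀ j ∈ S, f j < count j
  nodup : e.2.1.Nodup
  index : e.2.1.toFinset = N.boundary S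
  den_pos : 0 < e.2.2.1
  den_le : e.2.2.1 ≤ A ^ S.card
  weight_le : tableWeight e.2.2.2 ≤ A ^ S.card
  hasKeys : HasKeys d e.2.1 e.2.2.2
  hasAllKeys : HasAllKeys d e.2.1 e.2.2.2
  keys_nodup : (e.2.2.2.map fun p => p.1).Nodup
  value : ∀ σ, tableSum e.2.2.2 (Key.ofFun σ e.2.1) =
    e.2.2.1 * N.contraction (AbstractNetwork.labelling tens f) S σ

variable {tens : ∀ j : Fin N.size, ℕ → Tensor d (N.I j)} {count : Fin N.size → ℕ} {A : ℕ}
  {e e' : Entry} {S S' : Finset (Fin N.size)} {f f' : Fin N.size → ℕ}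

namespace Represents

theorem card_index (h : e.Represents tens count A S f) : e.2.1.length = (N.boundary S).card := by
  rw [← h.index, List.toFinset_card_of_nodup h.nodup]

theorem merge (h : e.Represents tens count A S f) (h' : e'.Represents tens count A S' f')
    (hS : Disjoint S S') :
    (e.merge e').Represents tens count A (S ∪ S') (S.piecewise f f') where
  choice := by
    rw [Entry.merge, h.choice, h'.choice]
    apply List.ext_getElem
    · simp
    · intro n h1 h2
      have hn : n < N.size := by simpa using h2
      simp only [List.getElem_map, List.getElem_zip, List.getElem_ofFn, Finset.mem_union]
      by_cases hj : (⟨n, hn⟩ : Fin N.size) ∈ S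
      · simp [hj]
      · simp [hj]
  valid := by
    intro j hj
    by_cases hjS : j ∈ S
    · rw [Finset.piecewise_eq_of_mem _ _ _ hjS]
      exact h.valid j hjS
    · rw [Finset.piecewise_eq_of_notMem _ _ _ hjS]
      exact h'.valid j ((Finset.mem_union.1 hj).resolve_left hjS)
  nodup := nodup_mergeIndex h.nodup h'.nodup
  index := by
    ext i
    rw [AbstractNetwork.boundary_union hS, ← h.index, ← h'.index, List.mem_toFinset,
      Finset.mem_symmDiff, List.mem_toFinset, List.mem_toFinset]
    exact mem_mergeIndex
  den_pos := Nat.mul_pos h.den_pos h'.den_pos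
  den_le := by
    rw [Finset.card_union_of_disjoint hS, pow_add]
    exact Nat.mul_le_mul h.den_le h'.den_le
  weight_le := by
    rw [Finset.card_union_of_disjoint hS, pow_add]
    exact (tableWeight_aggregate_le _).trans
      ((tableWeight_products e e').trans (Nat.mul_le_mul h.weight_le h'.weight_le))
  hasKeys := hasKeys_aggregate (hasKeys_products h.hasKeys h'.hasKeys)
  hasAllKeys := hasAllKeys_aggregate (hasAllKeys_products h.hasAllKeys h'.hasAllKeys)
  keys_nodup := by
    have := keys_aggregate (e.products e')
    exact this ▸ Key.nodup_nub _
  value := by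
    intro σ
    have h1 := tableSum_aggregate (e.products e') (Key.ofFun σ (mergeIndex e.2.1 e'.2.1))
    rw [tableSum_products h.hasKeys h'.hasKeys] at h1
    simp only [h.value, h'.value] at h1
    rw [h.index, h'.index] at h1
    refine Eq.trans h1 ?_
    rw [AbstractNetwork.contraction_union _ hS, Finset.mul_sum]
    refine Finset.sum_congr rfl fun ρ _ => ?_
    rw [AbstractNetwork.contraction_congr (lam := AbstractNetwork.labelling tens (S.piecewise f f'))
        (lam' := AbstractNetwork.labelling tens f) (S := S) (fun j hj => ?_) fun _ _ => rfl,
      AbstractNetwork.contraction_congr (lam := AbstractNetwork.labelling tens (S.piecewise f f'))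
        (lam' := AbstractNetwork.labelling tens f') (S := S') (fun j hj => ?_) fun _ _ => rfl]
    · change _ = (((e.2.2.1 * e'.2.2.1 : ℕ)) : ℂ) * _
      push_cast
      ring
    · have : j ∉ S := Finset.disjoint_right.1 hS hj
      simp [AbstractNetwork.labelling, this]
    · simp [AbstractNetwork.labelling, hj]

theorem apart_iff (h : e.Represents tens count A S f) (h' : e'.Represents tens count A S' f') :
    e.Apart e' = true ↔ Disjoint S S' := by
  rw [Entry.Apart, h.choice, h'.choice, List.all_eq_true, Finset.disjoint_left]
  constructor
  · intro H j hj hj'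
    have := H (some (f j), some (f' j)) (by
      rw [List.mem_iff_getElem]
      refine ⟨j, by simp, ?_⟩
      simp [hj, hj'])
    exact absurd this (by simp)
  · intro H p hp
    obtain ⟨n, hn, rfl⟩ := List.mem_iff_getElem.1 hp
    have hn' : n < N.size := by simpa using hn
    have := @H ⟨n, hn'⟩
    simp only [List.getElem_zip, List.getElem_ofFn]
    by_cases hj : (⟨n, hn'⟩ : Fin N.size) ∈ S
    · simp [this hj]
    · simp [hj]

theorem full_iff (h : e.Represents tens count A S f) : e.Full = true ↔ S = Finset.univ := by
  rw [Entry.Full, h.choice, List.all_eq_true, Finset.eq_univ_iff_forall]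
  constructor
  · intro H j
    have := H (if j ∈ S then some (f j) else none) (List.mem_ofFn.2 ⟨j, rfl⟩)
    by_contra hj
    simp [hj] at this
  · intro H o ho
    obtain ⟨j, rfl⟩ := List.mem_ofFn.1 ho
    simp [H j]

theorem isSome_eq_iff (h : e.Represents tens count A S f)
    (h' : e'.Represents tens count A S' f') :
    e.1.map (fun o => o.isSome) = e'.1.map (fun o => o.isSome) ↔ S = S' := by
  rw [h.choice, h'.choice, List.map_ofFn, List.map_ofFn, List.ofFn_inj, funext_iff, Finset.ext_iff]
  refine forall_congr' fun j => ?_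
  by_cases hj : j ∈ S <;> by_cases hj' : j ∈ S' <;> simp [hj, hj']

/-- The numerator of an entry of the tensor. -/
theorem exists_val (h : e.Represents tens count A S f) (σ : ℕ → Fin d × Fin d) :
    ∃ x, (Key.ofFun σ e.2.1, x) ∈ e.2.2.2 := by
  obtain ⟨p, hp, h1⟩ := h.hasAllKeys σ
  exact ⟨p.2, h1 ▸ hp⟩

theorem val_eq (h : e.Represents tens count A S f) {σ : ℕ → Fin d × Fin d} {x : GPair}
    (hx : (Key.ofFun σ e.2.1, x) ∈ e.2.2.2) :
    x.val = e.2.2.1 * N.contraction (AbstractNetwork.labelling tens f) S σ := by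
  rw [← h.value σ]
  exact (tableSum_eq_of_mem h.keys_nodup hx).symm

theorem length_table (hd : 0 < d) (h : e.Represents tens count A S f) :
    e.2.2.2.length = (d * d) ^ (N.boundary S).card := by
  have σ₀ : ℕ → Fin d × Fin d := fun _ => (⟨0, hd⟩, ⟨0, hd⟩)
  have h1 : (e.2.2.2.map fun p => p.1).toFinset = Finset.univ.image
      fun ρ : N.boundary S → Fin d × Fin d =>
        Key.ofFun (Function.updateFinset σ₀ (N.boundary S) ρ) e.2.1 := by
    ext k
    rw [List.mem_toFinset, Finset.mem_image, List.mem_map]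
    constructor
    · rintro ⟨p, hp, rfl⟩
      obtain ⟨τ, hτ⟩ := h.hasKeys p hp
      refine ⟨fun i => τ i, Finset.mem_univ _, ?_⟩
      rw [hτ, Key.ofFun_eq_iff]
      intro i hi
      have : i ∈ N.boundary S := by rwa [← h.index, List.mem_toFinset]
      simp [Function.updateFinset, this]
    · rintro ⟨ρ, -, rfl⟩
      exact h.hasAllKeys _
  rw [← List.length_map (f := fun p : Key × GPair => p.1), ← List.toFinset_card_of_nodup
    h.keys_nodup, h1, Finset.card_image_of_injective]
  · simp
  · intro ρ ρ' hρ
    rw [Key.ofFun_eq_iff] at hρ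
    funext i
    have := hρ i (by rw [← List.mem_toFinset, h.index]; exact i.2)
    simpa [Function.updateFinset] using this

/-- The integer comparisons are inequalities of fractions with the positive denominators cleared.
The length of the table, which is `(d * d) ^ |∂S|`, compensates in advance for the amplification of
the error when the tensor is contracted further. Index lists have to agree in their order too;
otherwise entries with the same tensor are both kept, which affects only their number. -/
theorem close_iff {M : ℕ} (h : e.Represents tens count A S f)
    (h' : e'.Represents tens count A S' f') :
    e.Close M e' = true ↔ e.2.1 = e'.2.1 ∧ S = S' ∧ ∀ σ,
      M * e.2.2.2.length * |(N.contraction (AbstractNetwork.labelling tens f) S σ -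
        N.contraction (AbstractNetwork.labelling tens f') S' σ).re| ≤ 1 ∧
      M * e.2.2.2.length * |(N.contraction (AbstractNetwork.labelling tens f) S σ -
        N.contraction (AbstractNetwork.labelling tens f') S' σ).im| ≤ 1 := by
  have hz : ∀ (k D D' : ℕ) (z z' : ZPair) (x x' : ℝ), 0 < D → 0 < D' →
      (z.1 : ℝ) - z.2 = D * x → (z'.1 : ℝ) - z'.2 = D' * x' →
      (closeZ k D D' z z' = true ↔ k * |x - x'| ≤ 1) := by
    intro k D D' z z' x x' hD hD' hx hx'
    have hDD : (0 : ℝ) < D * D' := by positivity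
    have h1 : |k * ((D * x) * D' - (D' * x') * D)| = D * D' * (k * |x - x'|) := by
      rw [show (k * (D * x * D' - D' * x' * D) : ℝ) = D * D' * (k * (x - x')) by ring,
        abs_mul (D * D' : ℝ), abs_mul (k : ℝ), abs_of_pos hDD, abs_of_nonneg (Nat.cast_nonneg k)]
    have h2 : (k : ℝ) * |x - x'| ≤ 1 ↔ |k * ((D * x) * D' - (D' * x') * D)| ≤ D * D' := by
      rw [h1, mul_le_iff_le_one_right hDD]
    rw [closeZ, Bool.and_eq_true, decide_eq_true_iff, decide_eq_true_iff, ← Nat.cast_le (α := ℝ),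
      ← Nat.cast_le (α := ℝ), h2, abs_le, ← hx, ← hx']
    push_cast
    constructor
    · rintro ⟨h1, h2⟩
      constructor <;> linarith
    · rintro ⟨h1, h2⟩
      constructor <;> linarith
  rw [Entry.Close, Bool.and_eq_true, Bool.and_eq_true, beq_iff_eq, beq_iff_eq,
    isSome_eq_iff h h', and_assoc]
  refine and_congr_right fun hI => and_congr_right fun hS => ?_
  simp only [List.all_eq_true, Bool.or_eq_true, Bool.not_eq_true', Bool.and_eq_true,
    beq_eq_false_iff_ne]
  constructor
  · intro H σ
    obtain ⟨x, hx⟩ := h.exists_val σ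
    obtain ⟨x', hx'⟩ := h'.exists_val σ
    have h1 := (H _ hx _ hx').resolve_left fun h1 => h1 (by rw [hI])
    have h2 := h.val_eq hx
    have h2' := h'.val_eq hx'
    rw [hz _ _ _ _ _ _ _ h.den_pos h'.den_pos
        (by rw [← x.re_val, h2, ← Complex.ofReal_natCast, Complex.re_ofReal_mul])
        (by rw [← x'.re_val, h2', ← Complex.ofReal_natCast, Complex.re_ofReal_mul]),
      hz _ _ _ _ _ _ _ h.den_pos h'.den_pos
        (by rw [← x.im_val, h2, ← Complex.ofReal_natCast, Complex.im_ofReal_mul])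
        (by rw [← x'.im_val, h2', ← Complex.ofReal_natCast, Complex.im_ofReal_mul])] at h1
    rw [Complex.sub_re, Complex.sub_im]
    exact_mod_cast h1
  · rintro H ⟨k, x⟩ hx ⟨k', x'⟩ hx'
    by_cases hk : k = k'
    · right
      subst hk
      obtain ⟨σ, hσ⟩ := h.hasKeys _ hx
      dsimp only at hσ
      subst hσ
      have h2 := h.val_eq hx
      rw [hI] at hx'
      have h2' := h'.val_eq hx'
      rw [hz _ _ _ _ _ _ _ h.den_pos h'.den_pos
          (by rw [← x.re_val, h2, ← Complex.ofReal_natCast, Complex.re_ofReal_mul])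
          (by rw [← x'.re_val, h2', ← Complex.ofReal_natCast, Complex.re_ofReal_mul]),
        hz _ _ _ _ _ _ _ h.den_pos h'.den_pos
          (by rw [← x.im_val, h2, ← Complex.ofReal_natCast, Complex.im_ofReal_mul])
          (by rw [← x'.im_val, h2', ← Complex.ofReal_natCast, Complex.im_ofReal_mul])]
      have := H σ
      rw [Complex.sub_re, Complex.sub_im] at this
      exact_mod_cast this
    · exact Or.inl hk

end Represents

end Entry

/-! ### Input format and entries for single tensors -/

namespace Key

theorem getElem_ofDigits {q : ℕ} {I : List ℕ} {n s : ℕ} (hs : s < (ofDigits q I n).length)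
    (hs' : s < I.length) : (ofDigits q I n)[s] = (I[s], n / q ^ s % q) := by
  induction I generalizing n s with
  | nil => simp at hs'
  | cons i I ih =>
    cases s with
    | zero => simp [ofDigits]
    | succ s =>
      simp only [ofDigits, List.getElem_cons_succ]
      rw [ih _ (by simpa using hs'), Nat.div_div_eq_div_mul, pow_succ']

theorem length_ofDigits (q : ℕ) (I : List ℕ) (n : ℕ) : (ofDigits q I n).length = I.length := by
  induction I generalizing n with
  | nil => rfl
  | cons i I ih => simp [ofDigits, ih]

/-- The enumeration of the assignments in the input format agrees with that of the algorithm. -/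
theorem ofDigits_sort {d : ℕ} (I : Finset ℕ) (n : Fin ((d * d) ^ I.card))
    (σ : ℕ → Fin d × Fin d)
    (hσ : ∀ i : I, σ i =
      finProdFinEquiv.symm (finFunctionFinEquiv.symm n ((I.orderIsoOfFin rfl).symm i))) :
    ofDigits (d * d) (I.sort (· ≤ ·)) n = ofFun σ (I.sort (· ≤ ·)) := by
  apply List.ext_getElem
  · rw [length_ofDigits, ofFun, List.length_map]
  · intro s h1 h2
    have hs : s < (I.sort (· ≤ ·)).length := by rwa [length_ofDigits] at h1
    have hs' : s < I.card := by rwa [Finset.length_sort] at hs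
    have h3 : ((I.sort (· ≤ ·))[s], n / (d * d) ^ s % (d * d)) = (ofFun σ (I.sort (· ≤ ·)))[s] := by
      simp only [ofFun, List.getElem_map]
      congr 1
      have hi : (I.orderIsoOfFin rfl ⟨s, hs'⟩ : ℕ) = (I.sort (· ≤ ·))[s] :=
        Finset.orderEmbOfFin_apply _ rfl _
      rw [← hi, hσ, digit, Equiv.apply_symm_apply, OrderIso.symm_apply_apply,
        finFunctionFinEquiv_symm_apply_val]
    rw [getElem_ofDigits h1 hs, h3]

end Key

namespace RawRat

def ofRat (q : ℚ) : RawRat := ((decide (q.num < 0), q.num.natAbs), q.den)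

/-- The rational number represented by `q`. -/
def val (q : RawRat) : ℚ := (bif q.1.1 then -(q.1.2 : ℚ) else q.1.2) / q.2

theorem val_ofRat (q : ℚ) : (ofRat q).val = q := by
  rw [val, ofRat]
  dsimp only
  by_cases h : q.num < 0
  · rw [decide_eq_true h, cond_true]
    have h1 : ((q.num.natAbs : ℤ) : ℚ) = ((-q.num : ℤ) : ℚ) := by
      rw [Int.ofNat_natAbs_of_nonpos h.le]
    rw [Int.cast_natCast] at h1
    rw [h1, Int.cast_neg, neg_neg, Rat.num_div_den]
  · rw [decide_eq_false h, cond_false]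
    have h1 : ((q.num.natAbs : ℤ) : ℚ) = (q.num : ℚ) := by
      rw [Int.natAbs_of_nonneg (not_lt.1 h)]
    rw [Int.cast_natCast] at h1
    rw [h1, Rat.num_div_den]

theorem scale_val {q : RawRat} (hq : q.2 ≠ 0) (c : ℕ) :
    ((q.scale c).1 : ℂ) - (q.scale c).2 = q.2 * c * q.val := by
  have hq' : (q.2 : ℂ) ≠ 0 := by exact_mod_cast hq
  rw [scale, val]
  cases q.1.1
  · simp only [cond_false]
    push_cast
    field_simp
    ring
  · simp only [cond_true]
    push_cast
    field_simp
    ring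

end RawRat

/-- As the keys are distinct, the other rows are recognized by their keys, and the product of their
denominators is the cofactor that brings a row to the common denominator without division. -/
theorem rowsDen_eq {l : List (Key × RawRat × RawRat)} (hl : (l.map fun p => p.1).Nodup) {k : Key}
    {x : RawRat × RawRat} (hx : (k, x) ∈ l) :
    rowsDen l = x.1.2 * x.2.2 * rowsDen (l.filter fun p => !(p.1 == k)) := by
  induction l with
  | nil => simp at hx
  | cons p l ih =>
    rw [List.map_cons, List.nodup_cons] at hl
    rcases List.mem_cons.1 hx with rfl | hx
    · have h1 : l.filter (fun p => !(p.1 == k)) = l := by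
        rw [List.filter_eq_self]
        intro p hp
        have : p.1 ≠ k := fun h => hl.1 (List.mem_map.2 ⟨p, hp, h⟩)
        simp [this]
      simp [h1, rowsDen]
    · have h1 : p.1 ≠ k := fun h => hl.1 (List.mem_map.2 ⟨_, hx, h.symm⟩)
      have h2 := ih hl.2 hx
      simp only [rowsDen] at h2 ⊢
      rw [List.map_cons, List.prod_cons, h2, List.filter_cons, if_pos (by simp [h1]),
        List.map_cons, List.prod_cons]
      ring

theorem tableSum_scaledRows {l : List (Key × RawRat × RawRat)}
    (hl : (l.map fun p => p.1).Nodup) (hden : ∀ p ∈ l, p.2.1.2 ≠ 0 ∧ p.2.2.2 ≠ 0) {k : Key}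
    {x : RawRat × RawRat} (hx : (k, x) ∈ l) :
    tableSum (scaledRows l) k = rowsDen l * ((x.1.val : ℂ) + (x.2.val : ℂ) * Complex.I) := by
  have h1 : ((scaledRows l).map fun p => p.1) = l.map fun p => p.1 := by
    rw [scaledRows, List.map_map]
    rfl
  have h2 : (k, (x.1.scale (x.2.2 * rowsDen (l.filter fun p' => !(p'.1 == k))),
      x.2.scale (x.1.2 * rowsDen (l.filter fun p' => !(p'.1 == k))))) ∈ scaledRows l :=
    List.mem_map.2 ⟨_, hx, rfl⟩
  rw [tableSum_eq_of_mem (h1 ▸ hl) h2, GPair.val]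
  dsimp only
  rw [RawRat.scale_val (hden _ hx).1, RawRat.scale_val (hden _ hx).2, rowsDen_eq hl hx]
  push_cast
  ring

theorem GPair.weight_lt_two_pow_sz (x : GPair) : x.weight < 2 ^ sz x := by
  have h1 := lt_two_pow_sz x.1.1
  have h2 := lt_two_pow_sz x.1.2
  have h3 := lt_two_pow_sz x.2.1
  have h4 := lt_two_pow_sz x.2.2
  have h5 : sz x = sz x.1.1 + sz x.1.2 + 1 + (sz x.2.1 + sz x.2.2 + 1) + 1 := by
    rw [sz_prod, sz_prod, sz_prod]
  have h6 : ∀ a b : ℕ, 2 ^ a + 2 ^ b ≤ 2 ^ (a + b + 1) := fun a b => by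
    have := Nat.pow_le_pow_right (n := 2) (by omega) (Nat.le_add_right a b)
    have := Nat.pow_le_pow_right (n := 2) (by omega) (Nat.le_add_left b a)
    rw [pow_succ]
    omega
  have h7 := h6 (sz x.1.1) (sz x.1.2)
  have h8 := h6 (sz x.2.1) (sz x.2.2)
  have h9 := h6 (sz x.1.1 + sz x.1.2 + 1) (sz x.2.1 + sz x.2.2 + 1)
  rw [weight, h5]
  omega

/-- Yields the base `A` of the bounds in `Represents`: a power of two whose exponent is the size of
the code. -/
theorem tableWeight_lt_two_pow_sz (l : List (Key × GPair)) : tableWeight l < 2 ^ sz l := by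
  induction l with
  | nil => simp [tableWeight]
  | cons p l ih =>
    have h1 := p.2.weight_lt_two_pow_sz
    have h2 : sz (p :: l) = sz p.1 + sz p.2 + 1 + sz l + 1 := by rw [sz_cons, sz_prod]
    have h3 := Nat.pow_le_pow_right (n := 2) (by omega)
      (show sz p.2 + sz l + 1 ≤ sz (p :: l) by omega)
    have h4 := Nat.pow_le_pow_right (n := 2) (by omega) (Nat.le_add_right (sz p.2) (sz l))
    have h5 := Nat.pow_le_pow_right (n := 2) (by omega) (Nat.le_add_left (sz l) (sz p.2))
    rw [pow_succ] at h3
    simp only [tableWeight, List.map_cons, List.sum_cons] at *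
    omega

section Input

variable {d : ℕ}

/-- The enumeration of the assignments to the indices in `I`. -/
def assignmentEquiv (d : ℕ) (I : Finset ℕ) : Fin ((d * d) ^ I.card) ≃ (I → Fin d × Fin d) :=
  finFunctionFinEquiv.symm.trans
    (Equiv.arrowCongr (I.orderIsoOfFin rfl).toEquiv finProdFinEquiv.symm)

def rawTable {I : Finset ℕ} (t : (I → Fin d × Fin d) → ℚ × ℚ) : List (RawRat × RawRat) :=
  List.ofFn fun n => (RawRat.ofRat (t (assignmentEquiv d I n)).1,
    RawRat.ofRat (t (assignmentEquiv d I n)).2)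

theorem ofDigits_assignmentEquiv (I : Finset ℕ) (σ₀ : ℕ → Fin d × Fin d)
    (n : Fin ((d * d) ^ I.card)) :
    Key.ofDigits (d * d) (I.sort (· ≤ ·)) n =
      Key.ofFun (Function.updateFinset σ₀ I (assignmentEquiv d I n)) (I.sort (· ≤ ·)) := by
  refine Key.ofDigits_sort I n _ fun i => ?_
  simp only [Function.updateFinset, i.2, dite_true]
  rfl

theorem keyedRows_rawTable {I : Finset ℕ} (t : (I → Fin d × Fin d) → ℚ × ℚ)
    (σ₀ : ℕ → Fin d × Fin d) :
    keyedRows (d * d) (I.sort (· ≤ ·)) (rawTable t) = List.ofFn fun n =>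
      (Key.ofFun (Function.updateFinset σ₀ I (assignmentEquiv d I n)) (I.sort (· ≤ ·)),
        RawRat.ofRat (t (assignmentEquiv d I n)).1, RawRat.ofRat (t (assignmentEquiv d I n)).2) := by
  rw [keyedRows, rawTable]
  apply List.ext_getElem
  · simp
  · intro s h1 h2
    have hs : s < (d * d) ^ I.card := by simpa using h2
    simp only [List.getElem_zip, List.getElem_map, List.getElem_range, List.getElem_ofFn]
    rw [← ofDigits_assignmentEquiv I σ₀ ⟨s, hs⟩]

namespace Entry

variable {N : AbstractNetwork}

theorem Represents.leaf {tens : ∀ j : Fin N.size, ℕ → Tensor d (N.I j)} {count : Fin N.size → ℕ}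
    (hd : 0 < d) {j : Fin N.size} {k : ℕ} (hk : k < count j)
    {t : (N.I j → Fin d × Fin d) → ℚ × ℚ}
    (ht : ∀ σ, tens j k σ = ((t σ).1 : ℂ) + ((t σ).2 : ℂ) * Complex.I) {c : List (Option ℕ)}
    (hc : c = List.ofFn fun i => if i = j then some k else none) {A : ℕ}
    (hA : 2 ^ sz (Entry.leaf (d * d) ((N.I j).sort (· ≤ ·)) c (rawTable t)) ≤ A) :
    (Entry.leaf (d * d) ((N.I j).sort (· ≤ ·)) c (rawTable t)).Represents tens count A {j}
      fun _ => k := by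
  let σ₀ : ℕ → Fin d × Fin d := fun _ => (⟨0, hd⟩, ⟨0, hd⟩)
  have hrows := keyedRows_rawTable t σ₀
  have hmem : ∀ σ : ℕ → Fin d × Fin d, (Key.ofFun σ ((N.I j).sort (· ≤ ·)),
      RawRat.ofRat (t fun i => σ i).1, RawRat.ofRat (t fun i => σ i).2) ∈
      keyedRows (d * d) ((N.I j).sort (· ≤ ·)) (rawTable t) := by
    intro σ
    rw [hrows, List.mem_ofFn]
    refine ⟨(assignmentEquiv d (N.I j)).symm fun i => σ i, ?_⟩
    rw [Equiv.apply_symm_apply]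
    congr 1
    rw [Key.ofFun_eq_iff]
    intro i hi
    rw [Finset.mem_sort] at hi
    simp [Function.updateFinset, hi]
  have hnodup : ((keyedRows (d * d) ((N.I j).sort (· ≤ ·)) (rawTable t)).map
      fun p => p.1).Nodup := by
    rw [hrows, List.map_ofFn, List.nodup_ofFn]
    intro n n' hn
    rw [Function.comp_apply, Function.comp_apply, Key.ofFun_eq_iff] at hn
    apply (assignmentEquiv d (N.I j)).injective
    funext i
    have := hn i ((Finset.mem_sort _).2 i.2)
    simpa [Function.updateFinset] using this
  have hden : ∀ p ∈ keyedRows (d * d) ((N.I j).sort (· ≤ ·)) (rawTable t),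
      p.2.1.2 ≠ 0 ∧ p.2.2.2 ≠ 0 := by
    intro p hp
    rw [hrows, List.mem_ofFn] at hp
    obtain ⟨n, rfl⟩ := hp
    exact ⟨Rat.den_nz _, Rat.den_nz _⟩
  have hkeys : ∀ p : Key × GPair, p ∈ scaledRows (keyedRows (d * d) ((N.I j).sort (· ≤ ·))
      (rawTable t)) → ∃ τ : ℕ → Fin d × Fin d, p.1 = Key.ofFun τ ((N.I j).sort (· ≤ ·)) := by
    intro p hp
    rw [scaledRows, hrows] at hp
    obtain ⟨q, hq, rfl⟩ := List.mem_map.1 hp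
    obtain ⟨n, rfl⟩ := List.mem_ofFn.1 hq
    exact ⟨_, rfl⟩
  have hsz : sz (Entry.leaf (d * d) ((N.I j).sort (· ≤ ·)) c (rawTable t)) =
      sz c + (sz ((N.I j).sort (· ≤ ·)) +
        (sz (rowsDen (keyedRows (d * d) ((N.I j).sort (· ≤ ·)) (rawTable t))) +
          sz (scaledRows (keyedRows (d * d) ((N.I j).sort (· ≤ ·)) (rawTable t))) + 1) + 1) + 1 :=
    rfl
  refine ⟨?_, ?_, Finset.sort_nodup _ _, ?_, ?_, ?_, ?_, hkeys, ?_, ?_, ?_⟩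
  · simp only [Finset.mem_singleton]
    exact hc
  · simpa using hk
  · rw [AbstractNetwork.boundary_singleton]
    exact Finset.sort_toFinset _ _
  · apply Nat.pos_of_ne_zero
    change rowsDen _ ≠ 0
    rw [rowsDen, ne_eq, List.prod_eq_zero_iff, List.mem_map]
    rintro ⟨p, hp, h0⟩
    exact mul_ne_zero (hden p hp).1 (hden p hp).2 h0
  · rw [Finset.card_singleton, pow_one]
    refine le_trans ((lt_two_pow_sz _).le.trans (Nat.pow_le_pow_right (by omega) ?_)) hA
    change sz (rowsDen _) ≤ _
    omega
  · rw [Finset.card_singleton, pow_one]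
    refine le_trans ((tableWeight_lt_two_pow_sz _).le.trans
      (Nat.pow_le_pow_right (by omega) ?_)) hA
    change sz (scaledRows _) ≤ _
    omega
  · intro τ
    exact ⟨_, List.mem_map.2 ⟨_, hmem τ, rfl⟩, rfl⟩
  · change ((scaledRows _).map _).Nodup
    rw [scaledRows, List.map_map]
    exact hnodup
  · intro σ
    refine (tableSum_scaledRows hnodup hden (hmem σ)).trans ?_
    rw [AbstractNetwork.contraction_singleton]
    simp only [RawRat.val_ofRat]
    rw [← ht fun i => σ i]
    rfl

end Entry

namespace FeasibilityNetwork.Presentation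

variable {F : FeasibilityNetwork d} {η : ℝ} (P : F.Presentation η)

/-- The input of the algorithm. -/
def rawInput (δ : ℚ) : RawInput :=
  (d, RawRat.ofRat δ, List.ofFn fun j =>
    ((F.net.I j).sort (· ≤ ·), List.ofFn fun k => rawTable (P.table j k)))

/-- The typed input has literally the same code as the prescribed one, so that no program for
parsing is needed. -/
theorem enc_rawInput (δ : ℚ) : enc (P.rawInput δ) = P.input δ := by
  have h1 : ∀ {I : Finset ℕ} (t : (I → Fin d × Fin d) → ℚ × ℚ),
      enc (rawTable t) = Data.ofTable t := by
    intro I t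
    rw [rawTable, Data.ofTable]
    change Data.ofList (List.map enc _) = _
    rw [List.map_ofFn]
    rfl
  have h2 : ∀ j, enc (List.ofFn fun k => rawTable (P.table j k)) =
      Data.ofList (List.ofFn fun k => Data.ofTable (P.table j k)) := by
    intro j
    change Data.ofList (List.map enc _) = _
    rw [List.map_ofFn]
    congr 2
    funext k
    exact h1 _
  have h3 : enc (List.ofFn fun j => ((F.net.I j).sort (· ≤ ·),
      List.ofFn fun k => rawTable (P.table j k))) = .ofList (List.ofFn fun j =>
    .cons (.ofIndexSet (F.net.I j)) (.ofList (List.ofFn fun k => .ofTable (P.table j k)))) := by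
    change Data.ofList (List.map enc _) = _
    rw [List.map_ofFn]
    congr 2
    funext j
    exact congrArg (Data.cons (Data.ofIndexSet (F.net.I j))) (h2 j)
  exact congrArg (fun z => Data.cons (.ofNat d) (.cons (.ofRat δ) z)) h3

/-- The approximate tensors. -/
noncomputable def approx (j : Fin F.net.size) (k : ℕ) : Tensor d (F.net.I j) := fun σ =>
  if h : k < P.count j then
    (((P.table j ⟨k, h⟩ σ).1 : ℂ) + ((P.table j ⟨k, h⟩ σ).2 : ℂ) * Complex.I) else 0

/-- The exact tensors. -/
noncomputable def exact (j : Fin F.net.size) (k : ℕ) : Tensor d (F.net.I j) :=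
  if h : k < P.count j then P.tensor j ⟨k, h⟩ else 0

theorem mem_leaves_iff (δ : ℚ) (e : Entry) :
    e ∈ (P.rawInput δ).leaves ↔ ∃ (j : Fin F.net.size) (k : Fin (P.count j)),
      e = Entry.leaf (d * d) ((F.net.I j).sort (· ≤ ·))
        (List.ofFn fun i => if i = j then some k.1 else none) (rawTable (P.table j k)) := by
  have hzip : ∀ {β : Type} {n : ℕ} (g : Fin n → β) (x : β × ℕ),
      x ∈ (List.ofFn g).zip (List.range (List.ofFn g).length) ↔ ∃ i, x = (g i, i.1) := by
    intro β n g x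
    rw [List.mem_iff_getElem]
    constructor
    · rintro ⟨s, hs, rfl⟩
      have hs' : s < n := by simpa using hs
      exact ⟨⟨s, hs'⟩, by simp⟩
    · rintro ⟨i, rfl⟩
      exact ⟨i, by simp, by simp⟩
  have hc : ∀ (j : Fin F.net.size) (k : ℕ), ((List.range F.net.size).map fun i =>
      bif i == j.1 then some k else none) = List.ofFn fun i => if i = j then some k else none := by
    intro j k
    apply List.ext_getElem
    · simp
    · intro s h1 h2
      simp only [List.getElem_map, List.getElem_range, List.getElem_ofFn, Fin.ext_iff]
      by_cases h : s = j.1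
      · simp [h]
      · rw [if_neg h, beq_eq_false_iff_ne.2 h, cond_false]
  rw [RawInput.leaves, List.mem_flatMap]
  constructor
  · rintro ⟨p, hp, he⟩
    obtain ⟨j, rfl⟩ := (hzip _ _).1 hp
    obtain ⟨t, ht, rfl⟩ := List.mem_map.1 he
    obtain ⟨k, rfl⟩ := (hzip _ _).1 ht
    refine ⟨j, k, ?_⟩
    rw [← hc]
    simp [rawInput]
  · rintro ⟨j, k, rfl⟩
    refine ⟨_, (hzip _ _).2 ⟨j, rfl⟩, List.mem_map.2 ⟨_, (hzip _ _).2 ⟨k, rfl⟩, ?_⟩⟩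
    rw [← hc]
    simp [rawInput]

end FeasibilityNetwork.Presentation

end Input

/-! ### The invariant of the search and its saturation -/

namespace AbstractNetwork

variable {N : AbstractNetwork} {d : ℕ}

theorem Mergeable.mono {r r' : ℕ} (h : r ≤ r') {S : Finset (Fin N.size)} (hS : N.Mergeable r S) :
    N.Mergeable r' S := by
  induction hS with
  | singleton j => exact .singleton j
  | union _ _ hd hc ih ih' => exact .union ih ih' hd (hc.trans h)

theorem Mergeable.nonempty {r : ℕ} {S : Finset (Fin N.size)} (hS : N.Mergeable r S) :
    S.Nonempty := by
  induction hS with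
  | singleton j => exact Finset.singleton_nonempty j
  | union _ _ _ _ ih _ => exact ih.mono Finset.subset_union_left

end AbstractNetwork

namespace LoopState

variable {N : AbstractNetwork} {d : ℕ}

/-- All entries of the list represent choices of single tensors, and all of them occur. -/
structure IsLeafList (tens : ∀ j : Fin N.size, ℕ → Tensor d (N.I j)) (count : Fin N.size → ℕ)
    (A : ℕ) (E : List Entry) : Prop where
  represents : ∀ e ∈ E, ∃ j f, Entry.Represents tens count A e {j} f
  exists_mem : ∀ j k, k < count j → ∃ e ∈ E, ∃ f, Entry.Represents tens count A e {j} f ∧ f j = k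

/-- The invariant of the main loop. -/
structure Invariant (tens : ∀ j : Fin N.size, ℕ → Tensor d (N.I j)) (count : Fin N.size → ℕ)
    (A M : ℕ) (E L : List Entry) (s : LoopState) : Prop where
  precision_eq : s.2.1 = M
  entries_eq : s.2.2.2 = L ++ E
  merged : ∀ e ∈ L, ∃ S f, Entry.Represents tens count A e S f ∧ N.Mergeable s.2.2.1 S ∧
    (N.boundary S).card ≤ s.2.2.1 ∧ 2 ≤ S.card
  pairwise : L.Pairwise fun e e' => e.Close M e' = false

variable {tens : ∀ j : Fin N.size, ℕ → Tensor d (N.I j)} {count : Fin N.size → ℕ} {A M : ℕ}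
  {E L : List Entry} {s : LoopState}

theorem Invariant.represents (hE : IsLeafList tens count A E)
    (h : Invariant tens count A M E L s) {e : Entry} (he : e ∈ s.2.2.2) :
    ∃ S f, Entry.Represents tens count A e S f ∧ N.Mergeable s.2.2.1 S := by
  rw [h.entries_eq, List.mem_append] at he
  rcases he with he | he
  · obtain ⟨S, f, h1, h2, -⟩ := h.merged e he
    exact ⟨S, f, h1, h2⟩
  · obtain ⟨j, f, h1⟩ := hE.represents e he
    exact ⟨{j}, f, h1, .singleton j⟩

theorem mem_candidates {e : Entry} : e ∈ s.candidates ↔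
    (∃ e₁ ∈ s.2.2.2, ∃ e₂ ∈ s.2.2.2, e₁.Apart e₂ = true ∧ e = e₁.merge e₂) ∧
      e.2.1.length ≤ s.2.2.1 ∧ ∀ e' ∈ s.2.2.2, e.Close s.2.1 e' = false := by
  rw [candidates, List.mem_filter, Bool.and_eq_true, decide_eq_true_iff, Bool.not_eq_true',
    List.any_eq_false]
  simp only [Bool.not_eq_true]
  refine and_congr_left fun _ => ?_
  rw [List.mem_map]
  constructor
  · rintro ⟨p, hp, rfl⟩
    rw [List.mem_filter, List.mem_flatMap] at hp
    obtain ⟨⟨e₁, h₁, h⟩, h'⟩ := hp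
    obtain ⟨e₂, h₂, rfl⟩ := List.mem_map.1 h
    exact ⟨e₁, h₁, e₂, h₂, h', rfl⟩
  · rintro ⟨e₁, h₁, e₂, h₂, h, rfl⟩
    exact ⟨(e₁, e₂), List.mem_filter.2 ⟨List.mem_flatMap.2 ⟨e₁, h₁, List.mem_map.2 ⟨e₂, h₂, rfl⟩⟩,
      h⟩, rfl⟩

theorem Invariant.candidate (hE : IsLeafList tens count A E)
    (h : Invariant tens count A M E L s) {e : Entry} (he : e ∈ s.candidates) :
    ∃ S f, Entry.Represents tens count A e S f ∧ N.Mergeable s.2.2.1 S ∧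
      (N.boundary S).card ≤ s.2.2.1 ∧ 2 ≤ S.card := by
  obtain ⟨⟨e₁, h₁, e₂, h₂, hap, rfl⟩, hlen, -⟩ := mem_candidates.1 he
  obtain ⟨S, f, hr, hm⟩ := h.represents hE h₁
  obtain ⟨S', f', hr', hm'⟩ := h.represents hE h₂
  have hS := (hr.apart_iff hr').1 hap
  have hM := hr.merge hr' hS
  have hc : (N.boundary (S ∪ S')).card ≤ s.2.2.1 := hM.card_index ▸ hlen
  refine ⟨S ∪ S', _, hM, .union hm hm' hS hc, hc, ?_⟩
  have h1 := hm.nonempty.card_pos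
  have h2 := hm'.nonempty.card_pos
  rw [Finset.card_union_of_disjoint hS]
  omega

theorem Invariant.step_of_mem (hE : IsLeafList tens count A E)
    (h : Invariant tens count A M E L s) {e : Entry} (he : s.candidates.head? = some e) :
    s.step = (true, s.2.1, s.2.2.1, e :: s.2.2.2) ∧
      Invariant tens count A M E (e :: L) s.step := by
  have h1 : s.step = (true, s.2.1, s.2.2.1, e :: s.2.2.2) := by rw [step, he]; rfl
  have he' := List.mem_of_head? he
  refine ⟨h1, ?_⟩
  rw [h1]
  refine ⟨h.precision_eq, by rw [h.entries_eq]; rfl, ?_, ?_⟩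
  · intro e' he'
    rcases List.mem_cons.1 he' with rfl | he'
    · exact h.candidate hE ‹_›
    · exact h.merged e' he'
  · refine List.pairwise_cons.2 ⟨fun e' h' => ?_, h.pairwise⟩
    rw [← h.precision_eq]
    exact (mem_candidates.1 he').2.2 e' (by rw [h.entries_eq]; exact List.mem_append_left _ h')

theorem step_of_not_full (he : s.candidates.head? = none)
    (hf : (s.2.2.2.any fun e => e.Full) = false) :
    s.step = (true, s.2.1, s.2.2.1 + 1, s.2.2.2) := by
  rw [step, he, hf]
  rfl

theorem step_of_full (he : s.candidates.head? = none)
    (hf : (s.2.2.2.any fun e => e.Full) = true) : s.step = (false, s.2) := by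
  rw [step, he, hf]
  rfl

theorem Invariant.succ (h : Invariant tens count A M E L s) :
    Invariant tens count A M E L (true, s.2.1, s.2.2.1 + 1, s.2.2.2) := by
  refine ⟨h.precision_eq, h.entries_eq, fun e he => ?_, h.pairwise⟩
  obtain ⟨S, f, h1, h2, h3, h4⟩ := h.merged e he
  exact ⟨S, f, h1, h2.mono (Nat.le_succ _), h3.trans (Nat.le_succ _), h4⟩

/-- If there are no candidates, then each choice is approximated by an entry. -/
theorem Invariant.exists_close (hd : 0 < d) (hE : IsLeafList tens count A E)
    (h : Invariant tens count A M E L s) (hs : s.candidates.head? = none) (hM : 0 < M) {B : ℝ}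
    (hB : ∀ c, (∀ j, c j < count j) → ∀ S σ,
      ‖N.contraction (AbstractNetwork.labelling tens c) S σ‖ ≤ B)
    {S : Finset (Fin N.size)} (hS : N.Mergeable s.2.2.1 S) {c : Fin N.size → ℕ}
    (hc : ∀ j, c j < count j) :
    ∃ e ∈ s.2.2.2, ∃ f, Entry.Represents tens count A e S f ∧ ∀ σ,
      ‖N.contraction (AbstractNetwork.labelling tens c) S σ -
        N.contraction (AbstractNetwork.labelling tens f) S σ‖ ≤ (S.card - 1) * (2 / M * B) := by
  -- The family consists of the choices represented by entries. The constant `2 / M` comes from real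
  -- and imaginary part, which contribute `1 / M` each.
  have key := hS.exists_close hd (ε := 2 / M) (K := fun S f => ∃ e ∈ s.2.2.2,
    Entry.Represents tens count A e S f) hB (fun S f => ?_) ?_ ?_
  · obtain ⟨-, h1⟩ := key
    obtain ⟨f, ⟨e, he, hr⟩, hf⟩ := h1 c hc
    refine ⟨e, he, f, hr, fun σ => ?_⟩
    have h2 := hf S (le_refl _) σ
    rwa [AbstractNetwork.contraction_congr
      (lam := AbstractNetwork.labelling tens (S.piecewise f c))
      (lam' := AbstractNetwork.labelling tens f) (fun j hj => by
        simp only [AbstractNetwork.labelling, Finset.piecewise_eq_of_mem _ _ _ hj])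
      fun _ _ => rfl] at h2
  · rintro ⟨e, -, hr⟩
    exact hr.valid
  · intro j k hk
    obtain ⟨e, he, f, hf⟩ := hE.exists_mem j k hk
    exact ⟨f, ⟨e, by rw [h.entries_eq]; exact List.mem_append_right _ he, hf.1⟩, hf.2⟩
  · rintro S S' f g ⟨e, he, hr⟩ ⟨e', he', hr'⟩ hSS hcard
    have hm := hr.merge hr' hSS
    have h2 : e.merge e' ∉ s.candidates := by
      rw [List.head?_eq_none_iff.1 hs]
      exact List.not_mem_nil
    rw [mem_candidates] at h2
    -- The merge has disjoint parts and few indices; the only possible reason why it is not a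
    -- candidate is an entry close to it.
    have h3 : ∃ e'' ∈ s.2.2.2, (e.merge e').Close M e'' = true := by
      by_contra hcon
      push Not at hcon
      refine h2 ⟨⟨e, he, e', he', (hr.apart_iff hr').2 hSS, rfl⟩, hm.card_index ▸ hcard, ?_⟩
      intro e'' he''
      rw [h.precision_eq]
      simpa using hcon e'' he''
    obtain ⟨e'', he'', hclose⟩ := h3
    obtain ⟨S'', k, hr'', -⟩ := h.represents hE he''
    obtain ⟨-, rfl, hσ⟩ := (hm.close_iff hr'').1 hclose
    refine ⟨k, ⟨e'', he'', hr''⟩, fun σ => ?_⟩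
    obtain ⟨hre, him⟩ := hσ σ
    have hn := Complex.norm_le_abs_re_add_abs_im
      (N.contraction (AbstractNetwork.labelling tens (S.piecewise f g)) (S ∪ S') σ -
        N.contraction (AbstractNetwork.labelling tens k) (S ∪ S') σ)
    have hM' : (0 : ℝ) < M := by exact_mod_cast hM
    rw [hm.length_table hd] at hre him
    push_cast at hre him ⊢
    rw [le_div_iff₀ hM']
    have hq : (0 : ℝ) ≤ ((d : ℝ) * d) ^ (N.boundary (S ∪ S')).card := by positivity
    have := mul_le_mul_of_nonneg_left hn (mul_nonneg hM'.le hq)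
    linarith

end LoopState

/-! ### Sizes of states and number of entries -/

theorem sz_nat_le_of_le_two_pow {n k : ℕ} (h : n ≤ 2 ^ k) : sz n ≤ 4 * k + 5 := by
  have h1 := sz_nat_le n
  have h2 : n.size ≤ k + 1 := by
    rw [Nat.size_le, pow_succ]
    have := Nat.two_pow_pos k
    omega
  omega

namespace Entry.Represents

variable {N : AbstractNetwork} {d : ℕ} {tens : ∀ j : Fin N.size, ℕ → Tensor d (N.I j)}
  {count : Fin N.size → ℕ} {e : Entry} {S : Finset (Fin N.size)} {f : Fin N.size → ℕ}

/-- Exact arithmetic is affordable: all numbers are at most `2 ^ (a * |S|)`, so their binary length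
is of order `W ^ 2`, and there are at most `(d * d) ^ r` rows with at most `r` indices each. -/
theorem sz_le {a W r : ℕ} (hd : 0 < d) (h : e.Represents tens count (2 ^ a) S f) (hW : 1 ≤ W)
    (ha : a ≤ W) (hm : N.size ≤ W) (hcount : ∀ j, count j ≤ W) (hI : ∀ i ∈ N.indices, sz i ≤ W)
    (hdW : sz d ≤ W) (hr : (N.boundary S).card ≤ r) :
    sz e ≤ 100 * ((r + 1) * (d * d) ^ r * W ^ 2) := by
  have hWW : W ≤ W ^ 2 := Nat.le_self_pow (by omega) W
  have hnum : ∀ n, n ≤ (2 ^ a) ^ S.card → sz n ≤ 9 * W ^ 2 := by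
    intro n hn
    rw [← pow_mul] at hn
    have h1 := sz_nat_le_of_le_two_pow hn
    have h2 : a * S.card ≤ W ^ 2 := by
      rw [sq]
      exact Nat.mul_le_mul ha ((Finset.card_le_univ S).trans (by simpa using hm))
    omega
  have hidx : ∀ i ∈ e.2.1, sz i ≤ W := by
    intro i hi
    refine hI i (Finset.mem_of_mem_filter i (?_ : i ∈ N.boundary S))
    rwa [← h.index, List.mem_toFinset]
  have hlen : e.2.1.length ≤ r := h.card_index ▸ hr
  have h1 : sz e.1 ≤ 8 * W ^ 2 + 1 := by
    refine (sz_le_of_forall (b := 4 * W + 3) fun o ho => ?_).trans ?_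
    · rw [h.choice] at ho
      obtain ⟨j, rfl⟩ := List.mem_ofFn.1 ho
      split_ifs with hj
      · rw [sz_some]
        have h2 := sz_nat_le_self (f j)
        have h3 := h.valid j hj
        have h4 := hcount j
        omega
      · rw [sz_none]
        omega
    · have : e.1.length ≤ W := by
        rw [h.choice, List.length_ofFn]
        exact hm
      nlinarith
  have h2 : sz e.2.1 ≤ r * (W + 1) + 1 :=
    (sz_le_of_forall hidx).trans (by gcongr)
  have h3 : sz e.2.2.1 ≤ 9 * W ^ 2 := hnum _ h.den_le
  have h4 : sz e.2.2.2 ≤ (d * d) ^ r * (50 * ((r + 1) * W ^ 2) + 1) + 1 := by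
    refine (sz_le_of_forall (b := 50 * ((r + 1) * W ^ 2)) fun p hp => ?_).trans ?_
    · have hw : p.2.weight ≤ (2 ^ a) ^ S.card := by
        refine le_trans ?_ h.weight_le
        exact List.single_le_sum (fun _ _ => Nat.zero_le _) _ (List.mem_map_of_mem hp)
      have e0 : sz p = sz p.1 + (sz p.2.1.1 + sz p.2.1.2 + 1 + (sz p.2.2.1 + sz p.2.2.2 + 1) + 1)
          + 1 := rfl
      rw [GPair.weight] at hw
      have e1 := hnum p.2.1.1 (by omega)
      have e2 := hnum p.2.1.2 (by omega)
      have e3 := hnum p.2.2.1 (by omega)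
      have e4 := hnum p.2.2.2 (by omega)
      have e5 : sz p.1 ≤ r * (10 * W + 6) + 1 := by
        obtain ⟨τ, hτ⟩ := h.hasKeys p hp
        rw [hτ]
        refine (sz_le_of_forall (b := 9 * W + 6) fun x hx => ?_).trans ?_
        · obtain ⟨i, hi, rfl⟩ := List.mem_map.1 hx
          rw [sz_prod]
          have h5 := hidx i hi
          have h6 := lt_two_pow_sz d
          have h7 : digit (τ i) ≤ 2 ^ (2 * W) := by
            refine (digit_lt (τ i)).le.trans ?_
            rw [two_mul, pow_add]
            have := h6.le.trans (Nat.pow_le_pow_right (by omega) hdW)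
            exact Nat.mul_le_mul this this
          have h8 := sz_nat_le_of_le_two_pow h7
          omega
        · rw [Key.ofFun, List.length_map]
          have : 9 * W + 6 + 1 ≤ 10 * W + 6 := by omega
          gcongr
      have e6 : r * (10 * W + 6) ≤ 16 * (r * W ^ 2) := by
        calc r * (10 * W + 6) ≤ r * (16 * W ^ 2) := by
              gcongr
              omega
          _ = 16 * (r * W ^ 2) := by ring
      rw [add_mul, one_mul]
      omega
    · rw [h.length_table hd]
      have : 0 < d * d := by positivity
      gcongr
  have h5 : sz e = sz e.1 + (sz e.2.1 + (sz e.2.2.1 + sz e.2.2.2 + 1) + 1) + 1 := rfl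
  have h6 : 1 ≤ (d * d) ^ r := Nat.one_le_pow _ _ (by positivity)
  have h7 : (r + 1) * W ^ 2 ≤ (d * d) ^ r * ((r + 1) * W ^ 2) := Nat.le_mul_of_pos_left _ h6
  have h8 : (d * d) ^ r ≤ (d * d) ^ r * ((r + 1) * W ^ 2) :=
    Nat.le_mul_of_pos_right _ (by positivity)
  have h9 : r * (W + 1) ≤ 2 * (r * W ^ 2) := by
    calc r * (W + 1) ≤ r * (2 * W ^ 2) := by
          gcongr
          omega
      _ = 2 * (r * W ^ 2) := by ring
  have h10 : (r + 1) * (d * d) ^ r * W ^ 2 = (d * d) ^ r * ((r + 1) * W ^ 2) := by ring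
  have h11 : (r + 1) * W ^ 2 = r * W ^ 2 + W ^ 2 := by ring
  have h12 : (d * d) ^ r * (50 * ((r + 1) * W ^ 2) + 1) =
    50 * ((d * d) ^ r * ((r + 1) * W ^ 2)) + (d * d) ^ r := by ring
  rw [h10]
  omega

end Entry.Represents

namespace LoopState

variable {N : AbstractNetwork} {d : ℕ} {tens : ∀ j : Fin N.size, ℕ → Tensor d (N.I j)}
  {count : Fin N.size → ℕ} {M : ℕ} {E L : List Entry} {s : LoopState}

theorem Invariant.sz_le {a W r P : ℕ} (hd : 0 < d) (h : Invariant tens count (2 ^ a) M E L s)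
    (hW : 1 ≤ W) (ha : a ≤ W) (hm : N.size ≤ W) (hcount : ∀ j, count j ≤ W)
    (hI : ∀ i ∈ N.indices, sz i ≤ W) (hdW : sz d ≤ W) (hE : sz E ≤ W) (hMW : sz M ≤ W)
    (hr : s.2.2.1 ≤ r) (hP : L.length ≤ P) :
    sz s ≤ 120 * ((P + 1) * ((r + 1) * (d * d) ^ r * W ^ 2)) := by
  have hWW : W ≤ W ^ 2 := Nat.le_self_pow (by omega) W
  have h0 : sz s = sz s.1 + (sz s.2.1 + (sz s.2.2.1 + sz s.2.2.2 + 1) + 1) + 1 := rfl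
  have h1 := sz_bool s.1
  have h2 := sz_append L E
  have h3 : sz L ≤ P * (100 * ((r + 1) * (d * d) ^ r * W ^ 2) + 1) + 1 := by
    refine (sz_le_of_forall (b := 100 * ((r + 1) * (d * d) ^ r * W ^ 2)) fun e he => ?_).trans
      (by gcongr)
    obtain ⟨S, f, hr', -, hc, -⟩ := h.merged e he
    exact hr'.sz_le hd hW ha hm hcount hI hdW (hc.trans hr)
  have h4 := sz_nat_le_self s.2.2.1
  have h6 : 1 ≤ (d * d) ^ r := Nat.one_le_pow _ _ (by positivity)
  have h7 : (r + 1) * W ^ 2 ≤ (d * d) ^ r * ((r + 1) * W ^ 2) := Nat.le_mul_of_pos_left _ h6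
  have h10 : (r + 1) * (d * d) ^ r * W ^ 2 = (d * d) ^ r * ((r + 1) * W ^ 2) := by ring
  have h11 : (r + 1) * W ^ 2 = r * W ^ 2 + W ^ 2 := by ring
  have h12 : r ≤ r * W ^ 2 := Nat.le_mul_of_pos_right _ (by positivity)
  rw [← h10] at h7
  generalize (r + 1) * (d * d) ^ r * W ^ 2 = X at *
  have h13 : P ≤ P * X := Nat.le_mul_of_pos_right _ (by omega)
  have h14 : (P + 1) * X = P * X + X := by ring
  have h15 : P * (100 * X + 1) = 100 * (P * X) + P := by ring
  rw [h.precision_eq, h.entries_eq] at h0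
  omega

/-- The number of entries that are not close to each other is bounded. -/
theorem Invariant.length_le {A : ℕ} (hN : N.IsConnected) (hd : 0 < d)
    (h : Invariant tens count A M E L s)
    (hB : ∀ e ∈ L, ∀ S f, Entry.Represents tens count A e S f → ∀ σ,
      ‖N.contraction (AbstractNetwork.labelling tens f) S σ‖ ≤ 2) :
    L.length ≤ (N.indices.card + 1) ^ s.2.2.1 *
      (2 * ((2 * (2 * M * (d * d) ^ s.2.2.1) + 1) ^ 2) ^ (d * d) ^ s.2.2.1) := by
  classical
  obtain ⟨a₀⟩ := hN.nonempty
  set r := s.2.2.1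
  have hm := h.merged
  choose! S f hR hS using hm
  let σ₀ : Fin d × Fin d := (⟨0, hd⟩, ⟨0, hd⟩)
  -- Contractions have norm at most two and are scaled by at most `M * (d * d) ^ r` before rounding.
  let b : ℤ := ((2 * M * (d * d) ^ r : ℕ) : ℤ)
  -- Tables for different index lists are brought to the common domain `Fin r → _` by numbering the
  -- indices by their places in the list.
  let x : Entry → (Fin r → Fin d × Fin d) → ℂ := fun e v =>
    N.contraction (AbstractNetwork.labelling tens (f e)) (S e) fun i =>
      if hi : e.2.1.idxOf i < r then v ⟨_, hi⟩ else σ₀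
  -- Entries with the same image are close: they have the same index list, on the same side of the
  -- complement ambiguity because of the bit for `a₀`, and their scaled tables have equal integer
  -- parts.
  let F : Entry → (Fin r → Option ℕ) × Bool × ((Fin r → Fin d × Fin d) → ℤ × ℤ) := fun e =>
    (fun i => e.2.1[i.1]?, decide (a₀.1 ∈ S e), fun v =>
      (⌊((M * e.2.2.2.length : ℕ) : ℝ) * (x e v).re⌋, ⌊((M * e.2.2.2.length : ℕ) : ℝ) * (x e v).im⌋))
  let T : Finset ((Fin r → Option ℕ) × Bool × ((Fin r → Fin d × Fin d) → ℤ × ℤ)) :=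
    (Fintype.piFinset fun _ => N.indices.insertNone) ×ˢ Finset.univ ×ˢ
      Fintype.piFinset fun _ => Finset.Icc (-b) b ×ˢ Finset.Icc (-b) b
  have hlen : ∀ e ∈ L, e.2.1.length ≤ r := fun e he => by
    rw [(hR e he).card_index]
    exact (hS e he).2.1
  have hF : ∀ e ∈ L, ∀ e' ∈ L, F e = F e' → e.Close M e' = true := by
    intro e he e' he' heq
    simp only [F, Prod.mk.injEq, decide_eq_decide, funext_iff] at heq
    obtain ⟨h1, h2, h3⟩ := heq
    have hI : e.2.1 = e'.2.1 := by
      apply List.ext_getElem?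
      intro i
      by_cases hi : i < r
      · exact h1 ⟨i, hi⟩
      · rw [List.getElem?_eq_none (by have := hlen e he; omega),
          List.getElem?_eq_none (by have := hlen e' he'; omega)]
    have hSS : S e = S e' := AbstractNetwork.eq_of_boundary_eq hN
      (by rw [← (hR e he).index, ← (hR e' he').index, hI]) h2
    refine ((hR e he).close_iff (hR e' he')).2 ⟨hI, hSS, fun σ => ?_⟩
    have hx : ∀ e'' ∈ L, e''.2.1 = e.2.1 →
        N.contraction (AbstractNetwork.labelling tens (f e'')) (S e'') σ =
          x e'' fun i => σ (e.2.1.getD i.1 0) := by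
      intro e'' h'' hI''
      refine AbstractNetwork.contraction_congr (fun _ _ => rfl) fun i hi => ?_
      rw [← (hR e'' h'').index, List.mem_toFinset, hI''] at hi
      have h4 := List.idxOf_lt_length_of_mem hi
      have h5 := hlen e he
      rw [hI'', dif_pos (by omega)]
      simp [List.getD_eq_getElem?_getD, List.getElem?_eq_getElem h4]
    have hlen' : e.2.2.2.length = e'.2.2.2.length := by
      rw [(hR e he).length_table hd, (hR e' he').length_table hd, hSS]
    have hk : ((M * e.2.2.2.length : ℕ) : ℝ) = M * e.2.2.2.length := by push_cast; rfl
    obtain ⟨h6, h7⟩ := h3 fun i => σ (e.2.1.getD i.1 0)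
    rw [← hlen'] at h6 h7
    have h8 := (Int.abs_sub_lt_one_of_floor_eq_floor h6).le
    have h9 := (Int.abs_sub_lt_one_of_floor_eq_floor h7).le
    rw [← mul_sub, abs_mul, abs_of_nonneg (Nat.cast_nonneg _), hk] at h8 h9
    rw [hx e he rfl, hx e' he' hI.symm, Complex.sub_re, Complex.sub_im]
    exact ⟨h8, h9⟩
  have hnodup : (L.map F).Nodup := by
    rw [List.Nodup, List.pairwise_map]
    refine h.pairwise.imp_of_mem fun he he' hne heq => ?_
    rw [hF _ he _ he' heq] at hne
    exact absurd hne (by decide)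
  have hsub : (L.map F).toFinset ⊆ T := by
    intro y hy
    rw [List.mem_toFinset] at hy
    obtain ⟨e, he, rfl⟩ := List.mem_map.1 hy
    have hb : ∀ t : ℝ, |t| ≤ 2 → ⌊((M * e.2.2.2.length : ℕ) : ℝ) * t⌋ ∈ Finset.Icc (-b) b := by
      intro t ht
      have h1 : (M * e.2.2.2.length : ℕ) ≤ M * (d * d) ^ r := by
        rw [(hR e he).length_table hd]
        exact Nat.mul_le_mul_left _ (Nat.pow_le_pow_right (by positivity) (hS e he).2.1)
      have h2 : |((M * e.2.2.2.length : ℕ) : ℝ) * t| ≤ (M * (d * d) ^ r : ℕ) * 2 := by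
        rw [abs_mul, Nat.abs_cast]
        exact mul_le_mul (by exact_mod_cast h1) ht (abs_nonneg _) (Nat.cast_nonneg _)
      have h3 : ((M * (d * d) ^ r : ℕ) : ℝ) * 2 = (b : ℝ) := by
        simp only [b]
        push_cast
        ring
      rw [h3, abs_le] at h2
      rw [Finset.mem_Icc, Int.le_floor]
      refine ⟨by rw [Int.cast_neg]; exact h2.1, ?_⟩
      exact_mod_cast (Int.floor_le _).trans h2.2
    have hx : ∀ v, ‖x e v‖ ≤ 2 := fun v => hB e he _ _ (hR e he) _
    simp only [T, F, Finset.mem_product, Fintype.mem_piFinset, Finset.mem_univ, true_and]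
    refine ⟨fun i => ?_, fun v => ⟨hb _ ?_, hb _ ?_⟩⟩
    · rw [Finset.mem_insertNone]
      intro k hk
      have hk' : k ∈ e.2.1 := List.mem_of_getElem? hk
      rw [← List.mem_toFinset, (hR e he).index] at hk'
      exact Finset.mem_of_mem_filter k hk'
    · exact (Complex.abs_re_le_norm _).trans (hx v)
    · exact (Complex.abs_im_le_norm _).trans (hx v)
  have h1 := Finset.card_le_card hsub
  rw [List.toFinset_card_of_nodup hnodup, List.length_map] at h1
  refine h1.trans (le_of_eq ?_)
  have h2 : (Finset.Icc (-b) b).card = 2 * (2 * M * (d * d) ^ r) + 1 := by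
    rw [Int.card_Icc]
    simp only [b]
    omega
  simp only [T, Finset.card_product, Fintype.card_piFinset, h2, Finset.prod_const,
    Finset.card_univ, Fintype.card_fin, Fintype.card_bool, Fintype.card_fun, Fintype.card_prod,
    Finset.card_insertNone, sq]

end LoopState

/-! ### Termination of the search -/

namespace LoopState

variable {N : AbstractNetwork} {d : ℕ} {tens : ∀ j : Fin N.size, ℕ → Tensor d (N.I j)}
  {count : Fin N.size → ℕ} {A M : ℕ} {E : List Entry}

/-- The main loop halts as soon as there is an entry for the whole network. -/
theorem exists_halt (hd : 0 < d) (hE : IsLeafList tens count A E) (hM : 0 < M)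
    (hcount : ∀ j, 0 < count j) {B : ℝ} (hB : ∀ c, (∀ j, c j < count j) → ∀ S σ,
      ‖N.contraction (AbstractNetwork.labelling tens c) S σ‖ ≤ B)
    {r P : ℕ} (hr : N.Mergeable r Finset.univ)
    (hP : ∀ L s, Invariant tens count A M E L s → s.2.2.1 ≤ r → L.length ≤ P) :
    ∃ n ≤ P + r + 1, (∀ i < n, (step^[i] (true, M, 0, E)).1 = true) ∧
      (step^[n] (true, M, 0, E)).1 = false ∧
      (∀ i ≤ n, ∃ L, Invariant tens count A M E L (step^[i] (true, M, 0, E)) ∧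
        (step^[i] (true, M, 0, E)).2.2.1 ≤ r) ∧
      (step^[n] (true, M, 0, E)).candidates.head? = none ∧
      ∃ e ∈ (step^[n] (true, M, 0, E)).2.2.2, e.Full = true := by
  set s₀ : LoopState := (true, M, 0, E) with hs₀
  have h0 : Invariant tens count A M E [] s₀ :=
    ⟨rfl, rfl, fun e he => absurd he List.not_mem_nil, List.Pairwise.nil⟩
  -- Every round that does not stop increases the number of merged entries plus the bound for the
  -- number of indices by exactly one; both are bounded.
  have hstep : ∀ L s, Invariant tens count A M E L s → s.2.2.1 ≤ r →
      (s.step.1 = true ∧ ∃ L', Invariant tens count A M E L' s.step ∧ s.step.2.2.1 ≤ r ∧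
        L'.length + s.step.2.2.1 = L.length + s.2.2.1 + 1) ∨
      (s.step = (false, s.2) ∧ s.candidates.head? = none ∧ ∃ e ∈ s.2.2.2, e.Full = true) := by
    intro L s h hsr
    rcases hc : s.candidates.head? with _ | e
    · by_cases hf : (s.2.2.2.any fun e => e.Full) = true
      · exact Or.inr ⟨step_of_full hc hf, rfl, List.any_eq_true.1 hf⟩
      · have h1 := step_of_not_full hc (by simpa using hf)
        -- At the bound `r` the set of all positions is mergeable, so saturation would produce a
        -- full entry.
        have hlt : s.2.2.1 < r := by
          refine lt_of_le_of_ne hsr fun heq => hf ?_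
          obtain ⟨e, he, f, hef, -⟩ := h.exists_close hd hE hc hM hB (heq ▸ hr) hcount
          exact List.any_eq_true.2 ⟨e, he, hef.full_iff.2 rfl⟩
        refine Or.inl ⟨by rw [h1], L, h1 ▸ h.succ, by rw [h1]; exact hlt, by rw [h1]; rfl⟩
    · obtain ⟨h1, h2⟩ := h.step_of_mem hE hc
      refine Or.inl ⟨by rw [h1], _, h2, by rw [h1]; exact hsr, ?_⟩
      rw [h1, List.length_cons]
      exact Nat.succ_add _ _
  have hrun : ∀ n, (∀ i ≤ n, (step^[i] s₀).1 = true) → ∃ L,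
      Invariant tens count A M E L (step^[n] s₀) ∧ (step^[n] s₀).2.2.1 ≤ r ∧
        L.length + (step^[n] s₀).2.2.1 = n := by
    intro n
    induction n with
    | zero => exact fun _ => ⟨[], h0, Nat.zero_le _, rfl⟩
    | succ n ih =>
      intro hn
      obtain ⟨L, h1, h2, h3⟩ := ih fun i hi => hn i (by omega)
      have h4 := hn (n + 1) le_rfl
      rw [Function.iterate_succ_apply'] at h4 ⊢
      rcases hstep L _ h1 h2 with ⟨-, L', h5, h6, h7⟩ | ⟨h5, -⟩
      · exact ⟨L', h5, h6, by omega⟩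
      · rw [h5] at h4
        exact absurd h4 Bool.false_ne_true
  have hex : ∃ n ≤ P + r + 1, (step^[n] s₀).1 = false := by
    by_contra hcon
    push Not at hcon
    obtain ⟨L, h1, h2, h3⟩ := hrun (P + r + 1) fun i hi => by simpa using hcon i hi
    have := hP L _ h1 h2
    omega
  have hex' : ∃ n, (step^[n] s₀).1 = false := hex.imp fun _ h => h.2
  obtain ⟨n, hn, hn1⟩ : ∃ n, (step^[n] s₀).1 = false ∧ ∀ i < n, (step^[i] s₀).1 = true :=
    ⟨Nat.find hex', Nat.find_spec hex', fun i hi => by simpa using Nat.find_min hex' hi⟩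
  have hnle : n ≤ P + r + 1 := by
    obtain ⟨n', h1, h2⟩ := hex
    by_contra hlt
    rw [hn1 n' (by omega)] at h2
    exact absurd h2.symm Bool.false_ne_true
  obtain ⟨k, rfl⟩ : ∃ k, n = k + 1 := by
    refine Nat.exists_eq_succ_of_ne_zero ?_
    rintro rfl
    exact absurd hn (by simp [hs₀])
  obtain ⟨L, h1, h2, -⟩ := hrun k fun i hi => hn1 i (by omega)
  rw [Function.iterate_succ_apply'] at hn
  rcases hstep L _ h1 h2 with ⟨h3, -⟩ | ⟨h3, h4, h5⟩
  · rw [h3] at hn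
    exact absurd hn (by decide)
  · refine ⟨k + 1, hnle, hn1, by rwa [Function.iterate_succ_apply'], fun i hi => ?_, ?_, ?_⟩
    · rcases Nat.lt_or_ge i (k + 1) with hi' | hi'
      · obtain ⟨L', h6, h7, -⟩ := hrun i fun i' hi'' => hn1 i' (by omega)
        exact ⟨L', h6, h7⟩
      · obtain rfl : i = k + 1 := by omega
        rw [Function.iterate_succ_apply', h3]
        exact ⟨L, ⟨h1.1, h1.2, h1.3, h1.4⟩, h2⟩
    · rw [Function.iterate_succ_apply', h3]
      exact h4
    · rw [Function.iterate_succ_apply', h3]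
      exact h5

end LoopState

/-! ### Selection of the best full entry -/

namespace Entry

variable {N : AbstractNetwork} {d : ℕ} {tens : ∀ j : Fin N.size, ℕ → Tensor d (N.I j)}
  {count : Fin N.size → ℕ} {A : ℕ} {e e' : Entry} {f f' : Fin N.size → ℕ}

theorem Represents.total_val (h : e.Represents tens count A Finset.univ f)
    (σ : ℕ → Fin d × Fin d) : e.total.val =
      e.2.2.1 * N.contraction (AbstractNetwork.labelling tens f) Finset.univ σ := by
  have h1 : e.2.1 = [] := by
    have := h.index
    rwa [AbstractNetwork.boundary_univ, List.toFinset_eq_empty_iff] at this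
  rw [← h.value σ, total, GPair.val_sum, List.map_map, tableSum]
  congr 1
  refine List.map_congr_left fun p hp => ?_
  obtain ⟨τ, hτ⟩ := h.hasKeys p hp
  rw [h1] at hτ
  rw [if_pos (by rw [hτ, h1]; rfl)]
  rfl

/-- Squares of absolute values are compared, since these are rational; the denominators are cleared,
and negative parts are moved to the other side. -/
theorem Represents.le_iff (h : e.Represents tens count A Finset.univ f)
    (h' : e'.Represents tens count A Finset.univ f') (σ : ℕ → Fin d × Fin d) :
    e.Le e' = true ↔ ‖N.contraction (AbstractNetwork.labelling tens f) Finset.univ σ‖ ≤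
      ‖N.contraction (AbstractNetwork.labelling tens f') Finset.univ σ‖ := by
  have h1 := e.total.normSq_val
  have h2 := e'.total.normSq_val
  rw [h.total_val σ, Complex.normSq_mul, Complex.normSq_natCast, Complex.normSq_eq_norm_sq] at h1
  rw [h'.total_val σ, Complex.normSq_mul, Complex.normSq_natCast, Complex.normSq_eq_norm_sq] at h2
  have hD : (0 : ℝ) < e.2.2.1 := by exact_mod_cast h.den_pos
  have hD' : (0 : ℝ) < e'.2.2.1 := by exact_mod_cast h'.den_pos
  have hx := norm_nonneg (N.contraction (AbstractNetwork.labelling tens f) Finset.univ σ)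
  have hy := norm_nonneg (N.contraction (AbstractNetwork.labelling tens f') Finset.univ σ)
  generalize ‖N.contraction (AbstractNetwork.labelling tens f) Finset.univ σ‖ = x at *
  generalize ‖N.contraction (AbstractNetwork.labelling tens f') Finset.univ σ‖ = y at *
  have h3 : ((((normSq e'.total).1 * (e.2.2.1 * e.2.2.1) +
      (normSq e.total).2 * (e'.2.2.1 * e'.2.2.1) : ℕ) : ℝ)) -
      ((normSq e.total).1 * (e'.2.2.1 * e'.2.2.1) +
      (normSq e'.total).2 * (e.2.2.1 * e.2.2.1) : ℕ) =
      (e.2.2.1 * e.2.2.1) * (e'.2.2.1 * e'.2.2.1) * (y ^ 2 - x ^ 2) := by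
    push_cast
    linear_combination ((e'.2.2.1 : ℝ) * e'.2.2.1) * h1 - ((e.2.2.1 : ℝ) * e.2.2.1) * h2
  rw [Le, decide_eq_true_iff, ← Nat.cast_le (α := ℝ), ← sub_nonneg, h3,
    mul_nonneg_iff_of_pos_left (by positivity), sub_nonneg, pow_le_pow_iff_left₀ hx hy two_ne_zero]

theorem best_spec (le : Entry → Entry → Prop) (htrans : ∀ a b c, le a b → le b c → le a c)
    (l : List Entry) (hle : ∀ a ∈ l, ∀ b ∈ l, (a.Le b = true → le a b) ∧
      (a.Le b = false → le b a)) (hne : l ≠ []) :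
    ∃ e ∈ l, best l = some e ∧ ∀ a ∈ l, le a e := by
  have hfold : ∀ (l' : List Entry) (e : Entry), e ∈ l → (∀ a ∈ l', a ∈ l) →
      ∃ e' ∈ l, l'.foldl (fun o e => o.elim (some e) fun e' =>
        bif Le e' e then some e else some e') (some e) = some e' ∧ le e e' ∧ ∀ a ∈ l', le a e' := by
    intro l'
    induction l' with
    | nil =>
      intro e he _
      refine ⟨e, he, rfl, ?_, by simp⟩
      have := hle e he e he
      cases h : e.Le e
      · exact this.2 h
      · exact this.1 h
    | cons b l' ih =>
      intro e he hl'
      have hb := hl' b List.mem_cons_self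
      rw [List.foldl_cons, Option.elim_some]
      cases h : e.Le b
      · rw [cond_false]
        obtain ⟨e', he', h1, h2, h3⟩ := ih e he fun a ha => hl' a (List.mem_cons_of_mem _ ha)
        refine ⟨e', he', h1, h2, fun a ha => ?_⟩
        rcases List.mem_cons.1 ha with rfl | ha
        · exact htrans _ _ _ ((hle e he _ hb).2 h) h2
        · exact h3 a ha
      · rw [cond_true]
        obtain ⟨e', he', h1, h2, h3⟩ := ih b hb fun a ha => hl' a (List.mem_cons_of_mem _ ha)
        refine ⟨e', he', h1, htrans _ _ _ ((hle e he _ hb).1 h) h2, fun a ha => ?_⟩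
        rcases List.mem_cons.1 ha with rfl | ha
        · exact h2
        · exact h3 a ha
  rcases l with _ | ⟨a, l'⟩
  · exact absurd rfl hne
  · obtain ⟨e', he', h1, h2, h3⟩ := hfold l' a List.mem_cons_self
      fun b hb => List.mem_cons_of_mem _ hb
    refine ⟨e', he', h1, fun b hb => ?_⟩
    rcases List.mem_cons.1 hb with rfl | hb
    · exact h2
    · exact h3 b hb

end Entry

namespace LoopState

variable {N : AbstractNetwork} {d : ℕ} {tens : ∀ j : Fin N.size, ℕ → Tensor d (N.I j)}
  {count : Fin N.size → ℕ} {A M : ℕ} {E L : List Entry} {s : LoopState}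

/-- The result of the algorithm is almost optimal for the tensors on which it operates. -/
theorem Invariant.result_spec (hd : 0 < d) (hE : IsLeafList tens count A E)
    (h : Invariant tens count A M E L s) (hs : s.candidates.head? = none)
    (hfull : ∃ e ∈ s.2.2.2, e.Full = true) (hM : 0 < M) {B : ℝ}
    (hB : ∀ c, (∀ j, c j < count j) → ∀ S σ,
      ‖N.contraction (AbstractNetwork.labelling tens c) S σ‖ ≤ B) :
    ∃ f : Fin N.size → ℕ, (∀ j, f j < count j) ∧ s.result = List.ofFn f ∧
      ∀ c, (∀ j, c j < count j) → ∀ σ,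
        ‖N.contraction (AbstractNetwork.labelling tens c) Finset.univ σ‖ ≤
          ‖N.contraction (AbstractNetwork.labelling tens f) Finset.univ σ‖ +
            (N.size - 1) * (2 / M * B) := by
  obtain ⟨e₀, he₀, hf₀⟩ := hfull
  -- The full entry certifies that the set of all positions is mergeable for the present bound,
  -- which may be smaller than the one from the tree decomposition.
  obtain ⟨S₀, f₀, hR₀, hm₀⟩ := h.represents hE he₀
  rw [hR₀.full_iff] at hf₀
  subst hf₀
  have hrep : ∀ e ∈ s.2.2.2.filter fun e => e.Full,
      ∃ f, e.Represents tens count A Finset.univ f := by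
    intro e he
    obtain ⟨h1, h2⟩ := List.mem_filter.1 he
    obtain ⟨S, f, hR, -⟩ := h.represents hE h1
    rw [hR.full_iff] at h2
    exact ⟨f, h2 ▸ hR⟩
  choose! f hf using hrep
  let σ₀ : ℕ → Fin d × Fin d := fun _ => (⟨0, hd⟩, ⟨0, hd⟩)
  obtain ⟨e, he, hbest, hmax⟩ := Entry.best_spec (fun a b =>
    ‖N.contraction (AbstractNetwork.labelling tens (f a)) Finset.univ σ₀‖ ≤
      ‖N.contraction (AbstractNetwork.labelling tens (f b)) Finset.univ σ₀‖)
    (fun a b c => le_trans) (s.2.2.2.filter fun e => e.Full) (fun a ha b hb => by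
      have h1 := (hf a ha).le_iff (hf b hb) σ₀
      refine ⟨h1.1, fun h2 => le_of_lt (not_le.1 fun h3 => ?_)⟩
      rw [h1.2 h3] at h2
      exact absurd h2 (by decide))
    (List.ne_nil_of_mem (List.mem_filter.2 ⟨he₀, hR₀.full_iff.2 rfl⟩))
  refine ⟨f e, fun j => (hf e he).valid j (Finset.mem_univ j), ?_, fun c hc σ => ?_⟩
  · rw [result, hbest, Option.elim_some, (hf e he).choice, List.map_ofFn]
    congr 1
    funext j
    simp
  · have hσ : ∀ c, N.contraction (AbstractNetwork.labelling tens c) Finset.univ σ =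
        N.contraction (AbstractNetwork.labelling tens c) Finset.univ σ₀ := fun c =>
      AbstractNetwork.contraction_congr (fun _ _ => rfl) (by simp [AbstractNetwork.boundary_univ])
    obtain ⟨e', he', f', hR', hclose⟩ := h.exists_close hd hE hs hM hB hm₀ hc
    have he'' : e' ∈ s.2.2.2.filter fun e => e.Full :=
      List.mem_filter.2 ⟨he', hR'.full_iff.2 rfl⟩
    -- An entry may represent both `f'` and the chosen `f e'`. The comparison `Le` depends on the
    -- entry only and carries the inequality from one to the other.
    have h1 := (hR'.le_iff (hf e he) σ₀).1 (((hf e' he'').le_iff (hf e he) σ₀).2 (hmax e' he''))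
    have h2 := hclose σ₀
    have h3 := norm_le_norm_add_norm_sub' (N.contraction (AbstractNetwork.labelling tens c)
      Finset.univ σ₀) (N.contraction (AbstractNetwork.labelling tens f') Finset.univ σ₀)
    rw [Finset.card_univ, Fintype.card_fin] at h2
    rw [hσ, hσ]
    linarith

end LoopState

/-! ### Rounding of `1 / δ` and passage to the exact tensors -/

theorem RawInput.invDelta_spec {δ : ℚ} (h0 : 0 < δ) (h1 : δ < 1) :
    1 ≤ invDelta (RawRat.ofRat δ) * δ ∧ invDelta (RawRat.ofRat δ) * δ ≤ 2 := by
  have hnum : 0 < δ.num := Rat.num_pos.2 h0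
  obtain ⟨a, ha⟩ : ∃ a : ℕ, δ.num = a := ⟨δ.num.natAbs, (Int.natAbs_of_nonneg hnum.le).symm⟩
  have hden : (0 : ℚ) < δ.den := by exact_mod_cast δ.den_pos
  have hδ : δ = a / δ.den := by
    conv_lhs => rw [← Rat.num_div_den δ, ha]
    simp
  have hlt : a < δ.den := by
    rw [hδ, div_lt_one hden] at h1
    exact_mod_cast h1
  -- Either the doubling has stopped, since `n * a` has reached the denominator, or it took place in
  -- every round; in the latter case the binary length of the denominator gives enough rounds. A
  -- doubling happens only below the denominator, whence the upper bound.
  have hfold : ∀ (l : List Bool) (n : ℕ), n * a ≤ 2 * δ.den →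
      l.foldl (fun n _ => bif decide (n * a < δ.den) then 2 * n else n) n * a ≤ 2 * δ.den ∧
      (δ.den ≤ l.foldl (fun n _ => bif decide (n * a < δ.den) then 2 * n else n) n * a ∨
        l.foldl (fun n _ => bif decide (n * a < δ.den) then 2 * n else n) n =
          2 ^ l.length * n) := by
    intro l
    induction l with
    | nil => exact fun n hn => ⟨hn, Or.inr (by simp)⟩
    | cons b l ih =>
      intro n hn
      rw [List.foldl_cons]
      by_cases h : n * a < δ.den
      · rw [decide_eq_true h, cond_true]
        obtain ⟨h2, h3⟩ := ih (2 * n) (by rw [mul_assoc]; omega)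
        refine ⟨h2, h3.imp_right fun h3 => ?_⟩
        rw [h3, List.length_cons]
        ring
      · rw [decide_eq_false h, cond_false]
        obtain ⟨h2, h3⟩ := ih n hn
        refine ⟨h2, Or.inl (h3.elim id fun h3 => ?_)⟩
        rw [h3, mul_assoc]
        exact (not_lt.1 h).trans (Nat.le_mul_of_pos_left _ (Nat.two_pow_pos _))
  have ha' : δ.num.natAbs = a := by omega
  have h2 : invDelta (RawRat.ofRat δ) =
      δ.den.bits.foldl (fun n _ => bif decide (n * a < δ.den) then 2 * n else n) 1 := by
    rw [invDelta, RawRat.ofRat, ha']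
  obtain ⟨h3, h4⟩ := hfold δ.den.bits 1 (by omega)
  rw [← h2] at h3 h4
  have h5 : δ.den ≤ invDelta (RawRat.ofRat δ) * a := by
    refine h4.elim id fun h4 => ?_
    rw [h4, Nat.size_eq_bits_len, mul_one]
    have := Nat.lt_size_self δ.den
    have ha0 : 0 < a := by omega
    exact this.le.trans (Nat.le_mul_of_pos_right _ ha0)
  generalize invDelta (RawRat.ofRat δ) = D at *
  rw [hδ, ← mul_div_assoc, le_div_iff₀ hden, div_le_iff₀ hden, one_mul]
  exact ⟨by exact_mod_cast h5, by exact_mod_cast h3⟩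

namespace FeasibilityNetwork.Presentation

variable {d : ℕ} {F : FeasibilityNetwork d} {η : ℝ} (P : F.Presentation η)

theorem isLeafList (hd : 0 < d) (δ : ℚ) : LoopState.IsLeafList P.approx P.count
    (2 ^ sz (P.rawInput δ).leaves) (P.rawInput δ).leaves := by
  have h : ∀ (j : Fin F.net.size) (k : Fin (P.count j)),
      (Entry.leaf (d * d) ((F.net.I j).sort (· ≤ ·))
        (List.ofFn fun i => if i = j then some k.1 else none) (rawTable (P.table j k))) ∈
          (P.rawInput δ).leaves ∧
      (Entry.leaf (d * d) ((F.net.I j).sort (· ≤ ·))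
        (List.ofFn fun i => if i = j then some k.1 else none)
          (rawTable (P.table j k))).Represents P.approx P.count
        (2 ^ sz (P.rawInput δ).leaves) {j} fun _ => k := by
    intro j k
    have h1 := (P.mem_leaves_iff δ _).2 ⟨j, k, rfl⟩
    refine ⟨h1, .leaf hd k.2 (fun σ => ?_) rfl
      (Nat.pow_le_pow_right (by omega) (sz_lt_of_mem h1).le)⟩
    rw [approx, dif_pos k.2]
  constructor
  · intro e he
    obtain ⟨j, k, rfl⟩ := (P.mem_leaves_iff δ e).1 he
    exact ⟨j, _, (h j k).2⟩
  · intro j k hk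
    exact ⟨_, (h j ⟨k, hk⟩).1, _, (h j ⟨k, hk⟩).2, rfl⟩

theorem labelling_exact {c : Fin F.net.size → ℕ} (hc : ∀ j, c j < P.count j) :
    AbstractNetwork.labelling P.exact c = (P.initialization fun j => ⟨c j, hc j⟩).1 := by
  funext j
  rw [AbstractNetwork.labelling, exact, dif_pos (hc j)]
  rfl

theorem norm_exact_sub_approx_le {c : Fin F.net.size → ℕ} (hc : ∀ j, c j < P.count j)
    (j : Fin F.net.size) (τ : F.net.I j → Fin d × Fin d) :
    ‖AbstractNetwork.labelling P.exact c j τ - AbstractNetwork.labelling P.approx c j τ‖ ≤ η := by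
  rw [AbstractNetwork.labelling, AbstractNetwork.labelling, exact, dif_pos (hc j), approx,
    dif_pos (hc j)]
  exact P.close j _ τ

/-- An almost optimal choice for the approximate tensors is almost optimal for the exact ones. -/
theorem abs_val_sub_VAL_le (hd : 0 < d) (hN : F.net.IsConnected) (hF : F.IsNormalized)
    {Eη ε : ℝ} (hE : ∀ c, (∀ j, c j < P.count j) → ∀ S σ,
      ‖F.net.contraction (AbstractNetwork.labelling P.exact c) S σ -
        F.net.contraction (AbstractNetwork.labelling P.approx c) S σ‖ ≤ Eη)
    {f : Fin F.net.size → ℕ} (hf : ∀ j, f j < P.count j)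
    (hopt : ∀ c, (∀ j, c j < P.count j) → ∀ σ,
      ‖F.net.contraction (AbstractNetwork.labelling P.approx c) Finset.univ σ‖ ≤
        ‖F.net.contraction (AbstractNetwork.labelling P.approx f) Finset.univ σ‖ + ε) :
    |F.net.val (P.initialization fun j => ⟨f j, hf j⟩).1 - F.VAL| ≤ 2 * Eη + ε := by
  let σ : ℕ → Fin d × Fin d := fun _ => (⟨0, hd⟩, ⟨0, hd⟩)
  have h1 : ∀ lam : F.Initialization, F.net.val lam.1 ≤ 1 := fun lam => by
    rw [AbstractNetwork.val_eq_norm_contraction hd hN _ σ]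
    exact AbstractNetwork.norm_contraction_le_one (hF lam) _ _
  have h2 : F.net.val (P.initialization fun j => ⟨f j, hf j⟩).1 ≤ F.VAL :=
    le_ciSup (f := fun lam : F.Initialization => F.net.val lam.1)
      ⟨1, by rintro _ ⟨lam, rfl⟩; exact h1 lam⟩ _
  have : Nonempty F.Initialization := ⟨P.initialization fun j => ⟨f j, hf j⟩⟩
  -- An arbitrary choice is compared with `f` by way of the approximate tensors; the error `Eη` is
  -- paid once for each of the two choices.
  have h3 : F.VAL ≤ F.net.val (P.initialization fun j => ⟨f j, hf j⟩).1 + (2 * Eη + ε) := by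
    refine ciSup_le fun lam => ?_
    have h4 : ∀ j, ∃ k, P.tensor j k = lam.1 j := fun j => (P.mem_iff j _).1 (lam.2 j)
    choose c hc using h4
    have h5 : lam.1 = AbstractNetwork.labelling P.exact fun j => c j := by
      rw [P.labelling_exact fun j => (c j).2]
      funext j
      exact (hc j).symm
    rw [h5, ← P.labelling_exact hf, AbstractNetwork.val_eq_norm_contraction hd hN _ σ,
      AbstractNetwork.val_eq_norm_contraction hd hN _ σ]
    have h6 := hE (fun j => c j) (fun j => (c j).2) Finset.univ σ
    have h7 := hE f hf Finset.univ σ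
    have h8 := hopt (fun j => c j) (fun j => (c j).2) σ
    have h9 := norm_le_norm_add_norm_sub'
      (F.net.contraction (AbstractNetwork.labelling P.exact fun j => c j) Finset.univ σ)
      (F.net.contraction (AbstractNetwork.labelling P.approx fun j => c j) Finset.univ σ)
    have h10 := norm_le_norm_add_norm_sub
      (F.net.contraction (AbstractNetwork.labelling P.exact f) Finset.univ σ)
      (F.net.contraction (AbstractNetwork.labelling P.approx f) Finset.univ σ)
    linarith
  rw [abs_le]
  constructor <;> linarith

theorem start_rawInput (δ : ℚ) : (P.rawInput δ).start =
    (true, 64 * F.net.size * RawInput.invDelta (RawRat.ofRat δ), 0, (P.rawInput δ).leaves) := by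
  simp [RawInput.start, rawInput]

theorem sz_le_sz_rawInput (δ : ℚ) : sz d ≤ sz (P.rawInput δ) ∧ F.net.size ≤ sz (P.rawInput δ) ∧
    (∀ j, P.count j ≤ sz (P.rawInput δ)) ∧ ∀ i ∈ F.net.indices, sz i ≤ sz (P.rawInput δ) := by
  set l := List.ofFn fun j => ((F.net.I j).sort (· ≤ ·),
    List.ofFn fun k => rawTable (P.table j k)) with hl
  have h0 : sz (P.rawInput δ) = sz d + (sz (RawRat.ofRat δ) + sz l + 1) + 1 := rfl
  have h1 := length_lt_sz l
  rw [hl, List.length_ofFn, ← hl] at h1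
  have h2 : ∀ j, sz ((F.net.I j).sort (· ≤ ·)) +
      sz (List.ofFn fun k => rawTable (P.table j k)) + 1 < sz l := fun j =>
    sz_lt_of_mem (a := ((F.net.I j).sort (· ≤ ·), List.ofFn fun k => rawTable (P.table j k)))
      (List.mem_ofFn.2 ⟨j, rfl⟩)
  refine ⟨by omega, by omega, fun j => ?_, fun i hi => ?_⟩
  · have h3 := length_lt_sz (List.ofFn fun k => rawTable (P.table j k))
    rw [List.length_ofFn] at h3
    have := h2 j
    omega
  · obtain ⟨j, hj⟩ := AbstractNetwork.mem_indices.1 hi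
    have h3 := sz_lt_of_mem ((Finset.mem_sort (· ≤ ·)).2 hj)
    have := h2 j
    omega

end FeasibilityNetwork.Presentation

/-- The analysis of the algorithm, in terms of bounds for the error of the approximation, the number
of indices of the tensors that are needed, and the number of entries found. -/
theorem exists_algorithm : ∃ (A : Program) (k : ℕ), ∀ (d : ℕ) (F : FeasibilityNetwork d) (δ : ℚ)
    (η Eη : ℝ) (P : F.Presentation η) (r p : ℕ), 0 < d → F.net.IsConnected →
      (∀ j, (F.tensors j).Nonempty) → F.IsNormalized → 0 < δ → δ < 1 →
      (∀ c, (∀ j, c j < P.count j) → ∀ S σ,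
        ‖F.net.contraction (AbstractNetwork.labelling P.exact c) S σ -
          F.net.contraction (AbstractNetwork.labelling P.approx c) S σ‖ ≤ Eη) → Eη ≤ 1 →
      F.net.Mergeable r Finset.univ →
      (2 ≤ F.net.size → (F.net.indices.card + 1) ^ r * (2 * ((2 * (2 * (64 * F.net.size *
        RawInput.invDelta (RawRat.ofRat δ)) * (d * d) ^ r) + 1) ^ 2) ^ (d * d) ^ r) ≤ p) →
      2 * Eη + (F.net.size - 1) * (2 / (64 * F.net.size * RawInput.invDelta (RawRat.ofRat δ) : ℕ) *
        (1 + Eη)) ≤ δ →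
      ∃ (c : ∀ j, Fin (P.count j)) (n : ℕ), A.Runs (P.input δ) (P.output c) n ∧
        n ≤ ((P.input δ).size ^ k * ((p + 1) * ((r + 1) * (d * d) ^ r)) ^ 2) ^ k ∧
        |F.net.val (P.initialization c).1 - F.VAL| ≤ δ := by
  obtain ⟨A, k, hA⟩ := PolyTime.exists_loop PolyTime.start PolyTime.step PolyTime.result
  obtain ⟨k', hk'⟩ := PolyTime.start.size
  refine ⟨A, k + (4 * k' + 22), fun d F δ η Eη P r p hd hN hne hF h0 h1 hE hE1 hr hp herr => ?_⟩
  set x := P.rawInput δ with hx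
  set M := 64 * F.net.size * RawInput.invDelta (RawRat.ofRat δ) with hM
  obtain ⟨hsd, hsm, hsc, hsi⟩ := P.sz_le_sz_rawInput δ
  rw [← hx] at hsd hsm hsc hsi
  have hm : 0 < F.net.size := by
    obtain ⟨a⟩ := hN.nonempty
    exact a.1.pos
  have hM0 : 0 < M := by
    have h2 := (RawInput.invDelta_spec h0 h1).1
    have : 0 < RawInput.invDelta (RawRat.ofRat δ) := by
      apply Nat.pos_of_ne_zero
      intro h3
      rw [h3] at h2
      norm_num at h2
    positivity
  have hcount : ∀ j, 0 < P.count j := fun j => by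
    obtain ⟨g, hg⟩ := hne j
    obtain ⟨i, -⟩ := (P.mem_iff j g).1 hg
    exact i.pos
  have hleaf := P.isLeafList hd δ
  rw [← hx] at hleaf
  have hB : ∀ c, (∀ j, c j < P.count j) → ∀ S σ,
      ‖F.net.contraction (AbstractNetwork.labelling P.approx c) S σ‖ ≤ 1 + Eη := by
    intro c hc S σ
    have h2 := hE c hc S σ
    have h3 : ‖F.net.contraction (AbstractNetwork.labelling P.exact c) S σ‖ ≤ 1 := by
      rw [P.labelling_exact hc]
      exact AbstractNetwork.norm_contraction_le_one (hF _) S σ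
    have h4 := norm_le_norm_add_norm_sub
      (F.net.contraction (AbstractNetwork.labelling P.exact c) S σ)
      (F.net.contraction (AbstractNetwork.labelling P.approx c) S σ)
    linarith
  have hP : ∀ L s, LoopState.Invariant P.approx P.count (2 ^ sz x.leaves) M x.leaves L s →
      s.2.2.1 ≤ r → L.length ≤ p := by
    intro L s h hs
    -- A merged entry involves at least two positions. If there is only one position, then the list
    -- is empty and nothing is demanded of `p`.
    rcases L with _ | ⟨e, L⟩
    · exact Nat.zero_le _
    obtain ⟨S, f, -, -, -, h2⟩ := h.merged e List.mem_cons_self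
    have h3 : 2 ≤ F.net.size := by
      have := Finset.card_le_univ S
      rw [Fintype.card_fin] at this
      omega
    refine (h.length_le hN hd fun e he S f hR σ => ?_).trans (le_trans ?_ (hp h3))
    -- Outside `S` the represented choice is arbitrary. The position `0`, which exists because all
    -- lists are nonempty, makes it valid without a change of the contraction on `S`.
    · have h4 : F.net.contraction (AbstractNetwork.labelling P.approx f) S σ =
          F.net.contraction (AbstractNetwork.labelling P.approx (S.piecewise f fun _ => 0)) S σ :=
        AbstractNetwork.contraction_congr (fun j hj => by
          simp only [AbstractNetwork.labelling, Finset.piecewise_eq_of_mem _ _ _ hj])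
          fun _ _ => rfl
      rw [h4]
      refine (hB _ (fun j => ?_) S σ).trans (by linarith)
      by_cases hj : j ∈ S
      · rw [Finset.piecewise_eq_of_mem _ _ _ hj]
        exact hR.valid j hj
      · rw [Finset.piecewise_eq_of_notMem _ _ _ hj]
        exact hcount j
    · have h5 : (d * d) ^ s.2.2.1 ≤ (d * d) ^ r := Nat.pow_le_pow_right (by positivity) hs
      gcongr
      · omega
      · exact Nat.one_le_pow _ _ (by omega)
  obtain ⟨n, hn, hrun, hhalt, hinv, hcand, hfull⟩ :=
    LoopState.exists_halt hd hleaf hM0 hcount hB hr hP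
  rw [hM, ← P.start_rawInput δ, ← hx] at hrun hhalt hinv hcand hfull
  obtain ⟨L, hL, -⟩ := hinv n le_rfl
  obtain ⟨f, hf, hres, hopt⟩ := hL.result_spec hd hleaf hcand hfull hM0 hB
  -- Bounds the size of the initial state and that of the input at the same time.
  set W := (sz x + 1) ^ k' + sz x with hW
  have hst : sz (P.rawInput δ).start ≤ (sz x + 1) ^ k' := hk' x
  rw [P.start_rawInput δ] at hst
  have hsz : ∀ i ≤ n, sz (LoopState.step^[i] x.start) ≤
      120 * ((p + 1) * ((r + 1) * (d * d) ^ r * W ^ 2)) := by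
    intro i hi
    obtain ⟨L', hL', hr'⟩ := hinv i hi
    have e1 : sz ((true, 64 * F.net.size * RawInput.invDelta (RawRat.ofRat δ), 0,
      (P.rawInput δ).leaves) : LoopState) = sz true + (sz M + (sz 0 + sz x.leaves + 1) + 1) + 1 :=
      rfl
    have e2 := sz_pos x
    exact hL'.sz_le hd (by omega) (by omega) (by omega)
      (fun j => (hsc j).trans (Nat.le_add_left _ _))
      (fun j hj => (hsi j hj).trans (Nat.le_add_left _ _)) (by omega) (by omega)
      (by rw [← hM]; omega) hr'
      (hP _ _ hL' hr')
  obtain ⟨t, ht, hAt⟩ := hA x n _ hrun hhalt hsz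
  rw [hres, P.enc_rawInput] at hAt
  refine ⟨fun j => ⟨f j, hf j⟩, t, ?_, ?_, ?_⟩
  · have : enc (List.ofFn f) = P.output fun j => ⟨f j, hf j⟩ := by
      change Data.ofList (List.map enc _) = _
      rw [List.map_ofFn]
      rfl
    rwa [this] at hAt
  · have hl : (P.input δ).size = sz x := by rw [← P.enc_rawInput]; rfl
    have hl2 : 2 ≤ sz x := by
      have e1 : sz x = sz d + (sz x.2) + 1 := rfl
      have := sz_pos d
      omega
    rw [hl]
    generalize sz x = l at *
    have h6 : 1 ≤ (d * d) ^ r := Nat.one_le_pow _ _ (by positivity)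
    have h7 : l + 1 ≤ l ^ 2 := by nlinarith
    have h8 : W ≤ l ^ (2 * k' + 2) := by
      have e1 : (l + 1) ^ k' ≤ l ^ (2 * k') := by
        rw [pow_mul]
        exact Nat.pow_le_pow_left h7 _
      have e2 : 1 ≤ l ^ (2 * k') := Nat.one_le_pow _ _ (by omega)
      rw [pow_add]
      nlinarith
    have h9 : 1 ≤ W ^ 2 := by
      have : 0 < W := by omega
      exact Nat.one_le_pow _ _ this
    -- Number of rounds and size of the states are both linear in `Y`, which accounts for the square
    -- in the final bound; the remaining factors are powers of the size of the input.
    set Y := (p + 1) * ((r + 1) * (d * d) ^ r) with hY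
    have h10 : n + 1 ≤ 2 * Y := by
      have e1 : (p + 1) * (r + 1) ≤ Y := by
        rw [hY, ← mul_assoc]
        exact Nat.le_mul_of_pos_right _ h6
      nlinarith
    have h11 : 120 * ((p + 1) * ((r + 1) * (d * d) ^ r * W ^ 2)) + 1 ≤ 121 * (Y * W ^ 2) := by
      have e1 : (p + 1) * ((r + 1) * (d * d) ^ r * W ^ 2) = Y * W ^ 2 := by rw [hY]; ring
      have e2 : 1 ≤ Y * W ^ 2 := Nat.mul_pos (by positivity) h9
      omega
    have h12 : (l + 1) * ((n + 1) * (120 * ((p + 1) * ((r + 1) * (d * d) ^ r * W ^ 2)) + 1)) ≤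
        l ^ (k + (4 * k' + 22)) * Y ^ 2 := by
      have e1 : W ^ 2 ≤ l ^ (4 * k' + 4) := by
        refine (Nat.pow_le_pow_left h8 2).trans (le_of_eq ?_)
        rw [← pow_mul]
        congr 1
        ring
      calc (l + 1) * ((n + 1) * (120 * ((p + 1) * ((r + 1) * (d * d) ^ r * W ^ 2)) + 1))
          ≤ l ^ 2 * (2 * Y * (121 * (Y * l ^ (4 * k' + 4)))) := by
            refine Nat.mul_le_mul h7 (Nat.mul_le_mul h10 (h11.trans ?_))
            gcongr
        _ = 242 * (l ^ (4 * k' + 6) * Y ^ 2) := by ring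
        _ ≤ l ^ 8 * (l ^ (4 * k' + 6) * Y ^ 2) := by
            refine Nat.mul_le_mul_right _ ?_
            calc 242 ≤ 2 ^ 8 := by norm_num
              _ ≤ l ^ 8 := Nat.pow_le_pow_left hl2 8
        _ = l ^ (4 * k' + 14) * Y ^ 2 := by ring
        _ ≤ l ^ (k + (4 * k' + 22)) * Y ^ 2 :=
            Nat.mul_le_mul_right _ (Nat.pow_le_pow_right (by omega) (by omega))
    refine ht.trans ((Nat.pow_le_pow_left h12 k).trans (Nat.pow_le_pow_right ?_ (by omega)))
    positivity
  · exact (P.abs_val_sub_VAL_le hd hN hF hE hf hopt).trans herr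

/-! ### Numerical estimates -/

/-- The exponents in the theorem are natural numbers, so that real powers can be replaced by
ordinary ones. -/
theorem exp_mul_log_eq_pow {d : ℕ} (hd : 2 ≤ d) (C Δ t : ℕ) :
    Real.exp (C * (Δ * t * Real.log d)) = ((d ^ (C * (Δ * t)) : ℕ) : ℝ) := by
  have hd' : (0 : ℝ) < d := by
    have : 0 < d := by omega
    exact_mod_cast this
  rw [show (C * (Δ * t * Real.log d) : ℝ) = ((C * (Δ * t) : ℕ) : ℝ) * Real.log d by push_cast; ring,
    Real.exp_nat_mul, Real.exp_log hd']
  push_cast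
  rfl

theorem one_add_pow_sub_one_le {m : ℕ} {y : ℝ} (hy : 0 ≤ y) (hmy : m * y ≤ 1) :
    (1 + y) ^ m - 1 ≤ 2 * (m * y) := by
  have h1 : (1 + y) ^ m ≤ Real.exp (m * y) := by
    rw [Real.exp_nat_mul]
    have := Real.add_one_le_exp y
    exact pow_le_pow_left₀ (by linarith) (by linarith) m
  have h0 : 0 ≤ m * y := by positivity
  have h2 := Real.abs_exp_sub_one_le (x := m * y) (by rwa [abs_of_nonneg h0])
  rw [abs_of_nonneg h0] at h2
  have h3 := le_abs_self (Real.exp (m * y) - 1)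
  linarith

/-- The number `Q` of rows of a table is the scale for all estimates. The last bound uses `t + 1 ≤ 2
* t`, hence `1 ≤ t`. -/
theorem pow_index_bounds {d Δ t : ℕ} (hd : 2 ≤ d) (hΔ : 1 ≤ Δ) (ht : 1 ≤ t) :
    Δ * (t + 1) + 1 ≤ (d * d) ^ (Δ * (t + 1)) ∧ 4 ≤ (d * d) ^ (Δ * (t + 1)) ∧
      (d * d) ^ (Δ * (t + 1)) ≤ d ^ (4 * (Δ * t)) := by
  have h1 : 4 ≤ d * d := by nlinarith
  have h2 : 1 ≤ Δ * (t + 1) := Nat.mul_pos hΔ (by omega)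
  refine ⟨?_, ?_, ?_⟩
  · exact Nat.lt_pow_self (by omega)
  · calc 4 ≤ d * d := h1
      _ = (d * d) ^ 1 := (pow_one _).symm
      _ ≤ _ := Nat.pow_le_pow_right (by omega) h2
  · rw [← sq, ← pow_mul]
    refine Nat.pow_le_pow_right (by omega) ?_
    nlinarith

/-- Put `e = δ / (2 * m) ≤ 1 / 4`. The exponent is at least `Q + 3`, where `5 ≤ C` is used: the
power `e ^ Q` absorbs the factor `(d * d) ^ Δ ≤ Q`, and `m * e ^ 3 ≤ δ / 32` remains. -/
theorem approximation_error_le {d Δ t m C : ℕ} {δ : ℝ} (hd : 2 ≤ d) (hΔ : 1 ≤ Δ) (ht : 1 ≤ t)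
    (hm : 2 ≤ m) (h0 : 0 < δ) (h1 : δ < 1) (hC : 5 ≤ C) :
    (1 + ((d * d : ℕ) : ℝ) ^ Δ * (δ / (2 * m)) ^ (d ^ (C * (Δ * t)))) ^ m - 1 ≤ δ / 16 := by
  obtain ⟨-, hQ4, hQ⟩ := pow_index_bounds hd hΔ ht
  set Q := (d * d) ^ (Δ * (t + 1)) with hQd
  have hm' : (2 : ℝ) ≤ m := by exact_mod_cast hm
  set e := δ / (2 * m) with he
  have he0 : 0 < e := by positivity
  have he1 : e ≤ 1 / 4 := by
    rw [he, div_le_iff₀ (by positivity)]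
    linarith
  have hK : Q + 3 ≤ d ^ (C * (Δ * t)) := by
    have : 1 ≤ Δ * t := Nat.mul_pos hΔ ht
    calc Q + 3 ≤ 2 * Q := by omega
      _ ≤ d * d ^ (4 * (Δ * t)) := Nat.mul_le_mul hd hQ
      _ = d ^ (4 * (Δ * t) + 1) := by ring
      _ ≤ d ^ (C * (Δ * t)) := Nat.pow_le_pow_right (by omega) (by nlinarith)
  have h2 : ((d * d : ℕ) : ℝ) ^ Δ ≤ Q := by
    rw [hQd, ← Nat.cast_pow, Nat.cast_le]
    exact Nat.pow_le_pow_right (by positivity) (by nlinarith)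
  have h3 : (Q : ℝ) * e ^ Q ≤ 1 := by
    have e1 : (Q : ℝ) ≤ 2 ^ Q := by exact_mod_cast Nat.lt_two_pow_self.le
    calc (Q : ℝ) * e ^ Q ≤ 2 ^ Q * e ^ Q := by gcongr
      _ = (2 * e) ^ Q := (mul_pow _ _ _).symm
      _ ≤ 1 := pow_le_one₀ (by positivity) (by linarith)
  have h4 : ((d * d : ℕ) : ℝ) ^ Δ * e ^ (d ^ (C * (Δ * t))) ≤ e ^ 3 := by
    calc ((d * d : ℕ) : ℝ) ^ Δ * e ^ (d ^ (C * (Δ * t))) ≤ Q * e ^ (Q + 3) := by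
          refine mul_le_mul h2 (pow_le_pow_of_le_one he0.le (by linarith) hK) (by positivity)
            (Nat.cast_nonneg _)
      _ = Q * e ^ Q * e ^ 3 := by ring
      _ ≤ 1 * e ^ 3 := by gcongr
      _ = e ^ 3 := one_mul _
  have h5 : (m : ℝ) * e = δ / 2 := by
    rw [he]
    field_simp
  have h6 : (m : ℝ) * (((d * d : ℕ) : ℝ) ^ Δ * e ^ (d ^ (C * (Δ * t)))) ≤ δ / 32 := by
    calc (m : ℝ) * (((d * d : ℕ) : ℝ) ^ Δ * e ^ (d ^ (C * (Δ * t)))) ≤ m * e ^ 3 := by gcongr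
      _ = δ / 2 * e ^ 2 := by rw [← h5]; ring
      _ ≤ δ / 2 * (1 / 4) ^ 2 := by gcongr
      _ = δ / 32 := by ring
  have h7 := one_add_pow_sub_one_le (m := m)
    (y := ((d * d : ℕ) : ℝ) ^ Δ * e ^ (d ^ (C * (Δ * t)))) (by positivity) (by linarith)
  linarith

/-- All quantities are bounded by powers of `x = m / δ ≥ 2` with exponents polynomial in `Q`. The
rounded tables dominate with the exponent `2 * Q * (Q + 11)`. The total exponent is at most `Q ^ (k
+ 6)`, which is a power of `d ^ (Δ * t)` with an exponent linear in `k`. -/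
theorem running_time_le {d Δ t m I D k C : ℕ} {δ : ℝ} (hd : 2 ≤ d) (hΔ : 1 ≤ Δ) (ht : 1 ≤ t)
    (hm : 2 ≤ m) (h0 : 0 < δ) (h1 : δ < 1) (hI : I ≤ m * Δ) (hD : D * δ ≤ 2)
    (hC : 4 * (k + 12) ≤ C) :
    ((((((I + 1) ^ (Δ * (t + 1)) * (2 * ((2 * (2 * (64 * m * D) * (d * d) ^ (Δ * (t + 1))) + 1) ^ 2)
      ^ (d * d) ^ (Δ * (t + 1))) + 1) * ((Δ * (t + 1) + 1) * (d * d) ^ (Δ * (t + 1)))) ^ (2 * (2 * k))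
      : ℕ)) : ℝ) ≤ (m / δ) ^ (d ^ (C * (Δ * t))) := by
  obtain ⟨hr, hQ4, hQ⟩ := pow_index_bounds hd hΔ ht
  set r := Δ * (t + 1) with hrd
  set Q := (d * d) ^ r with hQd
  have hm' : (2 : ℝ) ≤ m := by exact_mod_cast hm
  set x := m / δ with hx
  have hxm : (m : ℝ) ≤ x := by
    rw [hx, le_div_iff₀ h0]
    nlinarith
  have hx2 : 2 ≤ x := hm'.trans hxm
  have hx1 : 1 ≤ x := by linarith
  have hpow : ∀ a : ℕ, (2 : ℝ) ^ a ≤ x ^ a := fun a => pow_le_pow_left₀ (by norm_num) hx2 a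
  have hQx : (Q : ℝ) ≤ x ^ Q := by
    have e1 : (Q : ℝ) ≤ 2 ^ Q := by exact_mod_cast Nat.lt_two_pow_self.le
    exact e1.trans (hpow Q)
  have hQ1 : (1 : ℝ) ≤ Q := by
    have : 1 ≤ Q := by omega
    exact_mod_cast this
  have hΔQ : (Δ : ℝ) ≤ Q := by
    have : Δ ≤ Q := by nlinarith
    exact_mod_cast this
  have hrQ : (r : ℝ) + 1 ≤ Q := by exact_mod_cast hr
  have h2 : (I : ℝ) + 1 ≤ x ^ (Q + 2) := by
    have e1 : (I : ℝ) ≤ m * Δ := by exact_mod_cast hI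
    calc (I : ℝ) + 1 ≤ x * Q + x * Q := by
          have e2 : (m : ℝ) * Δ ≤ x * Q := mul_le_mul hxm hΔQ (Nat.cast_nonneg _) (by linarith)
          have e3 : 1 ≤ x * Q := one_le_mul_of_one_le_of_one_le hx1 hQ1
          linarith
      _ = 2 * x * Q := by ring
      _ ≤ x * x * x ^ Q := by gcongr
      _ = x ^ (Q + 2) := by ring
  have h3 : ((I : ℝ) + 1) ^ r ≤ x ^ ((Q + 2) * Q) := by
    calc ((I : ℝ) + 1) ^ r ≤ (x ^ (Q + 2)) ^ r := by gcongr
      _ = x ^ ((Q + 2) * r) := (pow_mul _ _ _).symm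
      _ ≤ x ^ ((Q + 2) * Q) := pow_le_pow_right₀ hx1 (Nat.mul_le_mul_left _ (by omega))
  have h4 : (2 * (2 * (64 * m * D) * Q) + 1 : ℝ) ≤ x ^ (Q + 11) := by
    have e1 : (m : ℝ) * D ≤ 2 * x := by
      rw [hx, ← mul_div_assoc, le_div_iff₀ h0]
      nlinarith
    calc (2 * (2 * (64 * m * D) * Q) + 1 : ℝ) = 256 * (m * D * Q) + 1 := by ring
      _ ≤ 256 * (2 * x * Q) + x * Q := by
          have e3 : 1 ≤ x * Q := one_le_mul_of_one_le_of_one_le hx1 hQ1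
          gcongr
      _ ≤ 2 ^ 10 * x * Q := by
          have e3 : 1 ≤ x * Q := one_le_mul_of_one_le_of_one_le hx1 hQ1
          nlinarith
      _ ≤ x ^ 10 * x * x ^ Q := by
          have := hpow 10
          gcongr
      _ = x ^ (Q + 11) := by ring
  have h5 : ((I : ℝ) + 1) ^ r * (2 * ((2 * (2 * (64 * m * D) * Q) + 1) ^ 2) ^ Q) + 1 ≤
      x ^ (3 * Q ^ 2 + 24 * Q + 2) := by
    calc ((I : ℝ) + 1) ^ r * (2 * ((2 * (2 * (64 * m * D) * Q) + 1) ^ 2) ^ Q) + 1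
        ≤ x ^ ((Q + 2) * Q) * (x * ((x ^ (Q + 11)) ^ 2) ^ Q) + 1 := by gcongr
      _ = x ^ (3 * Q ^ 2 + 24 * Q + 1) + 1 := by
          congr 1
          rw [← pow_mul, ← pow_mul]
          ring
      _ ≤ x ^ (3 * Q ^ 2 + 24 * Q + 1) + x ^ (3 * Q ^ 2 + 24 * Q + 1) := by
          gcongr
          exact one_le_pow₀ hx1
      _ = 2 * x ^ (3 * Q ^ 2 + 24 * Q + 1) := by ring
      _ ≤ x * x ^ (3 * Q ^ 2 + 24 * Q + 1) := by gcongr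
      _ = x ^ (3 * Q ^ 2 + 24 * Q + 2) := by ring
  have h6 : (((r : ℝ) + 1) * Q) ≤ x ^ (2 * Q) := by
    calc ((r : ℝ) + 1) * Q ≤ x ^ Q * x ^ Q := by
          have := hrQ.trans hQx
          gcongr
      _ = x ^ (2 * Q) := by ring
  have h7 : (3 * Q ^ 2 + 26 * Q + 2) * (2 * (2 * k)) ≤ d ^ (C * (Δ * t)) := by
    have e1 : 3 * Q ^ 2 + 26 * Q + 2 ≤ Q ^ 5 := by
      have : 4 ^ 3 ≤ Q ^ 3 := Nat.pow_le_pow_left hQ4 3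
      calc 3 * Q ^ 2 + 26 * Q + 2 ≤ 4 ^ 3 * Q ^ 2 := by nlinarith
        _ ≤ Q ^ 3 * Q ^ 2 := Nat.mul_le_mul_right _ this
        _ = Q ^ 5 := by ring
    have e2 : 2 * (2 * k) ≤ Q ^ (k + 1) := by
      have := (Nat.lt_pow_self (n := k) (by omega : 1 < Q)).le
      rw [pow_succ]
      nlinarith
    calc (3 * Q ^ 2 + 26 * Q + 2) * (2 * (2 * k)) ≤ Q ^ 5 * Q ^ (k + 1) := Nat.mul_le_mul e1 e2
      _ = Q ^ (k + 6) := by ring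
      _ ≤ (d ^ (4 * (Δ * t))) ^ (k + 6) := Nat.pow_le_pow_left hQ _
      _ = d ^ (4 * (Δ * t) * (k + 6)) := (pow_mul _ _ _).symm
      _ ≤ d ^ (C * (Δ * t)) := by
          refine Nat.pow_le_pow_right (by omega) ?_
          calc 4 * (Δ * t) * (k + 6) = 4 * (k + 6) * (Δ * t) := by ring
            _ ≤ C * (Δ * t) := Nat.mul_le_mul_right _ (by omega)
  push_cast
  calc _ ≤ (x ^ (3 * Q ^ 2 + 24 * Q + 2) * x ^ (2 * Q)) ^ (2 * (2 * k)) := by gcongr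
    _ = x ^ ((3 * Q ^ 2 + 26 * Q + 2) * (2 * (2 * k))) := by
        rw [← pow_add, ← pow_mul]
        congr 1
        ring
    _ ≤ x ^ (d ^ (C * (Δ * t))) := pow_le_pow_right₀ hx1 h7

/-! ### The main theorem -/

theorem mainTheorem2 :
    ∃ (A : Program) (C : ℕ), ∀ (d : ℕ) (F : FeasibilityNetwork d) (t Δ : ℕ) (δ : ℚ),
      2 ≤ d → F.net.IsConnected → (∀ j, (F.tensors j).Nonempty) → F.IsNormalized →
      F.net.graph.treeWidth = t → F.net.graph.maximumDegree = Δ → 0 < δ → δ < 1 →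
      ∀ P : F.Presentation
          (((δ : ℝ) / (2 * F.net.size)) ^ Real.exp (C * (Δ * t * Real.log d))),
        ∃ (c : ∀ j, Fin (P.count j)) (n : ℕ),
          A.Runs (P.input δ) (P.output c) n ∧
          (n : ℝ) ≤ ((F.net.size : ℝ) / δ) ^ Real.exp (C * (Δ * t * Real.log d)) +
            ((P.input δ).size : ℝ) ^ C ∧
          |F.net.val (P.initialization c).1 - F.VAL| ≤ δ := by
  obtain ⟨A, k, hA⟩ := exists_algorithm
  -- The first summand serves `running_time_le`, the second one is the exponent of the size of the
  -- input in `hsplit`.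
  refine ⟨A, 4 * (k + 12) + 2 * (k * k), ?_⟩
  intro d F t Δ δ hd hN hne hF rfl rfl h0 h1
  set C := 4 * (k + 12) + 2 * (k * k) with hC
  set t := F.net.graph.treeWidth with ht
  set Δ := F.net.graph.maximumDegree with hΔ
  rw [exp_mul_log_eq_pow hd, Real.rpow_natCast]
  intro P
  rw [Real.rpow_natCast]
  have hd0 : 0 < d := by omega
  have hm : 0 < F.net.size := by
    obtain ⟨a⟩ := hN.nonempty
    exact a.1.pos
  have hm' : (0 : ℝ) < F.net.size := by exact_mod_cast hm
  have h0' : (0 : ℝ) < δ := by exact_mod_cast h0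
  have h1' : (δ : ℝ) < 1 := by exact_mod_cast h1
  obtain ⟨hD1, hD2⟩ := RawInput.invDelta_spec h0 h1
  have hη : 0 ≤ ((δ : ℝ) / (2 * F.net.size)) ^ d ^ (C * (Δ * t)) := by positivity
  have hmerge : ∀ Δ', (∀ j, (F.net.I j).card ≤ Δ') →
      F.net.Mergeable (Δ' * (t + 1)) Finset.univ := fun Δ' h =>
    AbstractNetwork.mergeable_univ AbstractNetwork.hasTreeDecomposition_treeWidth h hm
  have hclose : ∀ Δ', (∀ j, (F.net.I j).card ≤ Δ') → ∀ c, (∀ j, c j < P.count j) → ∀ S σ,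
      ‖F.net.contraction (AbstractNetwork.labelling P.exact c) S σ -
        F.net.contraction (AbstractNetwork.labelling P.approx c) S σ‖ ≤
      (1 + ((d * d : ℕ) : ℝ) ^ Δ' * ((δ : ℝ) / (2 * F.net.size)) ^ d ^ (C * (Δ * t))) ^
        F.net.size - 1 := by
    intro Δ' hΔ' c hc S σ
    refine AbstractNetwork.norm_contraction_sub_le_of_close hd0 (fun S σ => ?_) hΔ'
      (P.norm_exact_sub_approx_le hc) hη S σ
    rw [P.labelling_exact hc]
    exact AbstractNetwork.norm_contraction_le_one (hF _) S σ
  have hl : 1 ≤ (P.input δ).size := by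
    rw [← P.enc_rawInput]
    exact sz_pos _
  -- The time bound is a product of a power of the input size and a power of `Y`. It becomes a sum
  -- by `a * b ≤ a ^ 2 + b ^ 2`, at the price of doubled exponents.
  have hsplit : ∀ Y n : ℕ, n ≤ ((P.input δ).size ^ k * Y ^ 2) ^ k →
      (n : ℝ) ≤ ((Y ^ (2 * (2 * k)) : ℕ) : ℝ) + ((P.input δ).size : ℝ) ^ C := by
    intro Y n hn
    have e1 : ((P.input δ).size ^ k * Y ^ 2) ^ k ≤
        Y ^ (2 * (2 * k)) + (P.input δ).size ^ (2 * (k * k)) := by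
      have e2 : ((P.input δ).size ^ k * Y ^ 2) ^ k =
          (P.input δ).size ^ (k * k) * Y ^ (2 * k) := by
        rw [mul_pow, ← pow_mul, ← pow_mul]
      have e3 : Y ^ (2 * (2 * k)) = Y ^ (2 * k) * Y ^ (2 * k) := by ring
      have e4 : (P.input δ).size ^ (2 * (k * k)) =
          (P.input δ).size ^ (k * k) * (P.input δ).size ^ (k * k) := by ring
      rw [e2, e3, e4]
      generalize (P.input δ).size ^ (k * k) = a
      generalize Y ^ (2 * k) = b
      rcases le_total a b with h | h <;> nlinarith
    have e5 : (P.input δ).size ^ (2 * (k * k)) ≤ (P.input δ).size ^ C :=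
      Nat.pow_le_pow_right hl (by omega)
    exact_mod_cast hn.trans (e1.trans (Nat.add_le_add_left e5 _))
  rcases Nat.lt_or_ge F.net.size 2 with hm2 | hm2
  -- A single position has no indices, and nothing is merged. The whole tolerance `δ` is left for
  -- the two comparisons of exact and approximate values, `δ / 2` for each.
  · have hm1 : F.net.size = 1 := by omega
    have hI : ∀ j, (F.net.I j).card ≤ 0 := by
      intro j
      rw [Nat.le_zero, Finset.card_eq_zero, Finset.eq_empty_iff_forall_notMem]
      intro i hi
      have e1 := F.net.two j i hi
      have e2 := Finset.card_le_univ (Finset.univ.filter fun k => i ∈ F.net.I k)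
      rw [e1, Fintype.card_fin] at e2
      omega
    have hE : (1 + ((d * d : ℕ) : ℝ) ^ 0 *
        ((δ : ℝ) / (2 * F.net.size)) ^ d ^ (C * (Δ * t))) ^ F.net.size - 1 ≤ δ / 2 := by
      rw [hm1, pow_zero, one_mul, pow_one, add_sub_cancel_left, Nat.cast_one, mul_one]
      exact pow_le_of_le_one (by positivity) (by linarith) (by positivity)
    have hr := hmerge 0 hI
    rw [zero_mul] at hr
    obtain ⟨c, n, hrun, hn, hval⟩ := hA d F δ _ (δ / 2) P 0 0 hd0 hN hne hF h0 h1
      (fun c hc S σ => (hclose 0 hI c hc S σ).trans hE) (by linarith) hr (fun h => by omega)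
      (by rw [hm1]; simp; linarith)
    refine ⟨c, n, hrun, (hsplit _ n hn).trans (add_le_add_left ?_ _), hval⟩
    have e1 : (1 : ℝ) ≤ F.net.size / δ := by
      rw [hm1, le_div_iff₀ h0']
      simpa using h1'.le
    simpa using one_le_pow₀ e1
  · obtain ⟨ht1, hΔ1⟩ := AbstractNetwork.one_le_of_two_le_size hN hm2
    have hI := AbstractNetwork.card_index_le (N := F.net)
    have hE := approximation_error_le (C := C) hd hΔ1 ht1 hm2 h0' h1' (by omega)
    have hidx : F.net.indices.card ≤ F.net.size * Δ := by
      refine Finset.card_biUnion_le.trans ((Finset.sum_le_card_nsmul _ _ Δ fun j _ => hI j).trans ?_)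
      simp
    have hD2' : (RawInput.invDelta (RawRat.ofRat δ) : ℝ) * δ ≤ 2 := by exact_mod_cast hD2
    have hD1' : 1 ≤ (RawInput.invDelta (RawRat.ofRat δ) : ℝ) * δ := by exact_mod_cast hD1
    obtain ⟨c, n, hrun, hn, hval⟩ := hA d F δ _ (δ / 16) P _ _ hd0 hN hne hF h0 h1
      (fun c hc S σ => (hclose Δ hI c hc S σ).trans hE) (by linarith) (hmerge Δ hI)
      (fun _ => le_rfl) (by
        -- Since `D ≥ 1 / δ`, a merge costs at most `δ / (32 * m)` times the norm bound, which is at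
        -- most two. The merges thus cost `δ / 16` and the approximation of the input `δ / 8`.
        have e1 : (2 : ℝ) / (64 * F.net.size * RawInput.invDelta (RawRat.ofRat δ) : ℕ) ≤
            δ / (32 * F.net.size) := by
          push_cast
          have e2 : (0 : ℝ) < RawInput.invDelta (RawRat.ofRat δ) := by
            by_contra h
            nlinarith
          rw [div_le_div_iff₀ (by positivity) (by positivity)]
          nlinarith
        have e3 : ((F.net.size : ℝ) - 1) ≤ F.net.size := by linarith
        have e4 : (1 : ℝ) ≤ F.net.size := by exact_mod_cast hm
        calc 2 * ((δ : ℝ) / 16) + (F.net.size - 1) *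
              (2 / (64 * F.net.size * RawInput.invDelta (RawRat.ofRat δ) : ℕ) * (1 + δ / 16))
            ≤ 2 * (δ / 16) + F.net.size * (δ / (32 * F.net.size) * 2) := by
              gcongr
              linarith
          _ ≤ δ := by
              have e5 : (F.net.size : ℝ) * (δ / (32 * F.net.size) * 2) = δ / 16 := by
                field_simp
                norm_num
              linarith)
    refine ⟨c, n, hrun, (hsplit _ n hn).trans (add_le_add_left ?_ _), hval⟩
    exact running_time_le hd hΔ1 ht1 hm2 h0' h1' hidx hD2' (by omega)
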